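/- Let $n\ge 1$, $0<s<1$, $2\le p<\infty$, let $\gamma$ be the standard Gaussian measure on $\mathbb{R}^n$, $d\gamma(x)=\varphi(x)\,dx=(2\pi)^{-n/2}e^{-|x|^2/2}\,dx$, let $H=\{x\in\mathbb{R}^n:x_1>0\}$ and $\mathcal{L}=-\Delta+x\cdot\nabla$. A measurable function $h$ on $H$ is called rearranged if $h=h^{\star}$ a.e. in $H$, where $h^{\star}(x)=h^{\circledast}(\Phi(x_1))$, $h^{\circledast}(r)=\inf\{t\ge 0:\gamma(\{x\in H:|h(x)|>t\})\le r\}$ and $\Phi(\lambda)=\frac{1}{\sqrt{2\pi}}\int_\lambda^\infty e^{-r^2/2}\,dr$. Let $a=1-2s$. Let $H^1_{0,L}$ be the space of functions $v$ on $H\times(0,\infty)$ with weak gradient $\nabla_{x,y}v$ such that $\iint y^a(v^2+|\nabla_{x,y}v|^2)\,d\gamma(x)\,dy<\infty$ and $v=0$ on $\partial H\times[0,\infty)$, in the sense that $v(\cdot,y)\in H^1_0(H,\gamma)$ for a.e. $y>0$; here $H^1_0(H,\gamma)$ is the closure of $C_c^\infty(H)$ in the norm $(\int_H (u^2+|\nabla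 u|^2)\,d\gamma)^{1/2}$. Write $v(\cdot,0)$ for the trace of $v$, i.e. the limit of $v(\cdot,y)$ in $L^2(H,\gamma)$ as $y\to0^+$ (through almost every $y$). For $h\in L^2(H,\gamma)$, a weak solution of $$\mathcal{L}^s\psi=h\ \text{ in } H,\qquad \psi=0\ \text{ on }\partial H,$$ is by definition the trace $\psi=w(\cdot,0)$ of a function $w\in H^1_{0,L}$ such that $$\iint_{H\times(0,\infty)}y^a\,\nabla_{x,y}w\cdot\nabla_{x,y}v\,d\gamma(x)\,dy=c_s\int_H h(x)\,v(x,0)\,d\gamma(x)\quad\text{for all } v\in H^1_{0,L},\qquad c_s=\frac{\Gamma(1-s)}{4^{s-1/2}\,\Gamma(s)}.$$ **Theorem.** There is a constant $C=C(n,p,s)>0$ such that for every rearranged $h\in L^p(H,\gamma)$ the problem above has a weak solution, and every weak solution $\psi$ of it belongs to $L^p(H,\gamma)$ and satisfies $$\|\psi\|_{L^p(H,\gamma)}\le C\,\|h\|_{L^p(H,\gamma)}.$$ -/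

import Mathlib

open MeasureTheory ProbabilityTheory Filter Topology Set
open scoped ENNReal ContDiff Gradient RealInnerProductSpace

noncomputable section

namespace FracOU

/-- The restriction to `Ω ⊆ ℝⁿ` of the standard Gaussian measure
`dγ(x) = (2π)^{-n/2} exp(-|x|²/2) dx`. -/
def gaussOn {n : ℕ} (Ω : Set (EuclideanSpace ℝ (Fin n))) : Measure (EuclideanSpace ℝ (Fin n)) :=
  (stdGaussian (EuclideanSpace ℝ (Fin n))).restrict Ω

/-- The half-space `H = {x ∈ ℝⁿ : x₁ > 0}` (the first coordinate has index `0`). -/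
def halfSpace (n : ℕ) [NeZero n] : Set (EuclideanSpace ℝ (Fin n)) := {x | 0 < x 0}

/-! ### Gaussian rearrangements -/

/-- `Φ(l) = (2π)^{-1/2} ∫_l^∞ exp(-r²/2) dr`. -/
def gaussTail (l : ℝ) : ℝ :=
  (Real.sqrt (2 * Real.pi))⁻¹ * ∫ r in Ioi l, Real.exp (-r ^ 2 / 2)

/-- The distribution function `γ_u(t) = γ({x ∈ Ω : |u(x)| > t})`. -/
def distribution {n : ℕ} (Ω : Set (EuclideanSpace ℝ (Fin n)))
    (u : EuclideanSpace ℝ (Fin n) → ℝ) (t : ℝ) : ℝ :=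
  (gaussOn Ω).real {x | t < |u x|}

/-- The one dimensional decreasing rearrangement `u^⊛(r) = inf {t ≥ 0 : γ_u(t) ≤ r}`, `r > 0`. -/
def rearr1 {n : ℕ} (Ω : Set (EuclideanSpace ℝ (Fin n)))
    (u : EuclideanSpace ℝ (Fin n) → ℝ) (r : ℝ) : ℝ :=
  sInf {t : ℝ | 0 ≤ t ∧ distribution Ω u t ≤ r}

/-- The `n`-dimensional Gaussian rearrangement `u^★(x) = u^⊛(Φ(x₁))`, considered for `x` in the
half-space `{x₁ > l}` having the same Gaussian measure as `Ω`. -/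
def rearr {n : ℕ} [NeZero n] (Ω : Set (EuclideanSpace ℝ (Fin n)))
    (u : EuclideanSpace ℝ (Fin n) → ℝ) (x : EuclideanSpace ℝ (Fin n)) : ℝ :=
  rearr1 Ω u (gaussTail (x 0))

/-- A function on `H` is rearranged if `h = h^★` almost everywhere in `H` (note `H^★ = H`). -/
def IsRearranged {n : ℕ} [NeZero n] (h : EuclideanSpace ℝ (Fin n) → ℝ) : Prop :=
  ∀ᵐ x ∂gaussOn (halfSpace n), h x = rearr (halfSpace n) h x

/-! ### Sobolev spaces -/

/-- Smooth compactly supported functions with support inside `U`. -/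
def IsTest {F : Type*} [NormedAddCommGroup F] [NormedSpace ℝ F] (U : Set F) (ζ : F → ℝ) : Prop :=
  ContDiff ℝ ∞ ζ ∧ HasCompactSupport ζ ∧ tsupport ζ ⊆ U

/-- `v ∈ H¹₀(Ω, γ)` with gradient `g`: the pair `(v, g)` is the limit of `(φⱼ, ∇φⱼ)` in
`L²(Ω, γ)` for some sequence `φⱼ ∈ C_c^∞(Ω)`. -/
def IsH10 {n : ℕ} (Ω : Set (EuclideanSpace ℝ (Fin n))) (v : EuclideanSpace ℝ (Fin n) → ℝ)
    (g : EuclideanSpace ℝ (Fin n) → EuclideanSpace ℝ (Fin n)) : Prop :=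
  MemLp v 2 (gaussOn Ω) ∧ MemLp g 2 (gaussOn Ω) ∧
    ∃ φ : ℕ → EuclideanSpace ℝ (Fin n) → ℝ, (∀ j, IsTest Ω (φ j)) ∧
      Tendsto (fun j => eLpNorm (fun x => φ j x - v x) 2 (gaussOn Ω)) atTop (𝓝 0) ∧
      Tendsto (fun j => eLpNorm (fun x => ∇ (φ j) x - g x) 2 (gaussOn Ω)) atTop (𝓝 0)

/-- The measure `dγ(x) ⊗ y^a dy` on the cylinder `Ω × (0, ∞)`, where `a = 1 - 2s`. -/
def cylMeasure {n : ℕ} (s : ℝ) (Ω : Set (EuclideanSpace ℝ (Fin n))) :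
    Measure (EuclideanSpace ℝ (Fin n) × ℝ) :=
  (gaussOn Ω).prod
    ((volume.restrict (Ioi (0 : ℝ))).withDensity fun y => ENNReal.ofReal (y ^ (1 - 2 * s)))

/-- `v` belongs to the energy space `H¹_{0,L}(Ω × (0,∞), dγ(x) ⊗ y^a dy)` and its weak gradient
is `(gx, gy)`: the functions `v`, `gx`, `gy` are square integrable with respect to
`dγ(x) ⊗ y^a dy`, `(gx, gy)` is the distributional gradient of `v` in `Ω × (0,∞)`, and `v`
vanishes on the lateral boundary `∂Ω × [0,∞)` in the sense that `v(·, y) ∈ H¹₀(Ω, γ)` (with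
gradient `gx(·, y)`) for almost every `y > 0`. -/
structure IsEnergy {n : ℕ} (s : ℝ) (Ω : Set (EuclideanSpace ℝ (Fin n)))
    (v : EuclideanSpace ℝ (Fin n) × ℝ → ℝ)
    (gx : EuclideanSpace ℝ (Fin n) × ℝ → EuclideanSpace ℝ (Fin n))
    (gy : EuclideanSpace ℝ (Fin n) × ℝ → ℝ) : Prop where
  memLp : MemLp v 2 (cylMeasure s Ω)
  memLp_x : MemLp gx 2 (cylMeasure s Ω)
  memLp_y : MemLp gy 2 (cylMeasure s Ω)
  weak_x : ∀ ζ : EuclideanSpace ℝ (Fin n) × ℝ → ℝ, IsTest (Ω ×ˢ Ioi 0) ζ → ∀ i : Fin n,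
    ∫ z in Ω ×ˢ Ioi 0, v z * fderiv ℝ ζ z (EuclideanSpace.single i 1, 0) =
      -∫ z in Ω ×ˢ Ioi 0, gx z i * ζ z
  weak_y : ∀ ζ : EuclideanSpace ℝ (Fin n) × ℝ → ℝ, IsTest (Ω ×ˢ Ioi 0) ζ →
    ∫ z in Ω ×ˢ Ioi 0, v z * fderiv ℝ ζ z (0, 1) = -∫ z in Ω ×ˢ Ioi 0, gy z * ζ z
  lateral : ∀ᵐ y ∂volume.restrict (Ioi (0 : ℝ)),
    IsH10 Ω (fun x => v (x, y)) (fun x => gx (x, y))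

/-- `u = v(·, 0)` is the trace of `v` on `Ω`: `v(·, y) → u` in `L²(Ω, γ)` as `y → 0⁺`.
As `v` is only defined almost everywhere, a null set of values `y` is disregarded. -/
def HasTrace {n : ℕ} (Ω : Set (EuclideanSpace ℝ (Fin n)))
    (v : EuclideanSpace ℝ (Fin n) × ℝ → ℝ) (u : EuclideanSpace ℝ (Fin n) → ℝ) : Prop :=
  MemLp u 2 (gaussOn Ω) ∧
    Tendsto (fun y => eLpNorm (fun x => v (x, y) - u x) 2 (gaussOn Ω))
      (𝓝[>] (0 : ℝ) ⊓ ae volume) (𝓝 0)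

/-! ### The fractional Ornstein--Uhlenbeck equation with Dirichlet boundary condition -/

/-- The constant `c_s` of the Dirichlet-to-Neumann relation
`-lim_{y → 0⁺} y^{1-2s} ∂_y w = c_s 𝓛^s w(·, 0)`. -/
def extConst (s : ℝ) : ℝ :=
  Real.Gamma (1 - s) / ((4 : ℝ) ^ (s - 1 / 2) * Real.Gamma s)

/-- `w` is a weak solution of the extension problem `-div(y^a φ ∇w) = 0` in `Ω × (0,∞)`,
`w = 0` on `∂Ω × [0,∞)`, `-lim_{y → 0⁺} y^a ∂_y w = c_s f` on `Ω`, where `φ` is the Gaussian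
density. -/
def IsWeakExtension {n : ℕ} (s : ℝ) (Ω : Set (EuclideanSpace ℝ (Fin n)))
    (f : EuclideanSpace ℝ (Fin n) → ℝ) (w : EuclideanSpace ℝ (Fin n) × ℝ → ℝ) : Prop :=
  ∃ (wx : EuclideanSpace ℝ (Fin n) × ℝ → EuclideanSpace ℝ (Fin n))
    (wy : EuclideanSpace ℝ (Fin n) × ℝ → ℝ), IsEnergy s Ω w wx wy ∧
    ∀ (v : EuclideanSpace ℝ (Fin n) × ℝ → ℝ)
      (vx : EuclideanSpace ℝ (Fin n) × ℝ → EuclideanSpace ℝ (Fin n))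
      (vy : EuclideanSpace ℝ (Fin n) × ℝ → ℝ) (v0 : EuclideanSpace ℝ (Fin n) → ℝ),
      IsEnergy s Ω v vx vy → HasTrace Ω v v0 →
      ∫ z, (⟪wx z, vx z⟫ + wy z * vy z) ∂cylMeasure s Ω =
        extConst s * ∫ x, f x * v0 x ∂gaussOn Ω

/-- `u` is a weak solution of `𝓛^s u = f` in `Ω`, `u = 0` on `∂Ω`, where `𝓛 = -Δ + x · ∇`:
it is the trace on `Ω` of a weak solution of the extension problem. -/
def IsWeakSolution {n : ℕ} (s : ℝ) (Ω : Set (EuclideanSpace ℝ (Fin n)))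
    (f u : EuclideanSpace ℝ (Fin n) → ℝ) : Prop :=
  ∃ w : EuclideanSpace ℝ (Fin n) × ℝ → ℝ, IsWeakExtension s Ω f w ∧ HasTrace Ω w u

end FracOU

end

/-!
The estimate comes from testing the extension problem with powers of the solution and bounding the
resulting energy from below by the trace inequality.

*Poincaré inequality.* On the half-space `L x₁ = x₁` with `x₁ > 0`, so that
`∫ (|∇φ|² - φ²) dγ = ∫ x₁² |∇(φ / x₁)|² dγ ≥ 0` for `φ ∈ C_c^∞(H)`; pointwise, the integrand on the
left, times the Gaussian density, dominates the `x₁`-derivative of `φ² / x₁` times the density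
(`fderiv_sq_div_mul_gaussDensity_le`). It passes to `H¹₀` (`IsH10.poincare`) and, slice by slice,
to the cylinder (`IsEnergy.poincare`).

*Traces.* A function `v` of finite energy has the form `v(x, y) = u(x) + ∫₀ʸ ∂_y v(x, t) dt`
(`exists_eq_add_primitive`), and by the Cauchy-Schwarz inequality, as `∫₀ʸ t^{2s-1} dt < ∞`, the
second term is `O(y^s)` in `L²(γ)` (`lintegral_primitive_sq_le`). Hence `u` is the trace of `v`.
Averaging over `0 < y ≤ 1` and the Poincaré inequality give the trace inequality
`‖v(·, 0)‖² ≤ C ∬ y^a |∇v|²` (`exists_trace_inequality`). The same representation makes `v`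
absolutely continuous in `y`, from which the chain rule for `f(v)` follows (`IsEnergy.comp`).

*Existence.* The functions of finite energy, with their gradients and traces, form a closed
subspace of a product of `L²` spaces on which the form `∬ y^a ∇w · ∇v` is coercive, so that the
Lax-Milgram theorem applies (`exists_isWeakSolution`).

*`L^p` estimate.* Let `w` solve the extension problem, `ψ = w(·, 0)`. If `(G')² ≤ A F'`, testing
with `F(w)` and the trace inequality for `G(w)` yield `∫ G(ψ)² ≤ C A ∫ h F(ψ)`
(`exists_energy_estimate`). With `F(t) = t |t|^{p-2}` and `G(t) = t |t|^{p/2-1}` this is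
`∫ |ψ|^p ≤ K ∫ |h| |ψ|^{p-1}`, and Hölder's inequality gives `‖ψ‖_p ≤ K ‖h‖_p`. As `F` and `G` have
to be smooth with bounded derivatives and `ψ` is not known to be in `L^p` beforehand, both are
composed with a bounded smooth truncation and regularized at the origin; the regularization is
removed by dominated convergence (`exists_integral_softTrunc_le`), the truncation by Fatou's lemma
(`exists_eLpNorm_le`).
-/

noncomputable section

namespace FracOU

/-! ### Densities and pairings with test functions -/

/-- The density of the standard Gaussian measure with respect to Lebesgue measure. -/
def gaussDensity {n : ℕ} (x : EuclideanSpace ℝ (Fin n)) : ℝ := ∏ i, gaussianPDFReal 0 1 (x i)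

lemma contDiff_gaussianPDFReal : ContDiff ℝ ∞ (gaussianPDFReal 0 1) := by
  unfold gaussianPDFReal
  fun_prop

lemma contDiff_gaussDensity {n : ℕ} : ContDiff ℝ ∞ (gaussDensity (n := n)) := by
  unfold gaussDensity
  refine contDiff_prod fun i _ => contDiff_gaussianPDFReal.comp ?_
  fun_prop

lemma gaussDensity_pos {n : ℕ} (x : EuclideanSpace ℝ (Fin n)) : 0 < gaussDensity x :=
  Finset.prod_pos fun _ _ => gaussianPDFReal_pos 0 1 _ one_ne_zero

lemma pi_gaussianReal_eq_withDensity {n : ℕ} :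
    Measure.pi (fun _ : Fin n => gaussianReal 0 1) =
      (volume : Measure (Fin n → ℝ)).withDensity
        fun x => ENNReal.ofReal (∏ i, gaussianPDFReal 0 1 (x i)) := by
  refine Measure.pi_eq fun t ht => ?_
  rw [withDensity_apply _ (MeasurableSet.univ_pi ht), volume_pi, Measure.restrict_pi_pi,
    ← ofReal_integral_eq_lintegral_ofReal]
  · rw [integral_fintype_prod_eq_prod (f := fun _ => gaussianPDFReal 0 1),
      ENNReal.ofReal_prod_of_nonneg]
    · refine Finset.prod_congr rfl fun i _ => ?_
      rw [gaussianReal_of_var_ne_zero _ one_ne_zero, withDensity_apply _ (ht i),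
        ofReal_integral_eq_lintegral_ofReal (integrable_gaussianPDFReal 0 1).integrableOn]
      · rfl
      · exact ae_of_all _ fun x => gaussianPDFReal_nonneg _ _ _
    · exact fun i _ => integral_nonneg fun x => gaussianPDFReal_nonneg _ _ _
  · exact Integrable.fintype_prod (f := fun _ => gaussianPDFReal 0 1)
      fun i => (integrable_gaussianPDFReal 0 1).integrableOn
  · exact ae_of_all _ fun x => Finset.prod_nonneg fun i _ => gaussianPDFReal_nonneg _ _ _

lemma stdGaussian_eq_withDensity {n : ℕ} :
    stdGaussian (EuclideanSpace ℝ (Fin n)) =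
      volume.withDensity fun x => ENNReal.ofReal (gaussDensity x) := by
  rw [← map_pi_eq_stdGaussian, pi_gaussianReal_eq_withDensity]
  have hmp := PiLp.volume_preserving_toLp (Fin n)
  have hme : MeasurableEmbedding (@WithLp.toLp 2 (Fin n → ℝ)) :=
    (MeasurableEquiv.toLp 2 (Fin n → ℝ)).measurableEmbedding
  ext t ht
  rw [Measure.map_apply hmp.measurable ht, withDensity_apply _ (hmp.measurable ht),
    withDensity_apply _ ht, ← hmp.setLIntegral_comp_preimage_emb hme]
  rfl

lemma gaussOn_eq_withDensity {n : ℕ} (Ω : Set (EuclideanSpace ℝ (Fin n))) :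
    gaussOn Ω = (volume.restrict Ω).withDensity fun x => ENNReal.ofReal (gaussDensity x) := by
  rw [gaussOn, stdGaussian_eq_withDensity, restrict_withDensity']

instance {n : ℕ} (Ω : Set (EuclideanSpace ℝ (Fin n))) : IsFiniteMeasure (gaussOn Ω) := by
  unfold gaussOn; infer_instance

/-- The weight `y^a dy` on `(0, ∞)`, `a = 1 - 2s`. -/
def weightMeasure (s : ℝ) : Measure ℝ :=
  (volume.restrict (Ioi (0 : ℝ))).withDensity fun y => ENNReal.ofReal (y ^ (1 - 2 * s))

instance (s : ℝ) : SFinite (weightMeasure s) := by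
  unfold weightMeasure; infer_instance

lemma cylMeasure_eq_prod {n : ℕ} (s : ℝ) (Ω : Set (EuclideanSpace ℝ (Fin n))) :
    cylMeasure s Ω = (gaussOn Ω).prod (weightMeasure s) := rfl

/-- The density of `cylMeasure` with respect to Lebesgue measure on the cylinder. -/
def cylDensity {n : ℕ} (s : ℝ) (z : EuclideanSpace ℝ (Fin n) × ℝ) : ℝ :=
  gaussDensity z.1 * z.2 ^ (1 - 2 * s)

lemma measurable_cylDensity {n : ℕ} (s : ℝ) : Measurable (cylDensity (n := n) s) :=
  (contDiff_gaussDensity.continuous.measurable.comp measurable_fst).mul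
    (measurable_snd.pow_const _)

lemma cylMeasure_eq_withDensity {n : ℕ} (s : ℝ) (Ω : Set (EuclideanSpace ℝ (Fin n))) :
    cylMeasure s Ω =
      (volume.restrict (Ω ×ˢ Ioi (0 : ℝ))).withDensity
        fun z => ENNReal.ofReal (cylDensity s z) := by
  rw [cylMeasure, gaussOn_eq_withDensity, prod_withDensity, Measure.prod_restrict]
  · congr 1
    ext z
    rw [cylDensity, ENNReal.ofReal_mul (gaussDensity_pos _).le]
  · exact contDiff_gaussDensity.continuous.measurable.ennreal_ofReal
  · exact (measurable_id.pow_const _).ennreal_ofReal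

/-- Pairing with a bounded function `κ` supported in a compact subset of `U` with respect to a
measure `m` is pairing with an `L²` function with respect to `ρ m`, when `ρ` is continuous and
positive on `U`. -/
lemma exists_memLp_pairing {X : Type*} [TopologicalSpace X] [MeasurableSpace X] [BorelSpace X]
    [T2Space X] {m : Measure X} [IsFiniteMeasureOnCompacts m] {U K : Set X}
    (hU : MeasurableSet U) {ρ : X → ℝ}
    (hρm : Measurable ρ) (hρc : ContinuousOn ρ U) (hρ : ∀ x ∈ U, 0 < ρ x) (hK : IsCompact K)
    (hKU : K ⊆ U) {κ : X → ℝ} (hκ : Measurable κ) {C : ℝ} (hC : ∀ x, |κ x| ≤ C)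
    (hκ0 : ∀ x, x ∉ K → κ x = 0) :
    ∃ k : X → ℝ,
      MemLp k 2 ((m.restrict U).withDensity fun x => ENNReal.ofReal (ρ x)) ∧
      ∀ f : X → ℝ,
        ∫ x in U, f x * κ x ∂m
          = ∫ x, f x * k x ∂((m.restrict U).withDensity fun x => ENNReal.ofReal (ρ x)) ∧
        (MemLp f 2 ((m.restrict U).withDensity fun x => ENNReal.ofReal (ρ x)) →
          IntegrableOn (fun x => f x * κ x) U m) := by
  set μ := (m.restrict U).withDensity fun x => ENNReal.ofReal (ρ x) with hμ
  have hmeas : Measurable fun x => ENNReal.ofReal (ρ x) := hρm.ennreal_ofReal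
  have hlt : ∀ᵐ x ∂m.restrict U, ENNReal.ofReal (ρ x) < ⊤ := ae_of_all _ fun x => by simp
  -- the function sought is `κ / ρ`
  have hkey : ∀ f : X → ℝ, (fun x => (ENNReal.ofReal (ρ x)).toReal • (f x * (κ x / ρ x)))
      =ᵐ[m.restrict U] fun x => f x * κ x := by
    intro f
    filter_upwards [ae_restrict_mem hU] with x hx
    have := hρ x hx
    rw [ENNReal.toReal_ofReal this.le, smul_eq_mul]
    field_simp
  have hk : MemLp (fun x => κ x / ρ x) 2 μ := by
    have hkm : Measurable fun x => κ x / ρ x := hκ.div hρm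
    rcases K.eq_empty_or_nonempty with hE | hne
    · have : (fun x => κ x / ρ x) = 0 := by
        ext x; simp [hκ0 x (by simp [hE])]
      rw [this]; exact MemLp.zero
    obtain ⟨x0, hx0, hmin⟩ := hK.exists_isMinOn hne (hρc.mono hKU)
    have hfin : μ K < ⊤ := by
      rw [hμ, withDensity_apply _ hK.isClosed.measurableSet, Measure.restrict_restrict
        hK.isClosed.measurableSet, inter_eq_left.2 hKU]
      have := ((hρc.mono hKU).integrableOn_compact (μ := m) hK).lintegral_lt_top
      exact this
    have hr0 := hρ x0 (hKU hx0)
    have hC0 : 0 ≤ C := (abs_nonneg _).trans (hC x0)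
    have hb : ∀ x, ‖κ x / ρ x‖ ≤ C / ρ x0 := by
      intro x
      by_cases hx : x ∈ K
      · rw [norm_div, Real.norm_eq_abs, Real.norm_of_nonneg (hρ x (hKU hx)).le]
        exact div_le_div₀ hC0 (hC x) hr0 (hmin hx)
      · rw [hκ0 x hx]; simp; positivity
    have : (fun x => κ x / ρ x) = K.indicator (fun x => κ x / ρ x) := by
      ext x
      by_cases hx : x ∈ K
      · simp [hx]
      · simp [hx, hκ0 x hx]
    rw [this, memLp_indicator_iff_restrict hK.isClosed.measurableSet]
    have : IsFiniteMeasure (μ.restrict K) := ⟨by simpa using hfin⟩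
    exact MemLp.of_bound hkm.aestronglyMeasurable _ (ae_of_all _ hb)
  refine ⟨_, hk, fun f => ⟨?_, fun hf => ?_⟩⟩
  · rw [hμ, integral_withDensity_eq_integral_toReal_smul hmeas hlt]
    exact (integral_congr_ae (hkey f)).symm
  · have h1 : Integrable (fun x => f x * (κ x / ρ x)) μ := hf.integrable_mul hk
    rw [hμ, integrable_withDensity_iff_integrable_smul' hmeas hlt] at h1
    exact (integrable_congr (hkey f)).1 h1

lemma exists_memLp_pairing_gauss {n : ℕ} {Ω K : Set (EuclideanSpace ℝ (Fin n))}
    (hΩ : MeasurableSet Ω) (hK : IsCompact K) (hKU : K ⊆ Ω)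
    {κ : EuclideanSpace ℝ (Fin n) → ℝ} (hκ : Measurable κ) {C : ℝ} (hC : ∀ x, |κ x| ≤ C)
    (hκ0 : ∀ x, x ∉ K → κ x = 0) :
    ∃ k : EuclideanSpace ℝ (Fin n) → ℝ, MemLp k 2 (gaussOn Ω) ∧
      ∀ f : EuclideanSpace ℝ (Fin n) → ℝ,
        ∫ x in Ω, f x * κ x = ∫ x, f x * k x ∂gaussOn Ω ∧
        (MemLp f 2 (gaussOn Ω) → IntegrableOn (fun x => f x * κ x) Ω) := by
  rw [gaussOn_eq_withDensity]
  exact exists_memLp_pairing hΩ contDiff_gaussDensity.continuous.measurable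
    contDiff_gaussDensity.continuous.continuousOn (fun x _ => gaussDensity_pos x) hK hKU hκ hC hκ0

lemma exists_memLp_pairing_cyl {n : ℕ} (s : ℝ) {Ω : Set (EuclideanSpace ℝ (Fin n))}
    {K : Set (EuclideanSpace ℝ (Fin n) × ℝ)}
    (hΩ : MeasurableSet Ω) (hK : IsCompact K) (hKU : K ⊆ Ω ×ˢ Ioi 0)
    {κ : EuclideanSpace ℝ (Fin n) × ℝ → ℝ} (hκ : Measurable κ) {C : ℝ} (hC : ∀ x, |κ x| ≤ C)
    (hκ0 : ∀ x, x ∉ K → κ x = 0) :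
    ∃ k : EuclideanSpace ℝ (Fin n) × ℝ → ℝ, MemLp k 2 (cylMeasure s Ω) ∧
      ∀ f : EuclideanSpace ℝ (Fin n) × ℝ → ℝ,
        ∫ x in Ω ×ˢ Ioi 0, f x * κ x = ∫ x, f x * k x ∂cylMeasure s Ω ∧
        (MemLp f 2 (cylMeasure s Ω) → IntegrableOn (fun x => f x * κ x) (Ω ×ˢ Ioi 0)) := by
  rw [cylMeasure_eq_withDensity]
  refine exists_memLp_pairing (hΩ.prod measurableSet_Ioi) (measurable_cylDensity s) ?_ ?_
    hK hKU hκ hC hκ0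
  · refine ((contDiff_gaussDensity.continuous.comp continuous_fst).continuousOn).mul ?_
    exact continuousOn_snd.rpow_const fun z hz => Or.inl (ne_of_gt hz.2)
  · exact fun z hz => mul_pos (gaussDensity_pos _) (Real.rpow_pos_of_pos hz.2 _)

/-- Almost everywhere statements for `cylMeasure` and for Lebesgue measure on the cylinder agree. -/
lemma ae_cylMeasure_iff {n : ℕ} {s : ℝ} {Ω : Set (EuclideanSpace ℝ (Fin n))}
    (hΩ : MeasurableSet Ω) {p : EuclideanSpace ℝ (Fin n) × ℝ → Prop} :
    (∀ᵐ z ∂cylMeasure s Ω, p z) ↔ ∀ᵐ z ∂volume.restrict (Ω ×ˢ Ioi (0 : ℝ)), p z := by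
  rw [cylMeasure_eq_withDensity, ae_withDensity_iff (measurable_cylDensity s).ennreal_ofReal]
  have : ∀ᵐ z ∂volume.restrict (Ω ×ˢ Ioi (0 : ℝ)), ENNReal.ofReal (cylDensity s z) ≠ 0 := by
    filter_upwards [ae_restrict_mem (hΩ.prod measurableSet_Ioi)] with z hz
    simpa [cylDensity] using mul_pos (gaussDensity_pos z.1) (Real.rpow_pos_of_pos hz.2 _)
  constructor
  · intro h
    filter_upwards [h, this] with z hz h0 using hz h0
  · intro h
    filter_upwards [h] with z hz _ using hz

lemma ae_weightMeasure_iff {s : ℝ} {p : ℝ → Prop} :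
    (∀ᵐ y ∂weightMeasure s, p y) ↔ ∀ᵐ y ∂volume.restrict (Ioi (0 : ℝ)), p y := by
  have hm : Measurable fun y : ℝ => ENNReal.ofReal (y ^ (1 - 2 * s)) :=
    (measurable_id.pow_const _).ennreal_ofReal
  rw [weightMeasure, ae_withDensity_iff hm]
  have : ∀ᵐ y ∂volume.restrict (Ioi (0 : ℝ)), ENNReal.ofReal (y ^ (1 - 2 * s)) ≠ 0 := by
    filter_upwards [ae_restrict_mem measurableSet_Ioi] with y hy
    simpa using Real.rpow_pos_of_pos hy _
  constructor
  · intro h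
    filter_upwards [h, this] with z hz h0 using hz h0
  · intro h
    filter_upwards [h] with z hz _ using hz

lemma ae_gaussOn_iff {n : ℕ} {Ω : Set (EuclideanSpace ℝ (Fin n))}
    {p : EuclideanSpace ℝ (Fin n) → Prop} :
    (∀ᵐ x ∂gaussOn Ω, p x) ↔ ∀ᵐ x ∂volume.restrict Ω, p x := by
  rw [gaussOn_eq_withDensity, ae_withDensity_iff
    contDiff_gaussDensity.continuous.measurable.ennreal_ofReal]
  simp [gaussDensity_pos]

/-! ### The space `H¹₀` -/

lemma eLpNorm_two_sq {X F : Type*} [MeasurableSpace X] [NormedAddCommGroup F] (f : X → F)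
    (μ : Measure X) : eLpNorm f 2 μ ^ 2 = ∫⁻ x, ‖f x‖ₑ ^ 2 ∂μ := by
  have := eLpNorm_nnreal_pow_eq_lintegral (p := 2) (f := f) (μ := μ) two_ne_zero
  simpa using this

lemma tendsto_zero_of_sq {ι : Type*} {l : Filter ι} {f : ι → ℝ≥0∞}
    (h : Tendsto (fun i => f i ^ 2) l (𝓝 0)) : Tendsto f l (𝓝 0) := by
  simpa using (ENNReal.continuous_rpow_const (y := 1 / 2)).tendsto 0 |>.comp h |>.congr
    fun j => by simp [← ENNReal.rpow_natCast_mul]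

lemma memLp_apply {n : ℕ} {X : Type*} [MeasurableSpace X] {μ : Measure X}
    {u : X → EuclideanSpace ℝ (Fin n)} (hu : MemLp u 2 μ) (i : Fin n) :
    MemLp (fun x => u x i) 2 μ :=
  (EuclideanSpace.proj i : EuclideanSpace ℝ (Fin n) →L[ℝ] ℝ).comp_memLp' hu

lemma gaussDensity_eq_exp {n : ℕ} (x : EuclideanSpace ℝ (Fin n)) :
    gaussDensity x = (√(2 * Real.pi))⁻¹ ^ n * Real.exp (-(‖x‖ ^ 2 / 2)) := by
  simp only [gaussDensity, gaussianPDFReal, EuclideanSpace.real_norm_sq_eq]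
  rw [Finset.prod_mul_distrib, ← Real.exp_sum, Finset.sum_div, ← Finset.sum_neg_distrib]
  simp [neg_div]

lemma fderiv_gaussDensity {n : ℕ} (x v : EuclideanSpace ℝ (Fin n)) :
    fderiv ℝ gaussDensity x v = -⟪x, v⟫ * gaussDensity x := by
  have h1 : HasFDerivAt (fun x : EuclideanSpace ℝ (Fin n) => ‖x‖ ^ 2) (2 • innerSL ℝ x) x :=
    (hasStrictFDerivAt_norm_sq x).hasFDerivAt
  have h2 : gaussDensity (n := n) =
      fun x => (√(2 * Real.pi))⁻¹ ^ n * Real.exp (-(‖x‖ ^ 2 * 2⁻¹)) := by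
    ext x; rw [gaussDensity_eq_exp]; rfl
  have h3 := ((h1.mul_const (2⁻¹ : ℝ)).neg.exp).const_mul ((√(2 * Real.pi))⁻¹ ^ n)
  have h4 : fderiv ℝ (gaussDensity (n := n)) x = _ := h2 ▸ h3.fderiv
  rw [h4, h2]
  simp
  ring

lemma fderiv_eq_inner_gradient {n : ℕ} (φ : EuclideanSpace ℝ (Fin n) → ℝ)
    (x v : EuclideanSpace ℝ (Fin n)) : fderiv ℝ φ x v = ⟪∇ φ x, v⟫ := by
  simp [gradient]

lemma gradient_apply {n : ℕ} (φ : EuclideanSpace ℝ (Fin n) → ℝ)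
    (x : EuclideanSpace ℝ (Fin n)) (i : Fin n) :
    ∇ φ x i = fderiv ℝ φ x (EuclideanSpace.single i 1) := by
  rw [fderiv_eq_inner_gradient, real_inner_comm, EuclideanSpace.inner_single_left]
  simp

lemma continuous_gradient {n : ℕ} {φ : EuclideanSpace ℝ (Fin n) → ℝ} (h : ContDiff ℝ ∞ φ) :
    Continuous (∇ φ) :=
  (InnerProductSpace.toDual ℝ _).symm.continuous.comp (h.continuous_fderiv (by simp))

lemma hasCompactSupport_gradient {n : ℕ} {φ : EuclideanSpace ℝ (Fin n) → ℝ}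
    (h : HasCompactSupport φ) : HasCompactSupport (∇ φ) :=
  (h.fderiv ℝ).comp_left (g := (InnerProductSpace.toDual ℝ _).symm) (map_zero _)

lemma isOpen_halfSpace (n : ℕ) [NeZero n] : IsOpen (halfSpace n) :=
  isOpen_lt continuous_const (by fun_prop)

/-- The pointwise form of the Poincaré inequality: its left-hand side is a derivative. -/
lemma fderiv_sq_div_mul_gaussDensity_le {n : ℕ} [NeZero n] {φ : EuclideanSpace ℝ (Fin n) → ℝ}
    (hφ : ContDiff ℝ ∞ φ) {x : EuclideanSpace ℝ (Fin n)} (hx : x 0 ≠ 0) :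
    fderiv ℝ (fun x => φ x ^ 2 * (x 0)⁻¹ * gaussDensity x) x (EuclideanSpace.single 0 1) ≤
      ‖∇ φ x‖ ^ 2 * gaussDensity x - φ x ^ 2 * gaussDensity x := by
  have h1 : HasFDerivAt φ (fderiv ℝ φ x) x :=
    (hφ.differentiable (by simp) x).hasFDerivAt
  have h2 : HasFDerivAt (fun x : EuclideanSpace ℝ (Fin n) => x 0)
      (EuclideanSpace.proj (0 : Fin n) : EuclideanSpace ℝ (Fin n) →L[ℝ] ℝ) x :=
    (EuclideanSpace.proj (0 : Fin n) : EuclideanSpace ℝ (Fin n) →L[ℝ] ℝ).hasFDerivAt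
  have h3 : HasFDerivAt (fun x : EuclideanSpace ℝ (Fin n) => (x 0)⁻¹) _ x :=
    (hasDerivAt_inv hx).comp_hasFDerivAt x h2
  have h4 : HasFDerivAt (gaussDensity (n := n)) (fderiv ℝ gaussDensity x) x :=
    (contDiff_gaussDensity.differentiable (by simp) x).hasFDerivAt
  have h5 := ((h1.pow 2).mul h3).mul h4
  have h6 : |∇ φ x 0| ≤ ‖∇ φ x‖ := PiLp.norm_apply_le (∇ φ x) 0
  have h7 : (∇ φ x 0) ^ 2 ≤ ‖∇ φ x‖ ^ 2 :=
    sq_le_sq' (by linarith [abs_le.1 h6]) (by linarith [abs_le.1 h6])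
  have hρ := gaussDensity_pos x
  have h8 : fderiv ℝ (fun x => φ x ^ 2 * (x 0)⁻¹ * gaussDensity x) x (EuclideanSpace.single 0 1)
      = (2 * (φ x * (x 0)⁻¹) * ∇ φ x 0 - (φ x * (x 0)⁻¹) ^ 2 - φ x ^ 2) * gaussDensity x := by
    erw [h5.fderiv]
    have h9 : fderiv ℝ gaussDensity x (EuclideanSpace.single 0 1) = -x 0 * gaussDensity x := by
      rw [fderiv_gaussDensity, real_inner_comm, EuclideanSpace.inner_single_left]
      simp
    simp [h9, ← gradient_apply]
    field_simp
    ring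
  rw [h8, ← sub_mul]
  gcongr
  nlinarith [sq_nonneg (φ x * (x 0)⁻¹ - ∇ φ x 0)]

lemma integral_gaussOn {n : ℕ} {Ω : Set (EuclideanSpace ℝ (Fin n))}
    (f : EuclideanSpace ℝ (Fin n) → ℝ) :
    ∫ x, f x ∂gaussOn Ω = ∫ x in Ω, f x * gaussDensity x := by
  rw [gaussOn_eq_withDensity, integral_withDensity_eq_integral_toReal_smul
    contDiff_gaussDensity.continuous.measurable.ennreal_ofReal (ae_of_all _ fun x => by simp)]
  simp [ENNReal.toReal_ofReal (gaussDensity_pos _).le, mul_comm]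

/-- The Poincaré inequality for test functions on the half-space; it is the identity
`∫ (|∇φ|² - φ²) dγ = ∫ x₁² |∇(φ / x₁)|² dγ ≥ 0`. -/
lemma integral_sq_le_integral_gradient_sq {n : ℕ} [NeZero n] {φ : EuclideanSpace ℝ (Fin n) → ℝ}
    (hφ : IsTest (halfSpace n) φ) :
    ∫ x, φ x ^ 2 ∂gaussOn (halfSpace n) ≤ ∫ x, ‖∇ φ x‖ ^ 2 ∂gaussOn (halfSpace n) := by
  obtain ⟨hφs, hφc, hφt⟩ := hφ
  set q : EuclideanSpace ℝ (Fin n) → ℝ := fun x => φ x ^ 2 * (x 0)⁻¹ * gaussDensity x with hq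
  have hts : tsupport q ⊆ tsupport φ := by
    refine closure_mono fun x hx => ?_
    contrapose! hx
    simp only [Function.mem_support, not_not] at hx ⊢
    simp [hq, hx]
  have hqc : HasCompactSupport q := hφc.mono' ((subset_tsupport _).trans hts)
  have hqs : ContDiff ℝ 1 q := by
    refine contDiff_iff_contDiffAt.2 fun x => ?_
    by_cases hx : x ∈ tsupport q
    swap
    · exact contDiffAt_const.congr_of_eventuallyEq (notMem_tsupport_iff_eventuallyEq.1 hx)
    have h0 : x 0 ≠ 0 := ne_of_gt (hφt (hts hx))
    refine ((hφs.contDiffAt.of_le (by simp)).pow 2).mul ?_ |>.mul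
      (contDiff_gaussDensity.contDiffAt.of_le (by simp))
    exact ContDiffAt.inv (by fun_prop) h0
  have hint : ∫ x, fderiv ℝ q x (EuclideanSpace.single 0 1) = 0 := by
    have hi1 : Integrable fun x => fderiv ℝ q x (EuclideanSpace.single 0 1) :=
      ((hqs.continuous_fderiv (by simp)).clm_apply continuous_const).integrable_of_hasCompactSupport
        (hqc.fderiv_apply ℝ _)
    have := integral_mul_fderiv_eq_neg_fderiv_mul_of_integrable (μ := volume)
      (f := fun _ : EuclideanSpace ℝ (Fin n) => (1 : ℝ)) (g := q)
      (v := EuclideanSpace.single 0 1) (by simp) (by simpa using hi1)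
      (by simpa using hqs.continuous.integrable_of_hasCompactSupport hqc)
      (fun x _ => by fun_prop) (fun x _ => hqs.differentiable (by simp) x)
    simpa using this
  have hi2 : Integrable fun x => ‖∇ φ x‖ ^ 2 * gaussDensity x := by
    refine Continuous.integrable_of_hasCompactSupport
      (((continuous_gradient hφs).norm.pow 2).mul contDiff_gaussDensity.continuous) ?_
    exact ((hasCompactSupport_gradient hφc).comp_left (g := fun v => ‖v‖ ^ 2) (by simp)).mul_right
  have hi3 : Integrable fun x => φ x ^ 2 * gaussDensity x := by
    refine Continuous.integrable_of_hasCompactSupport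
      ((hφs.continuous.pow 2).mul contDiff_gaussDensity.continuous) ?_
    exact (hφc.comp_left (g := fun v => v ^ 2) (by simp)).mul_right
  have hle : ∀ x, fderiv ℝ q x (EuclideanSpace.single 0 1) ≤
      ‖∇ φ x‖ ^ 2 * gaussDensity x - φ x ^ 2 * gaussDensity x := by
    intro x
    by_cases hx : x ∈ tsupport φ
    · exact fderiv_sq_div_mul_gaussDensity_le hφs (ne_of_gt (hφt hx))
    · have h1 : fderiv ℝ q x = 0 := by
        by_contra h
        exact hx (hts (support_fderiv_subset ℝ h))
      have h2 : φ x = 0 := image_eq_zero_of_notMem_tsupport hx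
      rw [h1, h2]
      have := gaussDensity_pos x
      simp only [zero_apply]
      have : 0 ≤ ‖∇ φ x‖ ^ 2 * gaussDensity x := by positivity
      linarith
  have hmono := integral_mono ((hqs.continuous_fderiv (by simp)).clm_apply
    continuous_const |>.integrable_of_hasCompactSupport (hqc.fderiv_apply ℝ _)) (hi2.sub hi3) hle
  rw [hint] at hmono
  have hsub : ∫ x, (‖∇ φ x‖ ^ 2 * gaussDensity x - φ x ^ 2 * gaussDensity x) =
      (∫ x, ‖∇ φ x‖ ^ 2 * gaussDensity x) - ∫ x, φ x ^ 2 * gaussDensity x := integral_sub hi2 hi3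
  have hmono' : 0 ≤ ∫ x, (‖∇ φ x‖ ^ 2 * gaussDensity x - φ x ^ 2 * gaussDensity x) := hmono
  rw [hsub] at hmono'
  have hz : ∀ x, x ∉ halfSpace n → φ x = 0 ∧ ∇ φ x = 0 := by
    intro x hx
    have hx' : x ∉ tsupport φ := fun h => hx (hφt h)
    refine ⟨image_eq_zero_of_notMem_tsupport hx', ?_⟩
    have : fderiv ℝ φ x = 0 := by
      by_contra h
      exact hx' (support_fderiv_subset ℝ h)
    simp [gradient, this]
  rw [integral_gaussOn, integral_gaussOn, setIntegral_eq_integral_of_forall_compl_eq_zero,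
    setIntegral_eq_integral_of_forall_compl_eq_zero]
  · linarith
  · intro x hx; simp [(hz x hx).2]
  · intro x hx; simp [(hz x hx).1]

lemma IsTest.memLp {n : ℕ} {Ω : Set (EuclideanSpace ℝ (Fin n))}
    {φ : EuclideanSpace ℝ (Fin n) → ℝ} (hφ : IsTest Ω φ) : MemLp φ 2 (gaussOn Ω) :=
  hφ.1.continuous.memLp_of_hasCompactSupport hφ.2.1

lemma IsTest.memLp_gradient {n : ℕ} {Ω : Set (EuclideanSpace ℝ (Fin n))}
    {φ : EuclideanSpace ℝ (Fin n) → ℝ} (hφ : IsTest Ω φ) : MemLp (∇ φ) 2 (gaussOn Ω) :=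
  (continuous_gradient hφ.1).memLp_of_hasCompactSupport (hasCompactSupport_gradient hφ.2.1)

lemma eLpNorm_le_of_integral_sq_le {X F G : Type*} [MeasurableSpace X] {μ : Measure X}
    [NormedAddCommGroup F] [NormedAddCommGroup G] {f : X → F} {g : X → G} (hf : MemLp f 2 μ)
    (hg : MemLp g 2 μ) (h : ∫ x, ‖f x‖ ^ 2 ∂μ ≤ ∫ x, ‖g x‖ ^ 2 ∂μ) :
    eLpNorm f 2 μ ≤ eLpNorm g 2 μ := by
  rw [hf.eLpNorm_eq_integral_rpow_norm two_ne_zero (by simp),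
    hg.eLpNorm_eq_integral_rpow_norm two_ne_zero (by simp)]
  refine ENNReal.ofReal_le_ofReal (Real.rpow_le_rpow ?_ ?_ (by positivity))
  · exact integral_nonneg fun x => by positivity
  · simpa using h

lemma IsTest.poincare {n : ℕ} [NeZero n] {φ : EuclideanSpace ℝ (Fin n) → ℝ}
    (hφ : IsTest (halfSpace n) φ) :
    eLpNorm φ 2 (gaussOn (halfSpace n)) ≤ eLpNorm (∇ φ) 2 (gaussOn (halfSpace n)) :=
  eLpNorm_le_of_integral_sq_le hφ.memLp hφ.memLp_gradient
    (by simpa using integral_sq_le_integral_gradient_sq hφ)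

lemma eLpNorm_le_add_eLpNorm_sub {X F : Type*} [MeasurableSpace X] {μ : Measure X}
    [NormedAddCommGroup F] {f g : X → F} (hf : AEStronglyMeasurable f μ)
    (hg : AEStronglyMeasurable g μ) :
    eLpNorm f 2 μ ≤ eLpNorm g 2 μ + eLpNorm (fun x => f x - g x) 2 μ := by
  have h : f = g + fun x => f x - g x := by ext x; simp
  calc eLpNorm f 2 μ = eLpNorm (g + fun x => f x - g x) 2 μ := by rw [← h]
    _ ≤ _ := eLpNorm_add_le hg (hf.sub hg) (by norm_num)

lemma eLpNorm_sub_comm' {X F : Type*} [MeasurableSpace X] {μ : Measure X}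
    [NormedAddCommGroup F] (f g : X → F) :
    eLpNorm (fun x => f x - g x) 2 μ = eLpNorm (fun x => g x - f x) 2 μ :=
  eLpNorm_sub_comm f g 2 μ

/-- The Poincaré inequality in `H¹₀` of the half-space. -/
lemma IsH10.poincare {n : ℕ} [NeZero n] {v : EuclideanSpace ℝ (Fin n) → ℝ}
    {g : EuclideanSpace ℝ (Fin n) → EuclideanSpace ℝ (Fin n)} (h : IsH10 (halfSpace n) v g) :
    eLpNorm v 2 (gaussOn (halfSpace n)) ≤ eLpNorm g 2 (gaussOn (halfSpace n)) := by
  obtain ⟨hv, hg, φ, hφ, h1, h2⟩ := h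
  have hlim : Tendsto (fun j => eLpNorm g 2 (gaussOn (halfSpace n)) +
      eLpNorm (fun x => ∇ (φ j) x - g x) 2 (gaussOn (halfSpace n)) +
      eLpNorm (fun x => φ j x - v x) 2 (gaussOn (halfSpace n))) atTop
      (𝓝 (eLpNorm g 2 (gaussOn (halfSpace n)) + 0 + 0)) := (h2.const_add _).add h1
  rw [add_zero, add_zero] at hlim
  refine ge_of_tendsto' hlim fun j => ?_
  calc eLpNorm v 2 (gaussOn (halfSpace n))
      ≤ eLpNorm (φ j) 2 (gaussOn (halfSpace n)) +
        eLpNorm (fun x => v x - φ j x) 2 (gaussOn (halfSpace n)) :=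
        eLpNorm_le_add_eLpNorm_sub hv.1 (hφ j).memLp.1
    _ ≤ _ := by
        rw [eLpNorm_sub_comm']
        gcongr
        exact (hφ j).poincare.trans (eLpNorm_le_add_eLpNorm_sub (hφ j).memLp_gradient.1 hg.1)

lemma tendsto_eLpNorm_add {X F : Type*} [MeasurableSpace X] {μ : Measure X}
    [NormedAddCommGroup F] {f g : ℕ → X → F} (hf : ∀ j, AEStronglyMeasurable (f j) μ)
    (hg : ∀ j, AEStronglyMeasurable (g j) μ)
    (h1 : Tendsto (fun j => eLpNorm (f j) 2 μ) atTop (𝓝 0))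
    (h2 : Tendsto (fun j => eLpNorm (g j) 2 μ) atTop (𝓝 0)) :
    Tendsto (fun j => eLpNorm (fun x => f j x + g j x) 2 μ) atTop (𝓝 0) := by
  have h := h1.add h2
  rw [add_zero] at h
  exact tendsto_of_tendsto_of_tendsto_of_le_of_le tendsto_const_nhds h (fun _ => zero_le)
    fun j => eLpNorm_add_le (hf j) (hg j) (by norm_num)

/-- `H¹₀` is closed in `L²`. -/
lemma IsH10.of_tendsto {n : ℕ} {Ω : Set (EuclideanSpace ℝ (Fin n))}
    {v : ℕ → EuclideanSpace ℝ (Fin n) → ℝ}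
    {g : ℕ → EuclideanSpace ℝ (Fin n) → EuclideanSpace ℝ (Fin n)}
    {v' : EuclideanSpace ℝ (Fin n) → ℝ}
    {g' : EuclideanSpace ℝ (Fin n) → EuclideanSpace ℝ (Fin n)}
    (h : ∀ j, IsH10 Ω (v j) (g j)) (hv : MemLp v' 2 (gaussOn Ω)) (hg : MemLp g' 2 (gaussOn Ω))
    (h1 : Tendsto (fun j => eLpNorm (fun x => v j x - v' x) 2 (gaussOn Ω)) atTop (𝓝 0))
    (h2 : Tendsto (fun j => eLpNorm (fun x => g j x - g' x) 2 (gaussOn Ω)) atTop (𝓝 0)) :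
    IsH10 Ω v' g' := by
  refine ⟨hv, hg, ?_⟩
  have hex : ∀ j : ℕ, ∃ φ, IsTest Ω φ ∧
      eLpNorm (fun x => φ x - v j x) 2 (gaussOn Ω) ≤ ((j : ℝ≥0∞) + 1)⁻¹ ∧
      eLpNorm (fun x => ∇ φ x - g j x) 2 (gaussOn Ω) ≤ ((j : ℝ≥0∞) + 1)⁻¹ := by
    intro j
    obtain ⟨_, _, φ, hφ, a, b⟩ := h j
    have hpos : (0 : ℝ≥0∞) < ((j : ℝ≥0∞) + 1)⁻¹ := by simp
    obtain ⟨k, hk1, hk2⟩ := ((a.eventually_le_const hpos).and (b.eventually_le_const hpos)).exists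
    exact ⟨φ k, hφ k, hk1, hk2⟩
  choose φ hφ ha hb using hex
  have hz : Tendsto (fun j : ℕ => ((j : ℝ≥0∞) + 1)⁻¹) atTop (𝓝 0) := by
    have := (ENNReal.tendsto_inv_nat_nhds_zero).comp (tendsto_add_atTop_nat 1)
    refine this.congr fun j => ?_
    simp
  refine ⟨φ, hφ, ?_, ?_⟩
  · have := tendsto_eLpNorm_add (fun j => (hφ j).memLp.1.sub (h j).1.1)
      (fun j => (h j).1.1.sub hv.1)
      (tendsto_of_tendsto_of_tendsto_of_le_of_le tendsto_const_nhds hz (fun _ => zero_le) ha) h1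
    refine this.congr fun j => ?_
    congr 1; ext x; simp
  · have := tendsto_eLpNorm_add (fun j => (hφ j).memLp_gradient.1.sub (h j).2.1.1)
      (fun j => (h j).2.1.1.sub hg.1)
      (tendsto_of_tendsto_of_tendsto_of_le_of_le tendsto_const_nhds hz (fun _ => zero_le) hb) h2
    refine this.congr fun j => ?_
    congr 1; ext x; simp

lemma IsTest.add {F : Type*} [NormedAddCommGroup F] [NormedSpace ℝ F] {U : Set F} {φ ψ : F → ℝ}
    (hφ : IsTest U φ) (hψ : IsTest U ψ) : IsTest U (fun x => φ x + ψ x) :=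
  ⟨hφ.1.add hψ.1, hφ.2.1.add hψ.2.1,
    (tsupport_add φ ψ).trans (union_subset hφ.2.2 hψ.2.2)⟩

lemma IsTest.comp {F : Type*} [NormedAddCommGroup F] [NormedSpace ℝ F] {U : Set F} {φ : F → ℝ}
    (hφ : IsTest U φ) {f : ℝ → ℝ} (hf : ContDiff ℝ ∞ f) (h0 : f 0 = 0) :
    IsTest U (fun x => f (φ x)) :=
  ⟨hf.comp hφ.1, hφ.2.1.comp_left h0, (closure_mono fun x hx => by
    contrapose! hx
    simp only [Function.mem_support, not_not] at hx ⊢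
    simp [hx, h0]).trans hφ.2.2⟩

lemma gradient_comp {n : ℕ} {φ : EuclideanSpace ℝ (Fin n) → ℝ} {f : ℝ → ℝ}
    {x : EuclideanSpace ℝ (Fin n)} (hφ : DifferentiableAt ℝ φ x)
    (hf : DifferentiableAt ℝ f (φ x)) :
    ∇ (fun x => f (φ x)) x = deriv f (φ x) • ∇ φ x := by
  have := hf.hasDerivAt.comp_hasFDerivAt x hφ.hasFDerivAt
  have h2 : fderiv ℝ (fun x => f (φ x)) x = deriv f (φ x) • fderiv ℝ φ x := this.fderiv
  simp [gradient, h2]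

lemma gradient_add {n : ℕ} {φ ψ : EuclideanSpace ℝ (Fin n) → ℝ} {x : EuclideanSpace ℝ (Fin n)}
    (hφ : DifferentiableAt ℝ φ x) (hψ : DifferentiableAt ℝ ψ x) :
    ∇ (fun x => φ x + ψ x) x = ∇ φ x + ∇ ψ x := by
  simp [gradient, fderiv_fun_add hφ hψ]

lemma IsTest.differentiableAt {F : Type*} [NormedAddCommGroup F] [NormedSpace ℝ F] {U : Set F}
    {φ : F → ℝ} (hφ : IsTest U φ) (x : F) : DifferentiableAt ℝ φ x :=
  hφ.1.differentiable (by simp) x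

lemma IsH10.add {n : ℕ} {Ω : Set (EuclideanSpace ℝ (Fin n))}
    {v v' : EuclideanSpace ℝ (Fin n) → ℝ}
    {g g' : EuclideanSpace ℝ (Fin n) → EuclideanSpace ℝ (Fin n)}
    (h : IsH10 Ω v g) (h' : IsH10 Ω v' g') :
    IsH10 Ω (fun x => v x + v' x) (fun x => g x + g' x) := by
  obtain ⟨hv, hg, φ, hφ, h1, h2⟩ := h
  obtain ⟨hv', hg', φ', hφ', h1', h2'⟩ := h'
  refine ⟨hv.add hv', hg.add hg', fun j x => φ j x + φ' j x, fun j => (hφ j).add (hφ' j), ?_, ?_⟩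
  · have := tendsto_eLpNorm_add (fun j => (hφ j).memLp.1.sub hv.1)
      (fun j => (hφ' j).memLp.1.sub hv'.1) h1 h1'
    refine this.congr fun j => ?_
    congr 1; ext x; simp; ring
  · have := tendsto_eLpNorm_add (fun j => (hφ j).memLp_gradient.1.sub hg.1)
      (fun j => (hφ' j).memLp_gradient.1.sub hg'.1) h2 h2'
    refine this.congr fun j => ?_
    congr 1; ext x
    rw [gradient_add ((hφ j).differentiableAt x) ((hφ' j).differentiableAt x)]
    simp; ring

/-- The chain rule in `H¹₀`. -/
lemma IsH10.comp {n : ℕ} {Ω : Set (EuclideanSpace ℝ (Fin n))} {v : EuclideanSpace ℝ (Fin n) → ℝ}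
    {g : EuclideanSpace ℝ (Fin n) → EuclideanSpace ℝ (Fin n)} (h : IsH10 Ω v g) {f : ℝ → ℝ}
    (hf : ContDiff ℝ ∞ f) (h0 : f 0 = 0) {L : NNReal} (hL : ∀ t, ‖deriv f t‖₊ ≤ L) :
    IsH10 Ω (fun x => f (v x)) (fun x => deriv f (v x) • g x) := by
  obtain ⟨hv, hg, φ, hφ, h1, h2⟩ := h
  have hlip : LipschitzWith L f := lipschitzWith_of_nnnorm_deriv_le (hf.differentiable (by simp)) hL
  have hd : Continuous (deriv f) := hf.continuous_deriv (by simp)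
  -- along a subsequence the approximating functions converge almost everywhere
  obtain ⟨ns, hns, hae⟩ := (tendstoInMeasure_of_tendsto_eLpNorm two_ne_zero
    (fun j => (hφ j).memLp.1) hv.1 h1).exists_seq_tendsto_ae
  have hL' : ∀ t, ‖deriv f t‖ ≤ L := fun t => hL t
  refine ⟨?_, ?_, fun j x => f (φ (ns j) x), fun j => (hφ _).comp hf h0, ?_, ?_⟩
  · exact hlip.comp_memLp h0 hv
  · refine (hg.norm.const_mul L).of_le ((hd.comp_aestronglyMeasurable hv.1).smul hg.1)
      (ae_of_all _ fun x => ?_)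
    rw [norm_smul, norm_mul, norm_norm]
    gcongr
    exact (hL' (v x)).trans (le_abs_self _)
  · have hlim : Tendsto (fun j => (L : ℝ≥0∞) *
        eLpNorm (fun x => φ (ns j) x - v x) 2 (gaussOn Ω)) atTop (𝓝 (L * 0)) :=
      ENNReal.Tendsto.const_mul (h1.comp hns.tendsto_atTop) (Or.inr (by simp))
    rw [mul_zero] at hlim
    refine tendsto_of_tendsto_of_tendsto_of_le_of_le tendsto_const_nhds hlim (fun _ => zero_le)
      fun j => ?_
    refine eLpNorm_le_nnreal_smul_eLpNorm_of_ae_le_mul (ae_of_all _ fun x => ?_) 2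
    simpa [nndist_eq_nnnorm] using hlip.nndist_le (φ (ns j) x) (v x)
  · -- `f'(φⱼ) ∇φⱼ - f'(v) g = f'(φⱼ) (∇φⱼ - g) + (f'(φⱼ) - f'(v)) g`; the second term tends to
    -- zero by dominated convergence
    have ha : Tendsto (fun j => eLpNorm (fun x => deriv f (φ (ns j) x) •
        (∇ (φ (ns j)) x - g x)) 2 (gaussOn Ω)) atTop (𝓝 0) := by
      have hlim : Tendsto (fun j => (L : ℝ≥0∞) *
          eLpNorm (fun x => ∇ (φ (ns j)) x - g x) 2 (gaussOn Ω)) atTop (𝓝 (L * 0)) :=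
        ENNReal.Tendsto.const_mul (h2.comp hns.tendsto_atTop) (Or.inr (by simp))
      rw [mul_zero] at hlim
      refine tendsto_of_tendsto_of_tendsto_of_le_of_le tendsto_const_nhds hlim (fun _ => zero_le)
        fun j => ?_
      refine eLpNorm_le_nnreal_smul_eLpNorm_of_ae_le_mul (ae_of_all _ fun x => ?_) 2
      rw [nnnorm_smul]
      gcongr
      exact hL _
    have hb : Tendsto (fun j => eLpNorm (fun x => (deriv f (φ (ns j) x) - deriv f (v x)) •
        g x) 2 (gaussOn Ω)) atTop (𝓝 0) := by
      have hsq : Tendsto (fun j => eLpNorm (fun x => (deriv f (φ (ns j) x) - deriv f (v x)) •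
          g x) 2 (gaussOn Ω) ^ 2) atTop (𝓝 0) := by
        simp_rw [eLpNorm_two_sq]
        rw [show (0 : ℝ≥0∞) = ∫⁻ x, 0 ∂gaussOn Ω by simp]
        refine tendsto_lintegral_of_dominated_convergence'
          (fun x => (2 * L * ‖g x‖ₑ) ^ 2) (fun j => ?_) (fun j => ae_of_all _ fun x => ?_) ?_ ?_
        · exact ((((hd.comp_aestronglyMeasurable (hφ _).memLp.1).sub
            (hd.comp_aestronglyMeasurable hv.1)).smul hg.1).enorm.pow_const 2)
        · simp only [enorm_smul]
          gcongr
          calc ‖deriv f (φ (ns j) x) - deriv f (v x)‖ₑ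
              ≤ ‖deriv f (φ (ns j) x)‖ₑ + ‖deriv f (v x)‖ₑ := enorm_sub_le
            _ ≤ L + L := by
                gcongr
                · exact ENNReal.coe_le_coe.2 (hL _)
                · exact ENNReal.coe_le_coe.2 (hL _)
            _ = 2 * L := by ring
        · simp_rw [mul_pow]
          rw [lintegral_const_mul'' _ (hg.1.enorm.pow_const 2), ← eLpNorm_two_sq]
          exact ENNReal.mul_ne_top (by finiteness) (by simpa using hg.2.ne)
        · filter_upwards [hae] with x hx
          have h3 : Tendsto (fun j => (deriv f (φ (ns j) x) - deriv f (v x)) • g x) atTop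
              (𝓝 ((deriv f (v x) - deriv f (v x)) • g x)) :=
            (((hd.tendsto _).comp hx).sub_const _).smul_const _
          have h4 := ((ENNReal.continuous_pow 2).tendsto _).comp h3.enorm
          simpa [Function.comp_def] using h4
      exact tendsto_zero_of_sq hsq
    have := tendsto_eLpNorm_add (fun j => (hd.comp_aestronglyMeasurable (hφ _).memLp.1).smul
      ((hφ _).memLp_gradient.1.sub hg.1)) (fun j => ((hd.comp_aestronglyMeasurable
      (hφ _).memLp.1).sub (hd.comp_aestronglyMeasurable hv.1)).smul hg.1) ha hb
    refine this.congr fun j => ?_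
    congr 1; ext x
    rw [gradient_comp ((hφ _).differentiableAt x) (hf.differentiable (by simp) _)]
    simp; ring

lemma tendsto_integral_mul_of_eLpNorm {X : Type*} [MeasurableSpace X] {μ : Measure X}
    {f : ℕ → X → ℝ} {f' k : X → ℝ} (hf : ∀ j, MemLp (f j) 2 μ) (hf' : MemLp f' 2 μ)
    (hk : MemLp k 2 μ) (h : Tendsto (fun j => eLpNorm (fun x => f j x - f' x) 2 μ) atTop (𝓝 0)) :
    Tendsto (fun j => ∫ x, f j x * k x ∂μ) atTop (𝓝 (∫ x, f' x * k x ∂μ)) := by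
  refine tendsto_integral_of_L1 _ (hf'.integrable_mul hk).1
    (Eventually.of_forall fun j => (hf j).integrable_mul hk) ?_
  have hlim : Tendsto (fun j => eLpNorm (fun x => f j x - f' x) 2 μ * eLpNorm k 2 μ) atTop
      (𝓝 (0 * eLpNorm k 2 μ)) := ENNReal.Tendsto.mul_const h (Or.inr hk.2.ne)
  rw [zero_mul] at hlim
  refine tendsto_of_tendsto_of_tendsto_of_le_of_le tendsto_const_nhds hlim (fun _ => zero_le)
    fun j => ?_
  have h1 := eLpNorm_smul_le_mul_eLpNorm (p := 2) (q := 2) (r := 1) hk.1 ((hf j).sub hf').1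
    (μ := μ)
  rw [eLpNorm_one_eq_lintegral_enorm] at h1
  refine le_trans (lintegral_mono fun x => ?_) h1
  simp [sub_mul]

lemma IsTest.exists_bound_fderiv {F : Type*} [NormedAddCommGroup F] [NormedSpace ℝ F]
    {U : Set F} {ζ : F → ℝ} (hζ : IsTest U ζ) (v : F) : ∃ C, ∀ x, |fderiv ℝ ζ x v| ≤ C :=
  (hζ.2.1.fderiv_apply ℝ v).exists_bound_of_continuous
    ((hζ.1.continuous_fderiv (by simp)).clm_apply continuous_const)

lemma IsTest.exists_bound {F : Type*} [NormedAddCommGroup F] [NormedSpace ℝ F]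
    {U : Set F} {ζ : F → ℝ} (hζ : IsTest U ζ) : ∃ C, ∀ x, |ζ x| ≤ C :=
  hζ.2.1.exists_bound_of_continuous hζ.1.continuous

lemma IsTest.fderiv_eq_zero {F : Type*} [NormedAddCommGroup F] [NormedSpace ℝ F]
    {U : Set F} {ζ : F → ℝ} (_ : IsTest U ζ) {x : F} (hx : x ∉ tsupport ζ) (v : F) :
    fderiv ℝ ζ x v = 0 := by
  have : fderiv ℝ ζ x = 0 := by
    by_contra h
    exact hx (support_fderiv_subset ℝ h)
  simp [this]

lemma IsTest.measurable_fderiv {F : Type*} [NormedAddCommGroup F] [NormedSpace ℝ F]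
    [MeasurableSpace F] [BorelSpace F]
    {U : Set F} {ζ : F → ℝ} (hζ : IsTest U ζ) (v : F) : Measurable fun x => fderiv ℝ ζ x v :=
  ((hζ.1.continuous_fderiv (by simp)).clm_apply continuous_const).measurable

/-- The second component of an element of `H¹₀` is the distributional gradient of the first. -/
lemma IsH10.weak {n : ℕ} {Ω : Set (EuclideanSpace ℝ (Fin n))} (hΩ : MeasurableSet Ω)
    {v : EuclideanSpace ℝ (Fin n) → ℝ}
    {g : EuclideanSpace ℝ (Fin n) → EuclideanSpace ℝ (Fin n)} (h : IsH10 Ω v g)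
    {ζ : EuclideanSpace ℝ (Fin n) → ℝ} (hζ : IsTest Ω ζ) (i : Fin n) :
    ∫ x in Ω, v x * fderiv ℝ ζ x (EuclideanSpace.single i 1) = -∫ x in Ω, g x i * ζ x := by
  obtain ⟨hv, hg, φ, hφ, h1, h2⟩ := h
  obtain ⟨C, hC⟩ := hζ.exists_bound
  obtain ⟨C', hC'⟩ := hζ.exists_bound_fderiv (EuclideanSpace.single i 1)
  obtain ⟨k, hk, hk1⟩ := exists_memLp_pairing_gauss hΩ hζ.2.1 hζ.2.2
    hζ.1.continuous.measurable hC fun x hx => image_eq_zero_of_notMem_tsupport hx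
  obtain ⟨k', hk', hk1'⟩ := exists_memLp_pairing_gauss hΩ hζ.2.1 hζ.2.2
    (hζ.measurable_fderiv (EuclideanSpace.single i 1)) hC' fun x hx => hζ.fderiv_eq_zero hx _
  have hl := tendsto_integral_mul_of_eLpNorm (fun j => (hφ j).memLp) hv hk' h1
  have hr := tendsto_integral_mul_of_eLpNorm (f := fun j x => ∇ (φ j) x i)
    (fun j => memLp_apply (hφ j).memLp_gradient i) (memLp_apply hg i) hk (by
      refine tendsto_of_tendsto_of_tendsto_of_le_of_le tendsto_const_nhds h2 (fun _ => zero_le)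
        fun j => eLpNorm_mono fun x => ?_
      exact PiLp.norm_apply_le (∇ (φ j) x - g x) i)
  rw [(hk1' v).1, (hk1 _).1]
  refine tendsto_nhds_unique hl (hr.neg.congr fun j => ?_)
  rw [← (hk1' _).1, ← (hk1 _).1]
  have hout : ∀ x, x ∉ Ω → x ∉ tsupport ζ := fun x hx h => hx (hζ.2.2 h)
  rw [setIntegral_eq_integral_of_forall_compl_eq_zero,
    setIntegral_eq_integral_of_forall_compl_eq_zero]
  · have hcd := ((hζ.1.continuous_fderiv (by simp)).clm_apply
      (continuous_const (y := EuclideanSpace.single i (1 : ℝ))))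
    have hcd' := (((hφ j).1.continuous_fderiv (by simp)).clm_apply
      (continuous_const (y := EuclideanSpace.single i (1 : ℝ))))
    have := integral_mul_fderiv_eq_neg_fderiv_mul_of_integrable (μ := volume) (f := φ j) (g := ζ)
      (v := EuclideanSpace.single i (1 : ℝ))
      ((hcd'.mul hζ.1.continuous).integrable_of_hasCompactSupport hζ.2.1.mul_left)
      (((hφ j).1.continuous.mul hcd).integrable_of_hasCompactSupport (hφ j).2.1.mul_right)
      (((hφ j).1.continuous.mul hζ.1.continuous).integrable_of_hasCompactSupport hζ.2.1.mul_left)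
      (fun x _ => (hφ j).differentiableAt x) (fun x _ => hζ.differentiableAt x)
    simp only [gradient_apply]
    exact this.symm
  · intro x hx; simp [hζ.fderiv_eq_zero (hout x hx)]
  · intro x hx; simp [image_eq_zero_of_notMem_tsupport (hout x hx)]

/-! ### Regularity in the extension variable -/

lemma _root_.AbsolutelyContinuousOnInterval.lipschitz_comp {u f : ℝ → ℝ} {a b : ℝ}
    (hu : AbsolutelyContinuousOnInterval u a b) {L : NNReal} (hf : LipschitzWith L f) :
    AbsolutelyContinuousOnInterval (fun x => f (u x)) a b := by
  unfold AbsolutelyContinuousOnInterval at *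
  refine squeeze_zero (fun E => Finset.sum_nonneg fun i _ => dist_nonneg) (fun E => ?_)
    (by simpa using hu.const_mul (L : ℝ))
  rw [Finset.mul_sum]
  exact Finset.sum_le_sum fun i _ => hf.dist_le_mul _ _

/-- Integration by parts for a smooth function of a primitive. -/
lemma setIntegral_comp_primitive_mul_deriv {g : ℝ → ℝ} {R : ℝ} (hR : 0 < R)
    (hg : IntegrableOn g (Ioc 0 R)) (c : ℝ) {f : ℝ → ℝ} (hf : ContDiff ℝ ∞ f) {L : NNReal}
    (hL : ∀ t, ‖deriv f t‖₊ ≤ L) {η : ℝ → ℝ} (hη : ContDiff ℝ 1 η)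
    (hη0 : ∀ y, y ∉ Ioo 0 R → η y = 0) (hηd : ∀ y, y ∉ Ioo 0 R → deriv η y = 0) :
    ∫ y in Ioi 0, f (c + ∫ t in (0)..y, g t) * deriv η y =
      -∫ y in Ioi 0, deriv f (c + ∫ t in (0)..y, g t) * g y * η y := by
  have hlip : LipschitzWith L f := lipschitzWith_of_nnnorm_deriv_le (hf.differentiable (by simp)) hL
  have hgi : IntervalIntegrable g volume 0 R :=
    (intervalIntegrable_iff_integrableOn_Ioc_of_le hR.le).2 hg
  have hac : AbsolutelyContinuousOnInterval (fun y => c + ∫ t in (0)..y, g t) 0 R := by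
    have h1 := hgi.absolutelyContinuousOnInterval_intervalIntegral (c := 0) (by simp)
    have h2 : AbsolutelyContinuousOnInterval (fun _ : ℝ => c) 0 R :=
      (LipschitzWith.const c).lipschitzOnWith.absolutelyContinuousOnInterval
    exact h2.add h1
  have hcut : ∀ {k : ℝ → ℝ}, (∀ y, y ∉ Ioo 0 R → k y = 0) →
      ∫ y in Ioi 0, k y = ∫ y in (0)..R, k y := by
    intro k hk
    rw [intervalIntegral.integral_of_le hR.le]
    refine (setIntegral_eq_of_subset_of_forall_sdiff_eq_zero measurableSet_Ioi
      (fun y hy => hy.1) fun y hy => hk y ?_)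
    exact fun h => hy.2 ⟨h.1, h.2.le⟩
  rw [hcut fun y hy => by simp [hηd y hy], hcut fun y hy => by simp [hη0 y hy]]
  have hηac : AbsolutelyContinuousOnInterval η 0 R := hη.contDiffOn.absolutelyContinuousOnInterval
  rw [(hac.lipschitz_comp hlip).integral_mul_deriv_eq_deriv_mul hηac, hη0 R (by simp),
    hη0 0 (by simp)]
  simp only [mul_zero, sub_zero, zero_sub, neg_inj]
  refine intervalIntegral.integral_congr_ae ?_
  filter_upwards [hgi.ae_hasDerivAt_integral] with y hy hyR
  have h1 := (hy (uIoc_subset_uIcc hyR) 0 (by simp)).const_add c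
  have h2 := ((hf.differentiable (by simp) _).hasDerivAt).comp y h1
  have h3 : deriv (fun x => f (c + ∫ t in (0)..x, g t)) y = _ := h2.deriv
  rw [h3]

lemma lintegral_Ioc_rpow {s : ℝ} (hs : 0 < s) {y : ℝ} (hy : 0 < y) :
    ∫⁻ t in Ioc 0 y, ENNReal.ofReal (t ^ (2 * s - 1)) = ENNReal.ofReal (y ^ (2 * s) / (2 * s)) := by
  have hi : IntegrableOn (fun t : ℝ => t ^ (2 * s - 1)) (Ioc 0 y) :=
    (intervalIntegrable_iff_integrableOn_Ioc_of_le hy.le).1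
      (intervalIntegral.intervalIntegrable_rpow' (by linarith))
  rw [← ofReal_integral_eq_lintegral_ofReal hi
    ((ae_restrict_mem measurableSet_Ioc).mono fun t ht => Real.rpow_nonneg ht.1.le _),
    ← intervalIntegral.integral_of_le hy.le, integral_rpow (Or.inl (by linarith))]
  rw [sub_add_cancel, Real.zero_rpow (by linarith), sub_zero]

/-- The Cauchy-Schwarz inequality `(∫₀ʸ |q|)² ≤ (∫₀ʸ t^{-a} dt) (∫₀^∞ q² t^a dt)`. -/
lemma lintegral_Ioc_enorm_sq_le {s : ℝ} (hs : 0 < s) {q : ℝ → ℝ}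
    (hq : AEStronglyMeasurable q (volume.restrict (Ioi 0))) {y : ℝ} (hy : 0 < y) :
    (∫⁻ t in Ioc 0 y, ‖q t‖ₑ) ^ 2 ≤
      ENNReal.ofReal (y ^ (2 * s) / (2 * s)) * ∫⁻ t, ‖q t‖ₑ ^ 2 ∂weightMeasure s := by
  have hq' : AEMeasurable (fun t => ‖q t‖ₑ) (volume.restrict (Ioc 0 y)) :=
    hq.enorm.mono_measure (Measure.restrict_mono (fun t ht => ht.1) le_rfl)
  have hm1 : Measurable fun t : ℝ => ENNReal.ofReal (t ^ ((1 - 2 * s) / 2)) :=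
    (measurable_id.pow_const _).ennreal_ofReal
  have hm2 : Measurable fun t : ℝ => ENNReal.ofReal (t ^ ((2 * s - 1) / 2)) :=
    (measurable_id.pow_const _).ennreal_ofReal
  have hm3 : Measurable fun t : ℝ => ENNReal.ofReal (t ^ (1 - 2 * s)) :=
    (measurable_id.pow_const _).ennreal_ofReal
  have h1 : ∫⁻ t in Ioc 0 y, ‖q t‖ₑ = ∫⁻ t in Ioc 0 y,
      ((fun t => ‖q t‖ₑ * ENNReal.ofReal (t ^ ((1 - 2 * s) / 2))) *
        fun t => ENNReal.ofReal (t ^ ((2 * s - 1) / 2))) t := by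
    refine setLIntegral_congr_fun measurableSet_Ioc fun t ht => ?_
    simp only [Pi.mul_apply]
    rw [mul_assoc, ← ENNReal.ofReal_mul (Real.rpow_nonneg ht.1.le _), ← Real.rpow_add ht.1]
    ring_nf
    simp
  have h2 := ENNReal.lintegral_mul_le_Lp_mul_Lq (volume.restrict (Ioc 0 y))
    Real.HolderConjugate.two_two (hq'.mul hm1.aemeasurable) hm2.aemeasurable
  have h3 : ∫⁻ t in Ioc 0 y, ENNReal.ofReal (t ^ ((2 * s - 1) / 2)) ^ (2 : ℝ) =
      ENNReal.ofReal (y ^ (2 * s) / (2 * s)) := by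
    rw [← lintegral_Ioc_rpow hs hy]
    refine setLIntegral_congr_fun measurableSet_Ioc fun t ht => ?_
    rw [ENNReal.ofReal_rpow_of_nonneg (Real.rpow_nonneg ht.1.le _) (by norm_num),
      ← Real.rpow_mul ht.1.le]
    ring_nf
  have h4 : ∫⁻ t in Ioc 0 y, (‖q t‖ₑ * ENNReal.ofReal (t ^ ((1 - 2 * s) / 2))) ^ (2 : ℝ) ≤
      ∫⁻ t, ‖q t‖ₑ ^ 2 ∂weightMeasure s := by
    rw [weightMeasure, lintegral_withDensity_eq_lintegral_mul₀ hm3.aemeasurable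
      (hq.enorm.pow_const 2)]
    refine le_trans (le_of_eq (setLIntegral_congr_fun measurableSet_Ioc fun t ht => ?_))
      (lintegral_mono_set (fun t ht => ht.1))
    simp only [Pi.mul_apply]
    rw [ENNReal.mul_rpow_of_nonneg _ _ (by norm_num),
      ENNReal.ofReal_rpow_of_nonneg (Real.rpow_nonneg ht.1.le _) (by norm_num),
      ← Real.rpow_mul ht.1.le, mul_comm]
    congr 1
    · ring_nf
    · exact ENNReal.rpow_natCast _ 2
  rw [h1]
  calc _ ≤ _ := pow_le_pow_left' h2 2
    _ = (∫⁻ t in Ioc 0 y, (‖q t‖ₑ * ENNReal.ofReal (t ^ ((1 - 2 * s) / 2))) ^ (2 : ℝ)) *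
        (∫⁻ t in Ioc 0 y, ENNReal.ofReal (t ^ ((2 * s - 1) / 2)) ^ (2 : ℝ)) := by
      rw [mul_pow, ← ENNReal.rpow_mul_natCast, ← ENNReal.rpow_mul_natCast]
      norm_num
    _ ≤ _ := by
      rw [h3, mul_comm]
      gcongr

lemma integrableOn_Ioc_of_lintegral_sq {s : ℝ} (hs : 0 < s) {q : ℝ → ℝ}
    (hq : AEStronglyMeasurable q (volume.restrict (Ioi 0)))
    (hq2 : ∫⁻ t, ‖q t‖ₑ ^ 2 ∂weightMeasure s < ⊤) {y : ℝ} (hy : 0 < y) :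
    IntegrableOn q (Ioc 0 y) := by
  refine ⟨hq.mono_measure (Measure.restrict_mono (fun t ht => ht.1) le_rfl), ?_⟩
  have h := (lintegral_Ioc_enorm_sq_le hs hq hy).trans_lt
    (ENNReal.mul_lt_top ENNReal.ofReal_lt_top hq2)
  exact (ENNReal.pow_lt_top_iff.1 h).resolve_right (by norm_num)

lemma enorm_primitive_sq_le {s : ℝ} (hs : 0 < s) {q : ℝ → ℝ}
    (hq : AEStronglyMeasurable q (volume.restrict (Ioi 0))) {y : ℝ} (hy : 0 < y) :
    ‖∫ t in (0)..y, q t‖ₑ ^ 2 ≤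
      ENNReal.ofReal (y ^ (2 * s) / (2 * s)) * ∫⁻ t, ‖q t‖ₑ ^ 2 ∂weightMeasure s := by
  refine le_trans ?_ (lintegral_Ioc_enorm_sq_le hs hq hy)
  rw [intervalIntegral.integral_of_le hy.le]
  gcongr
  exact enorm_integral_le_lintegral_enorm _

section slices

variable {n : ℕ} {s : ℝ} {Ω : Set (EuclideanSpace ℝ (Fin n))}

lemma ae_slice_of_memLp {F : Type*} [NormedAddCommGroup F]
    {g : EuclideanSpace ℝ (Fin n) × ℝ → F} (hg : MemLp g 2 (cylMeasure s Ω)) :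
    ∀ᵐ x ∂gaussOn Ω, AEStronglyMeasurable (fun y => g (x, y)) (volume.restrict (Ioi 0)) ∧
      ∫⁻ y, ‖g (x, y)‖ₑ ^ 2 ∂weightMeasure s < ⊤ := by
  have hm := hg.1
  rw [cylMeasure_eq_prod] at hm
  have h2 : ∫⁻ z, ‖g z‖ₑ ^ 2 ∂cylMeasure s Ω < ⊤ := by
    rw [← eLpNorm_two_sq]; exact ENNReal.pow_lt_top hg.2
  rw [cylMeasure_eq_prod, lintegral_prod _ (hm.enorm.pow_const 2)] at h2
  have h3 := ae_lt_top' (hm.enorm.pow_const 2).lintegral_prod_right' h2.ne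
  filter_upwards [h3, hm.prodMk_left] with x hx hxm
  refine ⟨hxm.mono_ac ?_, hx⟩
  intro t ht
  have := (ae_weightMeasure_iff (s := s) (p := fun y => y ∉ t)).1
    (measure_eq_zero_iff_ae_notMem.1 ht)
  exact measure_eq_zero_iff_ae_notMem.2 this

/-- The primitive in the extension variable that vanishes at `y = 0`. -/
def primitive (g : EuclideanSpace ℝ (Fin n) × ℝ → ℝ) (z : EuclideanSpace ℝ (Fin n) × ℝ) : ℝ :=
  ∫ t in (0)..z.2, g (z.1, t)

lemma aestronglyMeasurable_primitive {g : EuclideanSpace ℝ (Fin n) × ℝ → ℝ}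
    (hg : AEStronglyMeasurable g (cylMeasure s Ω)) :
    AEStronglyMeasurable (primitive g) (cylMeasure s Ω) := by
  obtain ⟨g', hg', hgg'⟩ := hg
  refine ⟨fun z => ∫ t, (Ioc 0 z.2).indicator (fun t => g' (z.1, t)) t, ?_, ?_⟩
  · refine StronglyMeasurable.integral_prod_right'
      (f := fun p : (EuclideanSpace ℝ (Fin n) × ℝ) × ℝ =>
        (Ioc (0 : ℝ) p.1.2).indicator (fun t : ℝ => (g' (p.1.1, t) : ℝ)) p.2) ?_
    have hS : MeasurableSet {p : (EuclideanSpace ℝ (Fin n) × ℝ) × ℝ | 0 < p.2 ∧ p.2 ≤ p.1.2} :=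
      (measurableSet_lt measurable_const measurable_snd).inter
        (measurableSet_le measurable_snd (measurable_snd.comp measurable_fst))
    have := (hg'.comp_measurable (g := fun p : (EuclideanSpace ℝ (Fin n) × ℝ) × ℝ =>
      (p.1.1, p.2)) (by fun_prop)).indicator hS
    exact this
  · rw [cylMeasure_eq_prod] at hgg'
    have h1 := Measure.ae_ae_of_ae_prod hgg'
    have h2 : ∀ᵐ z ∂cylMeasure s Ω, ∀ᵐ y ∂weightMeasure s, g (z.1, y) = g' (z.1, y) :=
      Measure.quasiMeasurePreserving_fst.ae h1
    have h3 : ∀ᵐ z ∂cylMeasure s Ω, z.2 ∈ Ioi (0 : ℝ) :=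
      Measure.quasiMeasurePreserving_snd.ae
        (ae_weightMeasure_iff.2 (ae_restrict_mem measurableSet_Ioi))
    filter_upwards [h2, h3] with z hz hz2
    rw [primitive, intervalIntegral.integral_of_le (le_of_lt hz2),
      integral_indicator measurableSet_Ioc]
    exact integral_congr_ae (ae_restrict_of_ae_restrict_of_subset (fun t ht => ht.1)
      (ae_weightMeasure_iff.1 hz))

/-- The primitive of a square integrable function is of order `y^s` in `L²(γ)`. -/
lemma lintegral_primitive_sq_le (hs : 0 < s) {g : EuclideanSpace ℝ (Fin n) × ℝ → ℝ}
    (hg : MemLp g 2 (cylMeasure s Ω)) {y : ℝ} (hy : 0 < y) :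
    ∫⁻ x, ‖primitive g (x, y)‖ₑ ^ 2 ∂gaussOn Ω ≤
      ENNReal.ofReal (y ^ (2 * s) / (2 * s)) * eLpNorm g 2 (cylMeasure s Ω) ^ 2 := by
  have hm := hg.1
  rw [cylMeasure_eq_prod] at hm
  rw [eLpNorm_two_sq, cylMeasure_eq_prod, lintegral_prod _ (hm.enorm.pow_const 2),
    ← lintegral_const_mul'' _ (hm.enorm.pow_const 2).lintegral_prod_right']
  refine lintegral_mono_ae ?_
  filter_upwards [ae_slice_of_memLp hg] with x hx
  exact enorm_primitive_sq_le hs hx.1 hy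

lemma weightMeasure_Iic_lt_top (hs1 : s < 1) (R : ℝ) :
    weightMeasure s (Iic R) < ⊤ := by
  rw [weightMeasure, withDensity_apply _ measurableSet_Iic,
    Measure.restrict_restrict measurableSet_Iic]
  rcases le_or_gt R 0 with h | h
  · rw [show Iic R ∩ Ioi 0 = ∅ by ext; simp; intro; linarith]; simp
  rw [inter_comm, Ioi_inter_Iic]
  have := lintegral_Ioc_rpow (s := 1 - s) (by linarith) h
  rw [show 2 * (1 - s) - 1 = 1 - 2 * s by ring] at this
  rw [this]; exact ENNReal.ofReal_lt_top

lemma memLp_indicator_primitive (hs : 0 < s) (hs1 : s < 1)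
    {g : EuclideanSpace ℝ (Fin n) × ℝ → ℝ} (hg : MemLp g 2 (cylMeasure s Ω)) (R : ℝ) :
    MemLp ({z | z.2 ≤ R}.indicator (primitive g)) 2 (cylMeasure s Ω) := by
  have hS : MeasurableSet {z : EuclideanSpace ℝ (Fin n) × ℝ | z.2 ≤ R} :=
    measurableSet_le measurable_snd measurable_const
  have hm := (aestronglyMeasurable_primitive hg.1).indicator hS
  refine ⟨hm, ?_⟩
  suffices eLpNorm ({z | z.2 ≤ R}.indicator (primitive g)) 2 (cylMeasure s Ω) ^ 2 < ⊤ from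
    (ENNReal.pow_lt_top_iff.1 this).resolve_right (by norm_num)
  have hm' := hm
  rw [cylMeasure_eq_prod] at hm'
  rw [eLpNorm_two_sq, cylMeasure_eq_prod, lintegral_prod_symm _ (hm'.enorm.pow_const 2)]
  set B := ENNReal.ofReal (R ^ (2 * s) / (2 * s)) * eLpNorm g 2 (cylMeasure s Ω) ^ 2 with hB
  have hBt : B < ⊤ := ENNReal.mul_lt_top ENNReal.ofReal_lt_top (ENNReal.pow_lt_top hg.2)
  have : ∀ᵐ y ∂weightMeasure s,
      ∫⁻ x, ‖{z : EuclideanSpace ℝ (Fin n) × ℝ | z.2 ≤ R}.indicator (primitive g) (x, y)‖ₑ ^ 2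
        ∂gaussOn Ω ≤ (Iic R).indicator (fun _ => B) y := by
    filter_upwards [ae_weightMeasure_iff.2 (ae_restrict_mem measurableSet_Ioi)] with y hy
    have hy : 0 < y := hy
    by_cases hyR : y ≤ R
    · simp only [indicator, mem_ofPred_eq, hyR, if_true, mem_Iic]
      refine (lintegral_primitive_sq_le hs hg hy).trans ?_
      rw [hB]
      gcongr
    · simp [indicator, hyR]
  refine (lintegral_mono_ae this).trans_lt ?_
  rw [lintegral_indicator_const measurableSet_Iic]
  exact ENNReal.mul_lt_top hBt (weightMeasure_Iic_lt_top hs1 R)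

end slices

section
variable {n : ℕ} {s : ℝ} {Ω : Set (EuclideanSpace ℝ (Fin n))}

/-- A compact subset of the cylinder lies in a compact slab at a positive height. -/
lemma exists_slab {K : Set (EuclideanSpace ℝ (Fin n) × ℝ)} (hK : IsCompact K)
    (hKU : K ⊆ Ω ×ˢ Ioi 0) :
    ∃ (K₁ : Set (EuclideanSpace ℝ (Fin n))) (α β : ℝ), IsCompact K₁ ∧ K₁ ⊆ Ω ∧ 0 < α ∧ α < β ∧
      K ⊆ K₁ ×ˢ Icc α β := by
  rcases K.eq_empty_or_nonempty with rfl | hne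
  · exact ⟨∅, 1, 2, isCompact_empty, by simp, by norm_num, by norm_num, by simp⟩
  have hK2 := hK.image continuous_snd
  obtain ⟨a, ha, hmin⟩ := hK2.exists_isLeast (hne.image _)
  obtain ⟨b, hb, hmax⟩ := hK2.exists_isGreatest (hne.image _)
  have ha0 : 0 < a := by
    obtain ⟨z, hz, rfl⟩ := ha
    exact (hKU hz).2
  refine ⟨Prod.fst '' K, a, b + 1, hK.image continuous_fst, ?_, ha0, ?_, fun z hz =>
    ⟨mem_image_of_mem _ hz, hmin (mem_image_of_mem _ hz), ?_⟩⟩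
  · rintro _ ⟨z, hz, rfl⟩
    exact (hKU hz).1
  · linarith [hmin hb]
  · linarith [hmax (mem_image_of_mem Prod.snd hz)]

lemma hasDerivAt_slice {ζ : EuclideanSpace ℝ (Fin n) × ℝ → ℝ} (hζ : Differentiable ℝ ζ)
    (x : EuclideanSpace ℝ (Fin n)) (y : ℝ) :
    HasDerivAt (fun y => ζ (x, y)) (fderiv ℝ ζ (x, y) (0, 1)) y :=
  (hζ (x, y)).hasFDerivAt.comp_hasDerivAt y ((hasDerivAt_const y x).prodMk (hasDerivAt_id y))

lemma volume_restrict_cyl :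
    (volume : Measure (EuclideanSpace ℝ (Fin n) × ℝ)).restrict (Ω ×ˢ Ioi (0 : ℝ)) =
      (volume.restrict Ω).prod (volume.restrict (Ioi 0)) := by
  rw [Measure.prod_restrict]; rfl

/-- The chain rule in the extension variable: a smooth function of `c(x) + ∫₀ʸ g(x, t) dt` has the
expected distributional derivative. -/
lemma integral_comp_mul_fderiv_of_primitive (hs : 0 < s) (hΩ : MeasurableSet Ω)
    {g v : EuclideanSpace ℝ (Fin n) × ℝ → ℝ} {c : EuclideanSpace ℝ (Fin n) → ℝ}
    (hg : MemLp g 2 (cylMeasure s Ω)) (hv : ∀ᵐ z ∂cylMeasure s Ω, v z = c z.1 + primitive g z)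
    {f : ℝ → ℝ} (hf : ContDiff ℝ ∞ f) {L : NNReal} (hL : ∀ t, ‖deriv f t‖₊ ≤ L)
    {ζ : EuclideanSpace ℝ (Fin n) × ℝ → ℝ} (hζ : IsTest (Ω ×ˢ Ioi 0) ζ)
    (hi1 : IntegrableOn (fun z => f (v z) * fderiv ℝ ζ z (0, 1)) (Ω ×ˢ Ioi 0))
    (hi2 : IntegrableOn (fun z => deriv f (v z) * g z * ζ z) (Ω ×ˢ Ioi 0)) :
    ∫ z in Ω ×ˢ Ioi 0, f (v z) * fderiv ℝ ζ z (0, 1) =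
      -∫ z in Ω ×ˢ Ioi 0, deriv f (v z) * g z * ζ z := by
  obtain ⟨K₁, α, β, -, -, hα, hαβ, hsub⟩ := exists_slab hζ.2.1 hζ.2.2
  rw [IntegrableOn, volume_restrict_cyl] at hi1 hi2
  rw [volume_restrict_cyl, integral_prod _ hi1, integral_prod _ hi2, ← integral_neg]
  have hv' := (ae_cylMeasure_iff hΩ).1 hv
  rw [volume_restrict_cyl] at hv'
  have hR : 0 < β + 1 := by linarith
  have hout : ∀ x y, y ∉ Ioo 0 (β + 1) → (x, y) ∉ tsupport ζ := fun x y hy h =>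
    hy ⟨hα.trans_le (hsub h).2.1, by linarith [(hsub h).2.2]⟩
  refine integral_congr_ae ?_
  filter_upwards [Measure.ae_ae_of_ae_prod hv', ae_gaussOn_iff.1 (ae_slice_of_memLp hg)]
    with x hx hgx
  have hd := fun y => hasDerivAt_slice (hζ.1.differentiable (by simp)) x y
  have hη : ContDiff ℝ 1 fun y => ζ (x, y) := by
    have := hζ.1.of_le (m := 1) (by simp)
    fun_prop
  have key := setIntegral_comp_primitive_mul_deriv hR
    (integrableOn_Ioc_of_lintegral_sq hs hgx.1 hgx.2 hR) (c x) hf hL hη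
    (fun y hy => image_eq_zero_of_notMem_tsupport (hout x y hy))
    (fun y hy => by rw [(hd y).deriv, hζ.fderiv_eq_zero (hout x y hy)])
  have e1 : ∫ y in Ioi 0, f (v (x, y)) * fderiv ℝ ζ (x, y) (0, 1) =
      ∫ y in Ioi 0, f (c x + ∫ t in (0)..y, g (x, t)) * deriv (fun y => ζ (x, y)) y := by
    refine integral_congr_ae ?_
    filter_upwards [hx] with y hy
    rw [hy, (hd y).deriv]; rfl
  have e2 : ∫ y in Ioi 0, deriv f (v (x, y)) * g (x, y) * ζ (x, y) =
      ∫ y in Ioi 0, deriv f (c x + ∫ t in (0)..y, g (x, t)) * g (x, y) * ζ (x, y) := by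
    refine integral_congr_ae ?_
    filter_upwards [hx] with y hy
    rw [hy]; rfl
  exact e1.trans (key.trans (congrArg Neg.neg e2.symm))

/-- The primitive from `-∞` in the extension variable is a convolution with the indicator function
of `[0, ∞)`, hence smooth. -/
lemma contDiff_setIntegral_Iic {θ : EuclideanSpace ℝ (Fin n) × ℝ → ℝ} (hθ : ContDiff ℝ ∞ θ)
    (hc : HasCompactSupport θ) :
    ContDiff ℝ ∞ fun z : EuclideanSpace ℝ (Fin n) × ℝ => ∫ t in Iic z.2, θ (z.1, t) := by
  have h := contDiffOn_convolution_right_with_param (𝕜 := ℝ) (n := (⊤ : ℕ∞)) (μ := volume)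
    (f := (Ici (0 : ℝ)).indicator fun _ => (1 : ℝ)) (ContinuousLinearMap.mul ℝ ℝ)
    (g := fun (x : EuclideanSpace ℝ (Fin n)) t => θ (x, t)) (s := univ)
    (k := Prod.snd '' tsupport θ) isOpen_univ (hc.isCompact.image continuous_snd)
    (fun p t _ ht => image_eq_zero_of_notMem_tsupport fun h => ht ⟨_, h, rfl⟩)
    ((locallyIntegrable_const 1).indicator measurableSet_Ici) (by
      rw [univ_prod_univ]; exact hθ.contDiffOn)
  rw [univ_prod_univ, contDiffOn_univ] at h
  convert h using 2 with z
  simp only [convolution, ContinuousLinearMap.mul_apply']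
  rw [← integral_sub_left_eq_self _ volume z.2, ← integral_indicator measurableSet_Iic]
  refine integral_congr_ae (ae_of_all _ fun t => ?_)
  by_cases ht : t ≤ z.2 <;> simp [indicator, ht]

/-- A test function with vanishing integral along the extension variable is the derivative of a
test function in that variable. -/
lemma exists_isTest_fderiv_eq {θ : EuclideanSpace ℝ (Fin n) × ℝ → ℝ}
    (hθ : IsTest (Ω ×ˢ Ioi 0) θ) (h0 : ∀ x, ∫ t, θ (x, t) = 0) :
    ∃ ζ, IsTest (Ω ×ˢ Ioi 0) ζ ∧ ∀ z, fderiv ℝ ζ z (0, 1) = θ z := by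
  obtain ⟨K₁, α, β, hK₁, hK₁Ω, hα, hαβ, hsub⟩ := exists_slab hθ.2.1 hθ.2.2
  have hz : ∀ x t, (x, t) ∉ K₁ ×ˢ Icc α β → θ (x, t) = 0 := fun x t h =>
    image_eq_zero_of_notMem_tsupport fun h' => h (hsub h')
  have hsm := contDiff_setIntegral_Iic hθ.1 hθ.2.1
  set ζ : EuclideanSpace ℝ (Fin n) × ℝ → ℝ := fun z => ∫ t in Iic z.2, θ (z.1, t) with hζ
  have hsupp : Function.support ζ ⊆ K₁ ×ˢ Icc α β := by
    intro z hzs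
    by_contra hzn
    refine hzs ?_
    simp only [hζ]
    by_cases hx : z.1 ∈ K₁
    · rcases lt_or_ge z.2 α with hlt | hge
      · refine setIntegral_eq_zero_of_forall_eq_zero fun t ht => hz _ _ fun h => ?_
        exact absurd (h.2.1.trans ht) (not_le.2 hlt)
      · have hgt : β < z.2 := by
          by_contra hle
          exact hzn ⟨hx, hge, not_lt.1 hle⟩
        rw [setIntegral_eq_integral_of_forall_compl_eq_zero, h0]
        intro t ht
        refine hz _ _ fun h => ht ?_
        exact h.2.2.trans hgt.le
    · exact setIntegral_eq_zero_of_forall_eq_zero fun t _ => hz _ _ fun h => hx h.1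
  have hcomp : IsCompact (K₁ ×ˢ Icc α β) := hK₁.prod isCompact_Icc
  have hts : tsupport ζ ⊆ K₁ ×ˢ Icc α β := closure_minimal hsupp hcomp.isClosed
  refine ⟨ζ, ⟨hsm, HasCompactSupport.intro' hcomp hcomp.isClosed fun z hzn => ?_,
    hts.trans (prod_mono hK₁Ω fun t ht => hα.trans_le ht.1)⟩, fun z => ?_⟩
  · by_contra h; exact hzn (hsupp h)
  have hcont : ∀ x, Continuous fun t => θ (x, t) := fun x => by
    have := hθ.1.continuous
    fun_prop
  have hint : ∀ x, Integrable fun t => θ (x, t) := fun x =>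
    (hcont x).integrable_of_hasCompactSupport (HasCompactSupport.intro' (isCompact_Icc (a := α)
      (b := β)) isClosed_Icc fun t ht => hz _ _ fun h => ht h.2)
  have h1 := hasDerivAt_slice (hsm.differentiable (by simp)) z.1 z.2
  have h2 : HasDerivAt (fun y => ζ (z.1, y)) (θ (z.1, z.2)) z.2 := by
    have h3 : (fun y => ζ (z.1, y)) =
        fun y => (∫ t in Iic 0, θ (z.1, t)) + ∫ t in (0)..y, θ (z.1, t) := by
      ext y
      simp only [hζ]
      rw [← intervalIntegral.integral_Iic_sub_Iic (hint _).integrableOn (hint _).integrableOn]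
      ring
    rw [h3]
    exact ((hcont z.1).integral_hasStrictDerivAt 0 z.2).hasDerivAt.const_add _
  exact h1.unique h2

lemma integrableOn_mul_of_memLp {κ : EuclideanSpace ℝ (Fin n) × ℝ → ℝ}
    {K : Set (EuclideanSpace ℝ (Fin n) × ℝ)} (hΩ : MeasurableSet Ω) (hK : IsCompact K)
    (hKU : K ⊆ Ω ×ˢ Ioi 0) (hκ : Measurable κ) {C : ℝ} (hC : ∀ x, |κ x| ≤ C)
    (hκ0 : ∀ x, x ∉ K → κ x = 0) {f : EuclideanSpace ℝ (Fin n) × ℝ → ℝ}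
    (hf : MemLp f 2 (cylMeasure s Ω)) :
    IntegrableOn (fun x => f x * κ x) (Ω ×ˢ Ioi 0) := by
  obtain ⟨k, -, hk⟩ := exists_memLp_pairing_cyl s hΩ hK hKU hκ hC hκ0
  exact (hk f).2 hf

lemma integrableOn_primitive_mul (hs : 0 < s) (hs1 : s < 1)
    {κ : EuclideanSpace ℝ (Fin n) × ℝ → ℝ}
    {K : Set (EuclideanSpace ℝ (Fin n) × ℝ)} (hΩ : MeasurableSet Ω) (hK : IsCompact K)
    (hKU : K ⊆ Ω ×ˢ Ioi 0) (hκ : Measurable κ) {C : ℝ} (hC : ∀ x, |κ x| ≤ C)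
    (hκ0 : ∀ x, x ∉ K → κ x = 0) {g : EuclideanSpace ℝ (Fin n) × ℝ → ℝ}
    (hg : MemLp g 2 (cylMeasure s Ω)) :
    IntegrableOn (fun x => primitive g x * κ x) (Ω ×ˢ Ioi 0) := by
  obtain ⟨K₁, α, β, -, -, hα, hαβ, hsub⟩ := exists_slab hK hKU
  have h := integrableOn_mul_of_memLp hΩ hK hKU hκ hC hκ0 (memLp_indicator_primitive hs hs1 hg β)
  refine h.congr_fun (fun z _ => ?_) (hΩ.prod measurableSet_Ioi)
  by_cases hz : z ∈ K
  · have : z ∈ {z : EuclideanSpace ℝ (Fin n) × ℝ | z.2 ≤ β} := (hsub hz).2.2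
    simp only [indicator_of_mem this]
  · simp [hκ0 z hz]

/-- A function with a square integrable weak derivative in the extension variable is the sum of
its trace and the primitive of that derivative. -/
lemma exists_eq_add_primitive (hs : 0 < s) (hs1 : s < 1) (hΩ : IsOpen Ω)
    {v g : EuclideanSpace ℝ (Fin n) × ℝ → ℝ} (hv : MemLp v 2 (cylMeasure s Ω))
    (hg : MemLp g 2 (cylMeasure s Ω))
    (hw : ∀ ζ : EuclideanSpace ℝ (Fin n) × ℝ → ℝ, IsTest (Ω ×ˢ Ioi 0) ζ →
      ∫ z in Ω ×ˢ Ioi 0, v z * fderiv ℝ ζ z (0, 1) = -∫ z in Ω ×ˢ Ioi 0, g z * ζ z) :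
    ∃ c : EuclideanSpace ℝ (Fin n) → ℝ,
      ∀ᵐ z ∂cylMeasure s Ω, v z = c z.1 + primitive g z := by
  have hΩm := hΩ.measurableSet
  have hUo : IsOpen (Ω ×ˢ Ioi (0 : ℝ)) := hΩ.prod isOpen_Ioi
  set D : EuclideanSpace ℝ (Fin n) × ℝ → ℝ := fun z => v z - primitive g z with hD
  have hDint : ∀ {κ : EuclideanSpace ℝ (Fin n) × ℝ → ℝ} {K} (_ : IsCompact K)
      (_ : K ⊆ Ω ×ˢ Ioi (0 : ℝ)) (_ : Measurable κ) {C : ℝ} (_ : ∀ x, |κ x| ≤ C)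
      (_ : ∀ x, x ∉ K → κ x = 0), IntegrableOn (fun x => D x * κ x) (Ω ×ˢ Ioi 0) := by
    intro κ K hK hKU hκ C hC hκ0
    have h := (integrableOn_mul_of_memLp hΩm hK hKU hκ hC hκ0 hv).sub
      (integrableOn_primitive_mul hs hs1 hΩm hK hKU hκ hC hκ0 hg)
    refine h.congr_fun (fun z _ => ?_) (hΩm.prod measurableSet_Ioi)
    simp [hD, sub_mul]
  -- the weak derivative of `D` in the extension variable vanishes
  have hD0 : ∀ ζ, IsTest (Ω ×ˢ Ioi 0) ζ → ∫ z in Ω ×ˢ Ioi 0, D z * fderiv ℝ ζ z (0, 1) = 0 := by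
    intro ζ hζ
    obtain ⟨C, hC⟩ := hζ.exists_bound
    obtain ⟨C', hC'⟩ := hζ.exists_bound_fderiv (0, 1)
    have hi1 := integrableOn_primitive_mul hs hs1 hΩm hζ.2.1 hζ.2.2 (hζ.measurable_fderiv (0, 1))
      hC' (fun x hx => hζ.fderiv_eq_zero hx _) hg
    have hi2 := integrableOn_mul_of_memLp hΩm hζ.2.1 hζ.2.2 hζ.1.continuous.measurable
      hC (fun x hx => image_eq_zero_of_notMem_tsupport hx) hg
    have hi3 := integrableOn_mul_of_memLp hΩm hζ.2.1 hζ.2.2 (hζ.measurable_fderiv (0, 1))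
      hC' (fun x hx => hζ.fderiv_eq_zero hx _) hv
    have h1 := integral_comp_mul_fderiv_of_primitive hs hΩm (v := primitive g) (c := fun _ => 0) hg
      (ae_of_all _ fun z => by simp) (f := fun t => t) (L := 1) contDiff_id
      (fun t => by simp) hζ hi1 (by simpa using hi2)
    simp only [hD, sub_mul]
    rw [integral_sub hi3 hi1, hw ζ hζ, h1]
    simp
  -- `c` is an average of `D` over the extension variable
  let b : ContDiffBump (2 : ℝ) := ⟨1 / 2, 1, by norm_num, by norm_num⟩
  set η : ℝ → ℝ := b.normed volume with hη
  have hηs : ContDiff ℝ ∞ η := b.contDiff_normed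
  have hηI : ∫ t, η t = 1 := b.integral_normed
  have hηt : tsupport η = Icc 1 3 := by
    rw [hη, b.tsupport_normed_eq, Real.closedBall_eq_Icc]; norm_num [b]
  have hη0 : ∀ t, t ∉ Icc (1 : ℝ) 3 → η t = 0 := fun t ht =>
    image_eq_zero_of_notMem_tsupport (hηt ▸ ht)
  obtain ⟨Cη, hCη⟩ : ∃ C, ∀ t, ‖η t‖ ≤ C :=
    b.hasCompactSupport_normed.exists_bound_of_continuous hηs.continuous
  set c : EuclideanSpace ℝ (Fin n) → ℝ := fun x => ∫ y in Ioi 0, D (x, y) * η y with hc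
  have hcK : ∀ K₁ : Set (EuclideanSpace ℝ (Fin n)), IsCompact K₁ → K₁ ⊆ Ω →
      ∀ {Z : EuclideanSpace ℝ (Fin n) → ℝ} (_ : Measurable Z) {C : ℝ} (_ : ∀ x, |Z x| ≤ C)
      (_ : ∀ x, x ∉ K₁ → Z x = 0),
      IntegrableOn (fun z => D z * (Z z.1 * η z.2)) (Ω ×ˢ Ioi 0) := by
    intro K₁ hK₁ hK₁Ω Z hZ C hC hZ0
    refine hDint (hK₁.prod (isCompact_Icc (a := 1) (b := 3)))
      (prod_mono hK₁Ω fun t ht => lt_of_lt_of_le one_pos ht.1)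
      ((hZ.comp measurable_fst).mul (hηs.continuous.measurable.comp measurable_snd))
      (C := C * Cη) (fun z => ?_) (fun z hz => ?_)
    · rw [abs_mul]
      exact mul_le_mul (hC _) (hCη _) (abs_nonneg _) ((abs_nonneg _).trans (hC z.1))
    · by_cases h : z.1 ∈ K₁
      · rw [hη0 z.2 fun h' => hz ⟨h, h'⟩, mul_zero]
      · rw [hZ0 _ h, zero_mul]
  have hcloc : ∀ K₁ : Set (EuclideanSpace ℝ (Fin n)), IsCompact K₁ → K₁ ⊆ Ω →
      IntegrableOn (K₁.indicator c) Ω := by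
    intro K₁ hK₁ hK₁Ω
    have h := hcK K₁ hK₁ hK₁Ω (Z := K₁.indicator fun _ => 1)
      (measurable_const.indicator hK₁.isClosed.measurableSet) (C := 1)
      (fun x => by by_cases hx : x ∈ K₁ <;> simp [hx]) (fun x hx => by simp [hx])
    rw [IntegrableOn, volume_restrict_cyl] at h
    refine h.integral_prod_left.congr (ae_of_all _ fun x => ?_)
    by_cases hx : x ∈ K₁ <;> simp [hx, hc]
  have hcint : ∀ {κ : EuclideanSpace ℝ (Fin n) × ℝ → ℝ} {K} (_ : IsCompact K)
      (_ : K ⊆ Ω ×ˢ Ioi (0 : ℝ)) (_ : Measurable κ) {C : ℝ} (_ : ∀ x, |κ x| ≤ C)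
      (_ : ∀ x, x ∉ K → κ x = 0), IntegrableOn (fun z => c z.1 * κ z) (Ω ×ˢ Ioi 0) := by
    intro κ K hK hKU hκ C hC hκ0
    obtain ⟨K₁, α, β, hK₁, hK₁Ω, hα, hαβ, hsub⟩ := exists_slab hK hKU
    have h2 : Integrable ((Icc α β).indicator fun _ => (1 : ℝ)) (volume.restrict (Ioi 0)) :=
      ((integrable_indicator_iff measurableSet_Icc).2 (by simp)).integrableOn
    have h1 := (hcloc K₁ hK₁ hK₁Ω).mul_prod h2
    rw [← volume_restrict_cyl] at h1
    have h3 := h1.mul_bdd (c := C) hκ.aestronglyMeasurable (ae_of_all _ hC)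
    refine h3.congr (ae_of_all _ fun z => ?_)
    by_cases hz : z ∈ K
    · simp [(hsub hz).1, (hsub hz).2.1, (hsub hz).2.2]
    · simp [hκ0 z hz]
  refine ⟨c, ?_⟩
  have hloc : LocallyIntegrableOn (fun z => D z - c z.1) (Ω ×ˢ Ioi (0 : ℝ)) := by
    rw [locallyIntegrableOn_iff hUo.isLocallyClosed]
    intro K hKU hK
    have hm : Measurable (K.indicator fun _ => (1 : ℝ)) :=
      measurable_const.indicator hK.isClosed.measurableSet
    have hb : ∀ x, |K.indicator (fun _ => (1 : ℝ)) x| ≤ 1 := fun x => by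
      by_cases hx : x ∈ K <;> simp [hx]
    have hb0 : ∀ x, x ∉ K → K.indicator (fun _ => (1 : ℝ)) x = 0 := fun x hx => by simp [hx]
    have h := ((hDint hK hKU hm hb hb0).sub (hcint hK hKU hm hb hb0)).mono_set hKU
    refine h.congr_fun (fun z hz => ?_) hK.isClosed.measurableSet
    simp [hz]
  have hae := hUo.ae_eq_zero_of_integral_contDiff_smul_eq_zero hloc (fun ζ hζs hζc hζt => by
    have hζ : IsTest (Ω ×ˢ Ioi 0) ζ := ⟨hζs, hζc, hζt⟩
    obtain ⟨C, hC⟩ := hζ.exists_bound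
    have hζ0 : ∀ z, z ∉ tsupport ζ → ζ z = 0 := fun z hz => image_eq_zero_of_notMem_tsupport hz
    obtain ⟨K₁, α, β, hK₁, hK₁Ω, hα, hαβ, hsub⟩ := exists_slab hζ.2.1 hζ.2.2
    have hζz : ∀ x t, (x, t) ∉ K₁ ×ˢ Icc α β → ζ (x, t) = 0 := fun x t h =>
      hζ0 _ fun h' => h (hsub h')
    set Z : EuclideanSpace ℝ (Fin n) → ℝ := fun x => ∫ t, ζ (x, t) with hZ
    have hZ1 : ∀ x, Z x = ∫ t in Iic β, ζ (x, t) := fun x => by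
      rw [setIntegral_eq_integral_of_forall_compl_eq_zero]
      exact fun t ht => hζz _ _ fun h => ht h.2.2
    have hZ2 : ∀ x, Z x = ∫ t in Ioi 0, ζ (x, t) := fun x => by
      rw [setIntegral_eq_integral_of_forall_compl_eq_zero]
      exact fun t ht => hζz _ _ fun h => ht (hα.trans_le h.2.1)
    have hZs : ContDiff ℝ ∞ Z := by
      have h := (contDiff_setIntegral_Iic hζs hζc).comp
        (contDiff_id.prodMk (contDiff_const (c := β)) :
          ContDiff ℝ ∞ fun x : EuclideanSpace ℝ (Fin n) => (x, β))
      exact (funext hZ1 : Z = _) ▸ h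
    have hZ0 : ∀ x, x ∉ K₁ → Z x = 0 := fun x hx => by
      rw [hZ]
      exact integral_eq_zero_of_ae (ae_of_all _ fun t => hζz _ _ fun h => hx h.1)
    have hZc : HasCompactSupport Z := HasCompactSupport.intro' hK₁ hK₁.isClosed hZ0
    obtain ⟨CZ, hCZ⟩ : ∃ C, ∀ x, ‖Z x‖ ≤ C := hZc.exists_bound_of_continuous hZs.continuous
    -- correct `ζ` so that its integrals along the extension variable vanish
    set P : EuclideanSpace ℝ (Fin n) × ℝ → ℝ := fun z => Z z.1 * η z.2 with hP
    have hPs : ContDiff ℝ ∞ P := (hZs.comp contDiff_fst).mul (hηs.comp contDiff_snd)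
    have hθ : IsTest (Ω ×ˢ Ioi 0) fun z => ζ z - P z := by
      have hcp : IsCompact (K₁ ×ˢ Icc (min α 1) (max β 3)) := hK₁.prod isCompact_Icc
      have h0 : ∀ z, z ∉ K₁ ×ˢ Icc (min α 1) (max β 3) → ζ z - P z = 0 := by
        intro z hz
        have h1 : ζ z = 0 := hζz z.1 z.2 fun h =>
          hz ⟨h.1, (min_le_left _ _).trans h.2.1, h.2.2.trans (le_max_left _ _)⟩
        have h2 : P z = 0 := by
          by_cases hx : z.1 ∈ K₁
          · rw [hP]; simp only
            rw [hη0 z.2 fun h => hz ⟨hx, (min_le_right _ _).trans h.1,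
              h.2.trans (le_max_right _ _)⟩, mul_zero]
          · simp [hP, hZ0 _ hx]
        rw [h1, h2, sub_zero]
      refine ⟨hζs.sub hPs, HasCompactSupport.intro' hcp hcp.isClosed h0, ?_⟩
      refine (closure_minimal (fun z hz => ?_) hcp.isClosed).trans
        (prod_mono hK₁Ω fun t ht => (lt_min hα one_pos).trans_le ht.1)
      by_contra hzn
      exact hz (h0 z hzn)
    have hθ0 : ∀ x, ∫ t, (ζ (x, t) - P (x, t)) = 0 := by
      intro x
      have hi1 : Integrable fun t => ζ (x, t) := by
        refine Continuous.integrable_of_hasCompactSupport (by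
          have := hζs.continuous
          fun_prop) (HasCompactSupport.intro' (isCompact_Icc (a := α) (b := β)) isClosed_Icc
            fun t ht => hζz _ _ fun h => ht h.2)
      have hi2 : Integrable fun t => P (x, t) :=
        Integrable.const_mul (c := Z x)
          (hηs.continuous.integrable_of_hasCompactSupport b.hasCompactSupport_normed)
      rw [integral_sub hi1 hi2]
      simp only [hP]
      rw [integral_const_mul, hηI, mul_one, sub_self]
    obtain ⟨ξ, hξ, hξd⟩ := exists_isTest_fderiv_eq hθ hθ0
    have e0 := hD0 ξ hξ
    simp only [hξd, mul_sub] at e0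
    have hi1 := hDint hζ.2.1 hζ.2.2 hζs.continuous.measurable hC hζ0
    have hi2 := hcK K₁ hK₁ hK₁Ω hZs.continuous.measurable hCZ hZ0
    have hi3 := hcint hζ.2.1 hζ.2.2 hζs.continuous.measurable hC hζ0
    rw [integral_sub hi1 hi2, sub_eq_zero] at e0
    have e1 : ∫ z in Ω ×ˢ Ioi 0, D z * P z = ∫ x in Ω, c x * Z x := by
      have hi2' := hi2
      rw [IntegrableOn, volume_restrict_cyl] at hi2'
      rw [volume_restrict_cyl, integral_prod _ hi2']
      refine integral_congr_ae (ae_of_all _ fun x => ?_)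
      simp only [hc, ← integral_mul_const]
      refine integral_congr_ae (ae_of_all _ fun y => ?_)
      simp only; ring
    have e2 : ∫ z in Ω ×ˢ Ioi 0, c z.1 * ζ z = ∫ x in Ω, c x * Z x := by
      have hi3' := hi3
      rw [IntegrableOn, volume_restrict_cyl] at hi3'
      rw [volume_restrict_cyl, integral_prod _ hi3']
      refine integral_congr_ae (ae_of_all _ fun x => ?_)
      simp only [hZ2, ← integral_const_mul]
    have e3 : ∫ z in Ω ×ˢ Ioi 0, (D z * ζ z - c z.1 * ζ z) = 0 := by
      rw [integral_sub hi1 hi3, e0, e1, e2, sub_self]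
    rw [← e3, ← setIntegral_eq_integral_of_forall_compl_eq_zero (s := Ω ×ˢ Ioi 0)]
    · refine integral_congr_ae (ae_of_all _ fun z => ?_)
      simp only [smul_eq_mul]; ring
    · intro z hz
      rw [hζ0 z fun h => hz (hζt h), zero_smul])
  rw [ae_cylMeasure_iff hΩm, ae_restrict_iff' (hΩm.prod measurableSet_Ioi)]
  filter_upwards [hae] with z hz hzU
  have := hz hzU
  simp only [hD] at this
  linarith

end

/-! ### The energy space and its traces -/

/-- The filter along which traces are taken is proper, so that limits along it are unique. -/
instance : NeBot (𝓝[>] (0 : ℝ) ⊓ ae volume) := by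
  rw [inf_neBot_iff]
  intro t ht t' ht'
  obtain ⟨u, hu, hut⟩ := mem_nhdsGT_iff_exists_Ioo_subset.1 ht
  by_contra hne
  rw [not_nonempty_iff_eq_empty] at hne
  have hsub : Ioo 0 u ⊆ t'ᶜ := fun y hy hy' =>
    (hne ▸ (⟨hut hy, hy'⟩ : y ∈ t ∩ t') : y ∈ (∅ : Set ℝ))
  have h0 : volume (Ioo 0 u) = 0 := measure_mono_null hsub ht'
  have hu : 0 < u := hu
  simp at h0
  linarith

section
variable {n : ℕ} {s : ℝ} {Ω : Set (EuclideanSpace ℝ (Fin n))}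

lemma ae_ae_cylMeasure {p : EuclideanSpace ℝ (Fin n) × ℝ → Prop}
    (h : ∀ᵐ z ∂cylMeasure s Ω, p z) :
    ∀ᵐ y ∂volume.restrict (Ioi (0 : ℝ)), ∀ᵐ x ∂gaussOn Ω, p (x, y) := by
  rw [cylMeasure_eq_prod] at h
  exact ae_weightMeasure_iff.1 (Measure.ae_ae_of_ae_prod
    (Measure.measurePreserving_swap.quasiMeasurePreserving.ae h))

lemma ae_aestronglyMeasurable_slice {F : Type*} [NormedAddCommGroup F]
    {v : EuclideanSpace ℝ (Fin n) × ℝ → F} (hv : AEStronglyMeasurable v (cylMeasure s Ω)) :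
    ∀ᵐ y ∂volume.restrict (Ioi (0 : ℝ)), AEStronglyMeasurable (fun x => v (x, y)) (gaussOn Ω) := by
  rw [cylMeasure_eq_prod] at hv
  exact ae_weightMeasure_iff.1 hv.prod_swap.prodMk_left

lemma lintegral_sq_cylMeasure {F : Type*} [NormedAddCommGroup F]
    {v : EuclideanSpace ℝ (Fin n) × ℝ → F} (hv : AEStronglyMeasurable v (cylMeasure s Ω)) :
    eLpNorm v 2 (cylMeasure s Ω) ^ 2 =
      ∫⁻ y, eLpNorm (fun x => v (x, y)) 2 (gaussOn Ω) ^ 2 ∂weightMeasure s := by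
  rw [cylMeasure_eq_prod] at hv
  simp only [eLpNorm_two_sq]
  rw [cylMeasure_eq_prod, lintegral_prod_symm _ (hv.enorm.pow_const 2)]

lemma aemeasurable_eLpNorm_slice {F : Type*} [NormedAddCommGroup F]
    {q : EuclideanSpace ℝ (Fin n) × ℝ → F} (hq : AEStronglyMeasurable q (cylMeasure s Ω)) :
    AEMeasurable (fun y => eLpNorm (fun x => q (x, y)) 2 (gaussOn Ω) ^ 2) (weightMeasure s) := by
  simp only [eLpNorm_two_sq]
  rw [cylMeasure_eq_prod] at hq
  exact (hq.enorm.pow_const 2).lintegral_prod_left'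

lemma ae_memLp_slice {F : Type*} [NormedAddCommGroup F]
    {q : EuclideanSpace ℝ (Fin n) × ℝ → F} (hq : MemLp q 2 (cylMeasure s Ω)) :
    ∀ᵐ y ∂volume.restrict (Ioi (0 : ℝ)), MemLp (fun x => q (x, y)) 2 (gaussOn Ω) := by
  have h1 := ae_lt_top' (aemeasurable_eLpNorm_slice hq.1) (by
    rw [← lintegral_sq_cylMeasure hq.1]; exact (ENNReal.pow_lt_top hq.2).ne)
  filter_upwards [ae_weightMeasure_iff.1 h1, ae_aestronglyMeasurable_slice hq.1] with y h2 h3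
  exact ⟨h3, (ENNReal.pow_lt_top_iff.1 h2).resolve_right (by norm_num)⟩

lemma IsTest.slice {ζ : EuclideanSpace ℝ (Fin n) × ℝ → ℝ} (hζ : IsTest (Ω ×ˢ Ioi 0) ζ) (y : ℝ) :
    IsTest Ω fun x => ζ (x, y) := by
  obtain ⟨K₁, α, β, hK₁, hK₁Ω, hα, hαβ, hsub⟩ := exists_slab hζ.2.1 hζ.2.2
  have h0 : ∀ x, x ∉ K₁ → ζ (x, y) = 0 := fun x hx =>
    image_eq_zero_of_notMem_tsupport fun h => hx (hsub h).1
  refine ⟨by have := hζ.1; fun_prop, HasCompactSupport.intro' hK₁ hK₁.isClosed h0, ?_⟩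
  refine (closure_minimal (fun x hx => ?_) hK₁.isClosed).trans hK₁Ω
  by_contra hxn
  exact hx (h0 x hxn)

lemma fderiv_slice {ζ : EuclideanSpace ℝ (Fin n) × ℝ → ℝ} (hζ : Differentiable ℝ ζ)
    (x v : EuclideanSpace ℝ (Fin n)) (y : ℝ) :
    fderiv ℝ (fun x => ζ (x, y)) x v = fderiv ℝ ζ (x, y) (v, 0) := by
  have h := HasFDerivAt.comp (f := fun x => (x, y)) x (hζ (x, y)).hasFDerivAt
    ((hasFDerivAt_id x).prodMk (hasFDerivAt_const y x))
  have h2 : fderiv ℝ (fun x => ζ (x, y)) x = _ := h.fderiv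
  rw [h2]
  simp

/-- The lateral condition already contains the weak differentiability in `x`. -/
lemma IsEnergy.of_lateral (hΩ : MeasurableSet Ω) {v : EuclideanSpace ℝ (Fin n) × ℝ → ℝ}
    {gx : EuclideanSpace ℝ (Fin n) × ℝ → EuclideanSpace ℝ (Fin n)}
    {gy : EuclideanSpace ℝ (Fin n) × ℝ → ℝ} (hv : MemLp v 2 (cylMeasure s Ω))
    (hx : MemLp gx 2 (cylMeasure s Ω)) (hy : MemLp gy 2 (cylMeasure s Ω))
    (weak_y : ∀ ζ : EuclideanSpace ℝ (Fin n) × ℝ → ℝ, IsTest (Ω ×ˢ Ioi 0) ζ →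
      ∫ z in Ω ×ˢ Ioi 0, v z * fderiv ℝ ζ z (0, 1) = -∫ z in Ω ×ˢ Ioi 0, gy z * ζ z)
    (lateral : ∀ᵐ y ∂volume.restrict (Ioi (0 : ℝ)),
      IsH10 Ω (fun x => v (x, y)) (fun x => gx (x, y))) :
    IsEnergy s Ω v gx gy := by
  refine ⟨hv, hx, hy, fun ζ hζ i => ?_, weak_y, lateral⟩
  obtain ⟨C, hC⟩ := hζ.exists_bound
  obtain ⟨C', hC'⟩ := hζ.exists_bound_fderiv (EuclideanSpace.single i 1, 0)
  have hi1 := integrableOn_mul_of_memLp hΩ hζ.2.1 hζ.2.2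
    (hζ.measurable_fderiv (EuclideanSpace.single i 1, 0))
    hC' (fun x hx => hζ.fderiv_eq_zero hx _) hv
  have hi2 := integrableOn_mul_of_memLp hΩ hζ.2.1 hζ.2.2 hζ.1.continuous.measurable
    hC (fun x hx => image_eq_zero_of_notMem_tsupport hx) (memLp_apply hx i)
  rw [IntegrableOn, volume_restrict_cyl] at hi1 hi2
  rw [volume_restrict_cyl, integral_prod_symm _ hi1, integral_prod_symm _ hi2, ← integral_neg]
  refine integral_congr_ae ?_
  filter_upwards [lateral] with y hy
  have h := hy.weak hΩ (hζ.slice y) i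
  simp only [fderiv_slice (hζ.1.differentiable (by simp))] at h
  exact h

lemma eLpNorm_add_sq_le {X F : Type*} [MeasurableSpace X] [NormedAddCommGroup F] {μ : Measure X}
    {f g : X → F} (hf : AEStronglyMeasurable f μ) (hg : AEStronglyMeasurable g μ) :
    eLpNorm (fun x => f x + g x) 2 μ ^ 2 ≤ 2 * eLpNorm f 2 μ ^ 2 + 2 * eLpNorm g 2 μ ^ 2 := by
  have h1 : eLpNorm (fun x => f x + g x) 2 μ ≤ eLpNorm f 2 μ + eLpNorm g 2 μ :=
    eLpNorm_add_le hf hg (by norm_num)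
  calc eLpNorm (fun x => f x + g x) 2 μ ^ 2 ≤ (eLpNorm f 2 μ + eLpNorm g 2 μ) ^ 2 := by gcongr
    _ ≤ _ := by
      rcases eq_or_ne (eLpNorm f 2 μ) ⊤ with h | ha
      · simp [h]
      rcases eq_or_ne (eLpNorm g 2 μ) ⊤ with h | hb
      · simp [h]
      lift eLpNorm f 2 μ to NNReal using ha with a
      lift eLpNorm g 2 μ to NNReal using hb with b
      norm_cast
      have := two_mul_le_add_sq a b
      calc (a + b) ^ 2 = a ^ 2 + b ^ 2 + 2 * a * b := by ring
        _ ≤ a ^ 2 + b ^ 2 + (a ^ 2 + b ^ 2) := by gcongr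
        _ = _ := by ring

/-- Every function of finite energy has a trace, of which it is a perturbation by the primitive of
its derivative in the extension variable. -/
lemma IsEnergy.exists_hasTrace (hs : 0 < s) (hs1 : s < 1) (hΩ : IsOpen Ω)
    {v : EuclideanSpace ℝ (Fin n) × ℝ → ℝ}
    {gx : EuclideanSpace ℝ (Fin n) × ℝ → EuclideanSpace ℝ (Fin n)}
    {gy : EuclideanSpace ℝ (Fin n) × ℝ → ℝ} (h : IsEnergy s Ω v gx gy) :
    ∃ u, HasTrace Ω v u ∧ ∀ᵐ z ∂cylMeasure s Ω, v z = u z.1 + primitive gy z := by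
  obtain ⟨c, hc⟩ := exists_eq_add_primitive hs hs1 hΩ h.memLp h.memLp_y h.weak_y
  have hpm := ae_aestronglyMeasurable_slice (aestronglyMeasurable_primitive h.memLp_y.1)
  have hcy := ae_ae_cylMeasure hc
  have hpos : ∀ᵐ y ∂volume.restrict (Ioi (0 : ℝ)), 0 < y := ae_restrict_mem measurableSet_Ioi
  have hsq : ∀ y, 0 < y → eLpNorm (fun x => primitive gy (x, y)) 2 (gaussOn Ω) ^ 2 ≤
      ENNReal.ofReal (y ^ (2 * s) / (2 * s)) * eLpNorm gy 2 (cylMeasure s Ω) ^ 2 := fun y hy => by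
    rw [eLpNorm_two_sq]; exact lintegral_primitive_sq_le hs h.memLp_y hy
  refine ⟨c, ⟨?_, ?_⟩, hc⟩
  · -- the trace is square integrable because it is a difference of such functions at some height
    have : (ae (volume.restrict (Ioi (0 : ℝ)))).NeBot := by
      rw [ae_neBot]
      intro h0
      have := congrArg (fun m => m univ) h0
      simp at this
    obtain ⟨y, ⟨⟨hy1, hy2⟩, hy3⟩, hy4⟩ := (((hpm.and hcy).and hpos).and h.lateral).exists
    have hP : MemLp (fun x => primitive gy (x, y)) 2 (gaussOn Ω) := by
      refine ⟨hy1, ?_⟩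
      have := (hsq y hy3).trans_lt (ENNReal.mul_lt_top ENNReal.ofReal_lt_top
        (ENNReal.pow_lt_top h.memLp_y.2))
      exact (ENNReal.pow_lt_top_iff.1 this).resolve_right (by norm_num)
    refine (memLp_congr_ae ?_).1 (hy4.1.sub hP)
    filter_upwards [hy2] with x hx
    simp [hx]
  · refine tendsto_zero_of_sq ?_
    have hlim : Tendsto (fun y : ℝ => ENNReal.ofReal (y ^ (2 * s) / (2 * s)) *
        eLpNorm gy 2 (cylMeasure s Ω) ^ 2) (𝓝[>] 0 ⊓ ae volume) (𝓝 0) := by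
      have h1 : Tendsto (fun y : ℝ => y ^ (2 * s) / (2 * s)) (𝓝 0) (𝓝 (0 ^ (2 * s) / (2 * s))) :=
        ((Real.continuousAt_rpow_const 0 (2 * s) (Or.inr (by linarith))).tendsto).div_const _
      rw [Real.zero_rpow (by linarith), zero_div] at h1
      have h2 := ENNReal.Tendsto.mul_const (b := eLpNorm gy 2 (cylMeasure s Ω) ^ 2)
        (ENNReal.tendsto_ofReal h1) (Or.inr (ENNReal.pow_lt_top h.memLp_y.2).ne)
      rw [ENNReal.ofReal_zero, zero_mul] at h2
      exact h2.mono_left (inf_le_left.trans nhdsWithin_le_nhds)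
    refine tendsto_of_tendsto_of_tendsto_of_le_of_le' tendsto_const_nhds hlim
      (Eventually.of_forall fun _ => zero_le) ?_
    have e1 : ∀ᶠ y in 𝓝[>] (0 : ℝ) ⊓ ae volume, y ∈ Ioi (0 : ℝ) :=
      Filter.Eventually.filter_mono inf_le_left self_mem_nhdsWithin
    have e2 := Filter.Eventually.filter_mono (inf_le_right (a := 𝓝[>] (0 : ℝ)))
      ((ae_restrict_iff' measurableSet_Ioi).1 hcy)
    filter_upwards [e1, e2] with y hy1 hy2
    refine le_trans (le_of_eq ?_) (hsq y hy1)
    congr 1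
    refine eLpNorm_congr_ae ?_
    filter_upwards [hy2 hy1] with x hx
    simp [hx]

lemma IsEnergy.eventually_memLp {v : EuclideanSpace ℝ (Fin n) × ℝ → ℝ}
    {gx : EuclideanSpace ℝ (Fin n) × ℝ → EuclideanSpace ℝ (Fin n)}
    {gy : EuclideanSpace ℝ (Fin n) × ℝ → ℝ} (h : IsEnergy s Ω v gx gy) :
    ∀ᶠ y in 𝓝[>] (0 : ℝ) ⊓ ae volume, MemLp (fun x => v (x, y)) 2 (gaussOn Ω) := by
  have e1 : ∀ᶠ y in 𝓝[>] (0 : ℝ) ⊓ ae volume, y ∈ Ioi (0 : ℝ) :=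
    Filter.Eventually.filter_mono inf_le_left self_mem_nhdsWithin
  have e2 := Filter.Eventually.filter_mono (inf_le_right (a := 𝓝[>] (0 : ℝ)))
    ((ae_restrict_iff' measurableSet_Ioi).1 h.lateral)
  filter_upwards [e1, e2] with y hy1 hy2 using (hy2 hy1).1

lemma IsEnergy.trace_unique {v : EuclideanSpace ℝ (Fin n) × ℝ → ℝ}
    {gx : EuclideanSpace ℝ (Fin n) × ℝ → EuclideanSpace ℝ (Fin n)}
    {gy : EuclideanSpace ℝ (Fin n) × ℝ → ℝ} (h : IsEnergy s Ω v gx gy)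
    {u u' : EuclideanSpace ℝ (Fin n) → ℝ} (hu : HasTrace Ω v u) (hu' : HasTrace Ω v u') :
    u =ᵐ[gaussOn Ω] u' := by
  have hlim := hu.2.add hu'.2
  rw [add_zero] at hlim
  have h0 : eLpNorm (fun x => u x - u' x) 2 (gaussOn Ω) ≤ 0 := by
    refine ge_of_tendsto hlim ?_
    filter_upwards [h.eventually_memLp] with y hy
    have h1 := eLpNorm_add_le (hu.1.1.sub hy.1) (hy.1.sub hu'.1.1) (p := 2) (by norm_num)
    refine le_trans (le_of_eq ?_) (h1.trans (le_of_eq ?_))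
    · congr 1; ext x; simp
    · congr 1
      exact eLpNorm_sub_comm _ _ _ _
  have h1 := (eLpNorm_eq_zero_iff (hu.1.1.sub hu'.1.1) two_ne_zero).1 (le_antisymm h0 zero_le)
  filter_upwards [h1] with x hx
  exact sub_eq_zero.1 hx

/-- The Poincaré inequality on the cylinder, by integration over the slices. -/
lemma IsEnergy.poincare [NeZero n] {v : EuclideanSpace ℝ (Fin n) × ℝ → ℝ}
    {gx : EuclideanSpace ℝ (Fin n) × ℝ → EuclideanSpace ℝ (Fin n)}
    {gy : EuclideanSpace ℝ (Fin n) × ℝ → ℝ} (h : IsEnergy s (halfSpace n) v gx gy) :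
    eLpNorm v 2 (cylMeasure s (halfSpace n)) ^ 2 ≤
      eLpNorm gx 2 (cylMeasure s (halfSpace n)) ^ 2 := by
  rw [lintegral_sq_cylMeasure h.memLp.1, lintegral_sq_cylMeasure h.memLp_x.1]
  refine lintegral_mono_ae (ae_weightMeasure_iff.2 ?_)
  filter_upwards [h.lateral] with y hy
  gcongr
  exact hy.poincare

/-- The trace inequality `‖v(·, 0)‖² ≤ C ∬ y^a |∇v|²`. -/
lemma exists_trace_inequality (n : ℕ) [NeZero n] (hs : 0 < s) (hs1 : s < 1) :
    ∃ C : NNReal, ∀ {v : EuclideanSpace ℝ (Fin n) × ℝ → ℝ}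
      {gx : EuclideanSpace ℝ (Fin n) × ℝ → EuclideanSpace ℝ (Fin n)}
      {gy : EuclideanSpace ℝ (Fin n) × ℝ → ℝ} {u : EuclideanSpace ℝ (Fin n) → ℝ},
      IsEnergy s (halfSpace n) v gx gy → HasTrace (halfSpace n) v u →
      eLpNorm u 2 (gaussOn (halfSpace n)) ^ 2 ≤
        C * (eLpNorm gx 2 (cylMeasure s (halfSpace n)) ^ 2 +
          eLpNorm gy 2 (cylMeasure s (halfSpace n)) ^ 2) := by
  set W := weightMeasure s (Iic 1) with hW
  have hWt : W ≠ ⊤ := (weightMeasure_Iic_lt_top hs1 1).ne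
  have hW0 : W ≠ 0 := by
    rw [hW, weightMeasure, withDensity_apply _ measurableSet_Iic,
      Measure.restrict_restrict measurableSet_Iic, inter_comm, Ioi_inter_Iic]
    have := lintegral_Ioc_rpow (s := 1 - s) (by linarith) one_pos
    rw [show 2 * (1 - s) - 1 = 1 - 2 * s by ring] at this
    rw [this]
    simp
    linarith
  set A : ℝ≥0∞ := ENNReal.ofReal (1 / (2 * s)) with hA
  have hCt : 2 * W⁻¹ + 2 * A ≠ ⊤ := by
    refine ENNReal.add_ne_top.2 ⟨ENNReal.mul_ne_top (by simp) (by simpa), ?_⟩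
    exact ENNReal.mul_ne_top (by simp) ENNReal.ofReal_ne_top
  refine ⟨(2 * W⁻¹ + 2 * A).toNNReal, fun {v gx gy u} h hu => ?_⟩
  rw [ENNReal.coe_toNNReal hCt]
  obtain ⟨c, hcT, hc⟩ := h.exists_hasTrace hs hs1 (isOpen_halfSpace n)
  rw [eLpNorm_congr_ae (h.trace_unique hu hcT)]
  set γ := gaussOn (halfSpace n)
  set B := eLpNorm gy 2 (cylMeasure s (halfSpace n)) ^ 2 with hB
  set G := eLpNorm gx 2 (cylMeasure s (halfSpace n)) ^ 2 with hG
  have hpm := ae_aestronglyMeasurable_slice (aestronglyMeasurable_primitive h.memLp_y.1)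
  have hpos : ∀ᵐ y ∂volume.restrict (Ioi (0 : ℝ)), 0 < y := ae_restrict_mem measurableSet_Ioi
  -- an inequality for almost every `y ∈ (0, 1]`, to be averaged with respect to `y^a dy`
  have hle : ∀ᵐ y ∂(weightMeasure s).restrict (Iic 1), eLpNorm c 2 γ ^ 2 ≤
      2 * eLpNorm (fun x => v (x, y)) 2 γ ^ 2 + 2 * (A * B) := by
    rw [ae_restrict_iff' measurableSet_Iic]
    refine ae_weightMeasure_iff.2 ?_
    filter_upwards [hpm, ae_ae_cylMeasure hc, hpos, h.lateral] with y hy1 hy2 hy3 hy4 hy5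
    have hsq : eLpNorm (fun x => primitive gy (x, y)) 2 γ ^ 2 ≤ A * B := by
      rw [eLpNorm_two_sq]
      refine (lintegral_primitive_sq_le hs h.memLp_y hy3).trans ?_
      rw [hA, hB]
      gcongr
      exact Real.rpow_le_one hy3.le hy5 (by linarith)
    have e : eLpNorm c 2 γ = eLpNorm (fun x => v (x, y) + -primitive gy (x, y)) 2 γ := by
      refine eLpNorm_congr_ae ?_
      filter_upwards [hy2] with x hx
      simp [hx]
    rw [e]
    refine (eLpNorm_add_sq_le (g := fun x => -primitive gy (x, y)) hy4.1.1 hy1.neg).trans ?_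
    have e2 : eLpNorm (fun x => -primitive gy (x, y)) 2 γ =
      eLpNorm (fun x => primitive gy (x, y)) 2 γ :=
      eLpNorm_neg (f := fun x => primitive gy (x, y)) ..
    rw [e2]
    gcongr
  have hint := lintegral_mono_ae hle
  rw [lintegral_const, Measure.restrict_apply_univ, ← hW, lintegral_add_right _ measurable_const,
    lintegral_const, Measure.restrict_apply_univ, ← hW,
    lintegral_const_mul' _ _ (by simp)] at hint
  have hv2 : ∫⁻ y in Iic 1, eLpNorm (fun x => v (x, y)) 2 γ ^ 2 ∂weightMeasure s ≤ G := by
    refine (setLIntegral_le_lintegral _ _).trans ?_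
    rw [← lintegral_sq_cylMeasure h.memLp.1]
    exact h.poincare
  calc eLpNorm c 2 γ ^ 2 = eLpNorm c 2 γ ^ 2 * W * W⁻¹ := by
        rw [mul_assoc, ENNReal.mul_inv_cancel hW0 hWt, mul_one]
    _ ≤ (2 * G + 2 * (A * B) * W) * W⁻¹ := by gcongr; exact hint.trans (by gcongr)
    _ = 2 * W⁻¹ * G + 2 * A * B := by
        rw [add_mul, mul_assoc (2 * (A * B)), ENNReal.mul_inv_cancel hW0 hWt]; ring
    _ ≤ (2 * W⁻¹ + 2 * A) * G + (2 * W⁻¹ + 2 * A) * B := by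
        gcongr <;> simp
    _ = _ := by ring

/-- The chain rule in the energy space. -/
lemma IsEnergy.comp (hs : 0 < s) (hs1 : s < 1) (hΩ : IsOpen Ω)
    {v : EuclideanSpace ℝ (Fin n) × ℝ → ℝ}
    {gx : EuclideanSpace ℝ (Fin n) × ℝ → EuclideanSpace ℝ (Fin n)}
    {gy : EuclideanSpace ℝ (Fin n) × ℝ → ℝ} (h : IsEnergy s Ω v gx gy) {f : ℝ → ℝ}
    (hf : ContDiff ℝ ∞ f) (h0 : f 0 = 0) {L : NNReal} (hL : ∀ t, ‖deriv f t‖₊ ≤ L) :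
    IsEnergy s Ω (fun z => f (v z)) (fun z => deriv f (v z) • gx z)
      (fun z => deriv f (v z) * gy z) := by
  have hlip : LipschitzWith L f := lipschitzWith_of_nnnorm_deriv_le (hf.differentiable (by simp)) hL
  have hd : Continuous (deriv f) := hf.continuous_deriv (by simp)
  have hL' : ∀ t, ‖deriv f t‖ ≤ L := fun t => hL t
  have hdv := hd.comp_aestronglyMeasurable h.memLp.1
  have hfv : MemLp (fun z => f (v z)) 2 (cylMeasure s Ω) := hlip.comp_memLp h0 h.memLp
  have hfx : MemLp (fun z => deriv f (v z) • gx z) 2 (cylMeasure s Ω) :=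
    (h.memLp_x.norm.const_mul (L : ℝ)).of_le (hdv.smul h.memLp_x.1) (ae_of_all _ fun x => by
      rw [norm_smul, norm_mul, norm_norm]
      gcongr
      exact (hL' (v x)).trans (le_abs_self _))
  have hfy : MemLp (fun z => deriv f (v z) * gy z) 2 (cylMeasure s Ω) :=
    (h.memLp_y.norm.const_mul (L : ℝ)).of_le (hdv.mul h.memLp_y.1) (ae_of_all _ fun x => by
      rw [norm_mul, norm_mul, norm_norm]
      gcongr
      exact (hL' (v x)).trans (le_abs_self _))
  obtain ⟨u, -, hu⟩ := h.exists_hasTrace hs hs1 hΩ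
  refine IsEnergy.of_lateral hΩ.measurableSet hfv hfx hfy (fun ζ hζ => ?_) ?_
  · obtain ⟨C, hC⟩ := hζ.exists_bound
    obtain ⟨C', hC'⟩ := hζ.exists_bound_fderiv (0, 1)
    exact integral_comp_mul_fderiv_of_primitive hs hΩ.measurableSet h.memLp_y hu hf hL hζ
      (integrableOn_mul_of_memLp hΩ.measurableSet hζ.2.1 hζ.2.2 (hζ.measurable_fderiv (0, 1))
        hC' (fun x hx => hζ.fderiv_eq_zero hx _) hfv)
      (integrableOn_mul_of_memLp hΩ.measurableSet hζ.2.1 hζ.2.2 hζ.1.continuous.measurable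
        hC (fun x hx => image_eq_zero_of_notMem_tsupport hx) hfy)
  · filter_upwards [h.lateral] with y hy using hy.comp hf h0 hL

lemma HasTrace.comp {v : EuclideanSpace ℝ (Fin n) × ℝ → ℝ} {u : EuclideanSpace ℝ (Fin n) → ℝ}
    (h : HasTrace Ω v u) {f : ℝ → ℝ} {L : NNReal} (hf : LipschitzWith L f) (h0 : f 0 = 0) :
    HasTrace Ω (fun z => f (v z)) (fun x => f (u x)) := by
  refine ⟨hf.comp_memLp h0 h.1, ?_⟩
  have hlim := ENNReal.Tendsto.const_mul (a := (L : ℝ≥0∞)) h.2 (Or.inr (by simp))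
  rw [mul_zero] at hlim
  refine tendsto_of_tendsto_of_tendsto_of_le_of_le tendsto_const_nhds hlim (fun _ => zero_le)
    fun y => eLpNorm_le_nnreal_smul_eLpNorm_of_ae_le_mul (ae_of_all _ fun x => ?_) 2
  simpa [nndist_eq_nnnorm] using hf.nndist_le (v (x, y)) (u x)

lemma IsEnergy.add (hΩ : MeasurableSet Ω) {v v' : EuclideanSpace ℝ (Fin n) × ℝ → ℝ}
    {gx gx' : EuclideanSpace ℝ (Fin n) × ℝ → EuclideanSpace ℝ (Fin n)}
    {gy gy' : EuclideanSpace ℝ (Fin n) × ℝ → ℝ} (h : IsEnergy s Ω v gx gy)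
    (h' : IsEnergy s Ω v' gx' gy') :
    IsEnergy s Ω (fun z => v z + v' z) (fun z => gx z + gx' z) (fun z => gy z + gy' z) := by
  refine IsEnergy.of_lateral hΩ (h.memLp.add h'.memLp) (h.memLp_x.add h'.memLp_x)
    (h.memLp_y.add h'.memLp_y) (fun ζ hζ => ?_) ?_
  · obtain ⟨C, hC⟩ := hζ.exists_bound
    obtain ⟨C', hC'⟩ := hζ.exists_bound_fderiv (0, 1)
    have h1 := fun {f : EuclideanSpace ℝ (Fin n) × ℝ → ℝ} (hf : MemLp f 2 (cylMeasure s Ω)) =>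
      (integrableOn_mul_of_memLp hΩ hζ.2.1 hζ.2.2 (hζ.measurable_fderiv (0, 1))
        hC' (fun x hx => hζ.fderiv_eq_zero hx _) hf)
    have h2 := fun {f : EuclideanSpace ℝ (Fin n) × ℝ → ℝ} (hf : MemLp f 2 (cylMeasure s Ω)) =>
      (integrableOn_mul_of_memLp hΩ hζ.2.1 hζ.2.2 hζ.1.continuous.measurable
        hC (fun x hx => image_eq_zero_of_notMem_tsupport hx) hf)
    simp only [add_mul]
    rw [integral_add (h1 h.memLp) (h1 h'.memLp), integral_add (h2 h.memLp_y) (h2 h'.memLp_y),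
      h.weak_y ζ hζ, h'.weak_y ζ hζ]
    ring
  · filter_upwards [h.lateral, h'.lateral] with y hy hy' using hy.add hy'

lemma IsEnergy.const_mul (hs : 0 < s) (hs1 : s < 1) (hΩ : IsOpen Ω)
    {v : EuclideanSpace ℝ (Fin n) × ℝ → ℝ}
    {gx : EuclideanSpace ℝ (Fin n) × ℝ → EuclideanSpace ℝ (Fin n)}
    {gy : EuclideanSpace ℝ (Fin n) × ℝ → ℝ} (h : IsEnergy s Ω v gx gy) (c : ℝ) :
    IsEnergy s Ω (fun z => c * v z) (fun z => c • gx z) (fun z => c * gy z) := by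
  have := h.comp hs hs1 hΩ (f := fun t => c * t) (by fun_prop) (by simp) (L := ‖c‖₊)
    (fun t => by simp)
  simpa [deriv_const_mul_field] using this

lemma HasTrace.const_mul {v : EuclideanSpace ℝ (Fin n) × ℝ → ℝ}
    {u : EuclideanSpace ℝ (Fin n) → ℝ} (h : HasTrace Ω v u) (c : ℝ) :
    HasTrace Ω (fun z => c * v z) (fun x => c * u x) :=
  h.comp (lipschitzWith_smul c) (by simp)

lemma HasTrace.add {v v' : EuclideanSpace ℝ (Fin n) × ℝ → ℝ}
    {gx gx' : EuclideanSpace ℝ (Fin n) × ℝ → EuclideanSpace ℝ (Fin n)}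
    {gy gy' : EuclideanSpace ℝ (Fin n) × ℝ → ℝ}
    {u u' : EuclideanSpace ℝ (Fin n) → ℝ} (h : HasTrace Ω v u) (h' : HasTrace Ω v' u')
    (he : IsEnergy s Ω v gx gy) (he' : IsEnergy s Ω v' gx' gy') :
    HasTrace Ω (fun z => v z + v' z) (fun x => u x + u' x) := by
  refine ⟨h.1.add h'.1, ?_⟩
  have hlim := h.2.add h'.2
  rw [add_zero] at hlim
  refine tendsto_of_tendsto_of_tendsto_of_le_of_le' tendsto_const_nhds hlim
    (Eventually.of_forall fun _ => zero_le) ?_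
  filter_upwards [he.eventually_memLp, he'.eventually_memLp] with y hy hy'
  refine le_trans (le_of_eq ?_) (eLpNorm_add_le (hy.1.sub h.1.1) (hy'.1.sub h'.1.1) (by norm_num))
  congr 1; ext x; simp; ring

lemma IsEnergy.sub (hs : 0 < s) (hs1 : s < 1) (hΩ : IsOpen Ω)
    {v v' : EuclideanSpace ℝ (Fin n) × ℝ → ℝ}
    {gx gx' : EuclideanSpace ℝ (Fin n) × ℝ → EuclideanSpace ℝ (Fin n)}
    {gy gy' : EuclideanSpace ℝ (Fin n) × ℝ → ℝ} (h : IsEnergy s Ω v gx gy)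
    (h' : IsEnergy s Ω v' gx' gy') :
    IsEnergy s Ω (fun z => v z - v' z) (fun z => gx z - gx' z) (fun z => gy z - gy' z) := by
  simpa [sub_eq_add_neg] using h.add hΩ.measurableSet (h'.const_mul hs hs1 hΩ (-1))

lemma HasTrace.sub (hs : 0 < s) (hs1 : s < 1) (hΩ : IsOpen Ω)
    {v v' : EuclideanSpace ℝ (Fin n) × ℝ → ℝ}
    {gx gx' : EuclideanSpace ℝ (Fin n) × ℝ → EuclideanSpace ℝ (Fin n)}
    {gy gy' : EuclideanSpace ℝ (Fin n) × ℝ → ℝ}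
    {u u' : EuclideanSpace ℝ (Fin n) → ℝ} (h : HasTrace Ω v u) (h' : HasTrace Ω v' u')
    (he : IsEnergy s Ω v gx gy) (he' : IsEnergy s Ω v' gx' gy') :
    HasTrace Ω (fun z => v z - v' z) (fun x => u x - u' x) := by
  simpa [sub_eq_add_neg] using h.add (h'.const_mul (-1)) he (he'.const_mul hs hs1 hΩ (-1))

/-- The energy space is closed in `L²`. -/
lemma IsEnergy.of_tendsto (hΩ : MeasurableSet Ω) {v : ℕ → EuclideanSpace ℝ (Fin n) × ℝ → ℝ}
    {gx : ℕ → EuclideanSpace ℝ (Fin n) × ℝ → EuclideanSpace ℝ (Fin n)}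
    {gy : ℕ → EuclideanSpace ℝ (Fin n) × ℝ → ℝ} (h : ∀ j, IsEnergy s Ω (v j) (gx j) (gy j))
    {v' : EuclideanSpace ℝ (Fin n) × ℝ → ℝ}
    {gx' : EuclideanSpace ℝ (Fin n) × ℝ → EuclideanSpace ℝ (Fin n)}
    {gy' : EuclideanSpace ℝ (Fin n) × ℝ → ℝ} (hv : MemLp v' 2 (cylMeasure s Ω))
    (hx : MemLp gx' 2 (cylMeasure s Ω)) (hy : MemLp gy' 2 (cylMeasure s Ω))
    (tv : Tendsto (fun j => eLpNorm (fun z => v j z - v' z) 2 (cylMeasure s Ω)) atTop (𝓝 0))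
    (tx : Tendsto (fun j => eLpNorm (fun z => gx j z - gx' z) 2 (cylMeasure s Ω)) atTop (𝓝 0))
    (ty : Tendsto (fun j => eLpNorm (fun z => gy j z - gy' z) 2 (cylMeasure s Ω)) atTop (𝓝 0)) :
    IsEnergy s Ω v' gx' gy' := by
  refine IsEnergy.of_lateral hΩ hv hx hy (fun ζ hζ => ?_) ?_
  · obtain ⟨C, hC⟩ := hζ.exists_bound
    obtain ⟨C', hC'⟩ := hζ.exists_bound_fderiv (0, 1)
    obtain ⟨k, hk, hk1⟩ := exists_memLp_pairing_cyl s hΩ hζ.2.1 hζ.2.2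
      hζ.1.continuous.measurable hC fun x hx => image_eq_zero_of_notMem_tsupport hx
    obtain ⟨k', hk', hk1'⟩ := exists_memLp_pairing_cyl s hΩ hζ.2.1 hζ.2.2
      (hζ.measurable_fderiv (0, 1)) hC' fun x hx => hζ.fderiv_eq_zero hx _
    rw [(hk1' _).1, (hk1 _).1]
    refine tendsto_nhds_unique
      (tendsto_integral_mul_of_eLpNorm (fun j => (h j).memLp) hv hk' tv)
      ((tendsto_integral_mul_of_eLpNorm (fun j => (h j).memLp_y) hy hk ty).neg.congr fun j => ?_)
    rw [← (hk1' _).1, ← (hk1 _).1, (h j).weak_y ζ hζ]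
  · -- along a fast subsequence almost every slice converges
    set N : ℕ → ℝ≥0∞ := fun j => eLpNorm (fun z => v j z - v' z) 2 (cylMeasure s Ω) ^ 2 +
      eLpNorm (fun z => gx j z - gx' z) 2 (cylMeasure s Ω) ^ 2 with hN
    have hN0 : Tendsto N atTop (𝓝 0) := by
      have h1 := ((ENNReal.continuous_pow 2).tendsto _).comp tv
      have h2 := ((ENNReal.continuous_pow 2).tendsto _).comp tx
      simpa [hN] using h1.add h2
    have hex : ∀ k : ℕ, ∃ j, N j ≤ (2⁻¹ : ℝ≥0∞) ^ k := fun k =>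
      (hN0.eventually_le_const (ENNReal.pow_pos (by simp) k)).exists
    choose ns hns using hex
    have hm : ∀ j, AEStronglyMeasurable (fun z => v j z - v' z) (cylMeasure s Ω) := fun j =>
      (h j).memLp.1.sub hv.1
    have hmx : ∀ j, AEStronglyMeasurable (fun z => gx j z - gx' z) (cylMeasure s Ω) := fun j =>
      (h j).memLp_x.1.sub hx.1
    set M : ℕ → ℝ → ℝ≥0∞ := fun k y =>
      eLpNorm (fun x => v (ns k) (x, y) - v' (x, y)) 2 (gaussOn Ω) ^ 2 +
      eLpNorm (fun x => gx (ns k) (x, y) - gx' (x, y)) 2 (gaussOn Ω) ^ 2 with hM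
    have hMm : ∀ k, AEMeasurable (M k) (weightMeasure s) := by
      intro k
      have h1 := aemeasurable_eLpNorm_slice (hm (ns k))
      have h2 := aemeasurable_eLpNorm_slice (hmx (ns k))
      exact h1.add h2
    have hMi : ∀ k, ∫⁻ y, M k y ∂weightMeasure s = N (ns k) := by
      intro k
      rw [hM, lintegral_add_left' (aemeasurable_eLpNorm_slice (hm (ns k))), hN]
      simp only
      rw [lintegral_sq_cylMeasure (hm (ns k)), lintegral_sq_cylMeasure (hmx (ns k))]
    have hsum : ∫⁻ y, ∑' k, M k y ∂weightMeasure s ≠ ⊤ := by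
      rw [lintegral_tsum hMm]
      simp only [hMi]
      refine ne_top_of_le_ne_top ?_ (ENNReal.tsum_le_tsum hns)
      rw [ENNReal.tsum_geometric]
      simp
    have hfin := ae_lt_top' (AEMeasurable.tsum hMm) hsum
    have hlat : ∀ᵐ y ∂volume.restrict (Ioi (0 : ℝ)), ∀ j,
        IsH10 Ω (fun x => v j (x, y)) (fun x => gx j (x, y)) :=
      ae_all_iff.2 fun j => (h j).lateral
    filter_upwards [ae_weightMeasure_iff.1 hfin, hlat, ae_memLp_slice hv,
      ae_memLp_slice hx] with y h1 h2 h3 h4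
    have h5 := ENNReal.tendsto_atTop_zero_of_tsum_ne_top h1.ne
    refine IsH10.of_tendsto (fun k => h2 (ns k)) h3 h4 (tendsto_zero_of_sq ?_)
      (tendsto_zero_of_sq ?_)
    · exact tendsto_of_tendsto_of_tendsto_of_le_of_le tendsto_const_nhds h5 (fun _ => zero_le)
        fun k => le_self_add
    · exact tendsto_of_tendsto_of_tendsto_of_le_of_le tendsto_const_nhds h5 (fun _ => zero_le)
        fun k => le_add_self

end

/-! ### Existence of weak solutions -/

/-- The Lax-Milgram theorem for the form `⟪P w, P v⟫` on a closed subspace. -/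
lemma exists_inner_eq_of_coercive {X Y : Type*} [NormedAddCommGroup X] [InnerProductSpace ℝ X]
    [CompleteSpace X] [NormedAddCommGroup Y] [InnerProductSpace ℝ Y] (S : Submodule ℝ X)
    (hS : IsClosed (S : Set X)) (P : X →L[ℝ] Y) {C : ℝ} (hC : 0 < C)
    (hP : ∀ x ∈ S, ‖x‖ ^ 2 ≤ C * ‖P x‖ ^ 2) (l : X →L[ℝ] ℝ) :
    ∃ w ∈ S, ∀ v ∈ S, ⟪P w, P v⟫ = l v := by
  have : CompleteSpace S := hS.completeSpace_coe
  let B : S →L[ℝ] S →L[ℝ] ℝ :=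
    (innerSL ℝ : Y →L[ℝ] Y →L[ℝ] ℝ).bilinearComp (P.comp S.subtypeL) (P.comp S.subtypeL)
  have hB : IsCoercive B := by
    refine ⟨C⁻¹, by positivity, fun u => ?_⟩
    have h := hP u u.2
    have h1 : B u u = ‖P u‖ ^ 2 := real_inner_self_eq_norm_sq (P u)
    rw [h1, mul_assoc, inv_mul_le_iff₀ hC, ← sq]
    exact h
  let e := hB.continuousLinearEquivOfBilin
  let r : S := (InnerProductSpace.toDual ℝ S).symm (l.comp S.subtypeL)
  refine ⟨(e.symm r : S), (e.symm r).2, fun v hv => ?_⟩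
  have h1 := hB.continuousLinearEquivOfBilin_apply (e.symm r) ⟨v, hv⟩
  have h2 : hB.continuousLinearEquivOfBilin (e.symm r) = r := e.apply_symm_apply r
  rw [h2, InnerProductSpace.toDual_symm_apply] at h1
  exact h1.symm

lemma ae_eq_of_tendsto_eLpNorm {X F : Type*} [MeasurableSpace X] [NormedAddCommGroup F]
    {μ : Measure X} {u : ℕ → X → F} {a c : X → F} (hu : ∀ j, AEStronglyMeasurable (u j) μ)
    (ha : AEStronglyMeasurable a μ) (hc : AEStronglyMeasurable c μ)
    (h1 : Tendsto (fun j => eLpNorm (fun x => u j x - a x) 2 μ) atTop (𝓝 0))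
    (h2 : Tendsto (fun j => eLpNorm (fun x => u j x - c x) 2 μ) atTop (𝓝 0)) : a =ᵐ[μ] c := by
  have s6 := tendsto_eLpNorm_add (fun j => ha.sub (hu j)) (fun j => (hu j).sub hc)
    (h1.congr fun j => eLpNorm_sub_comm' _ _) h2
  have s7 : eLpNorm (fun x => a x - c x) 2 μ = 0 := by
    refine tendsto_nhds_unique (tendsto_const_nhds) (s6.congr fun j => ?_)
    congr 1; ext x; simp
  filter_upwards [(eLpNorm_eq_zero_iff (ha.sub hc) two_ne_zero).1 s7] with x hx
  exact sub_eq_zero.1 hx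

lemma tendsto_withLp_fst {ι X Y : Type*} [NormedAddCommGroup X] [NormedAddCommGroup Y]
    {l : Filter ι} {f : ι → WithLp 2 (X × Y)} {a : WithLp 2 (X × Y)} (h : Tendsto f l (𝓝 a)) :
    Tendsto (fun j => (f j).fst) l (𝓝 a.fst) :=
  ((continuous_fst.comp (WithLp.prod_continuous_ofLp 2 X Y)).tendsto a).comp h

lemma tendsto_withLp_snd {ι X Y : Type*} [NormedAddCommGroup X] [NormedAddCommGroup Y]
    {l : Filter ι} {f : ι → WithLp 2 (X × Y)} {a : WithLp 2 (X × Y)} (h : Tendsto f l (𝓝 a)) :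
    Tendsto (fun j => (f j).snd) l (𝓝 a.snd) :=
  ((continuous_snd.comp (WithLp.prod_continuous_ofLp 2 X Y)).tendsto a).comp h

section
variable {n : ℕ} [NeZero n] {s : ℝ}

/-- The Hilbert space of square integrable gradients. -/
abbrev GradSpace (n : ℕ) [NeZero n] (s : ℝ) : Type :=
  WithLp 2 (Lp (EuclideanSpace ℝ (Fin n)) 2 (cylMeasure s (halfSpace n)) ×
    Lp ℝ 2 (cylMeasure s (halfSpace n)))

/-- The Hilbert space of pairs of a square integrable function on the cylinder and a square
integrable function on the half-space. -/
abbrev ValueSpace (n : ℕ) [NeZero n] (s : ℝ) : Type :=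
  WithLp 2 (Lp ℝ 2 (cylMeasure s (halfSpace n)) × Lp ℝ 2 (gaussOn (halfSpace n)))

/-- The Hilbert space of square integrable gradients, functions and traces. -/
abbrev AmbientSpace (n : ℕ) [NeZero n] (s : ℝ) : Type :=
  WithLp 2 (GradSpace n s × ValueSpace n s)

/-- `f` consists of the gradient, the values and the trace of a function of finite energy. -/
def IsEnergyElement (f : AmbientSpace n s) : Prop :=
  ∃ v gx gy u, IsEnergy s (halfSpace n) v gx gy ∧ HasTrace (halfSpace n) v u ∧
    f.fst.fst =ᵐ[cylMeasure s (halfSpace n)] gx ∧ f.fst.snd =ᵐ[cylMeasure s (halfSpace n)] gy ∧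
    f.snd.fst =ᵐ[cylMeasure s (halfSpace n)] v ∧ f.snd.snd =ᵐ[gaussOn (halfSpace n)] u

/-- The functions of finite energy, as a subspace of `AmbientSpace`. -/
def energySubmodule (n : ℕ) [NeZero n] (hs : 0 < s) (hs1 : s < 1) :
    Submodule ℝ (AmbientSpace n s) where
  carrier := {f | IsEnergyElement f}
  zero_mem' := by
    have h0 : IsEnergy s (halfSpace n) (fun _ => 0) (fun _ => 0) (fun _ => 0) := by
      refine IsEnergy.of_lateral (isOpen_halfSpace n).measurableSet MemLp.zero MemLp.zero
        MemLp.zero (fun ζ _ => by simp) (ae_of_all _ fun y => ⟨MemLp.zero, MemLp.zero,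
          fun _ _ => 0, fun _ => ⟨contDiff_const, HasCompactSupport.zero, ?_⟩, ?_, ?_⟩)
      · rw [tsupport_eq_empty_iff.2 (by rfl)]; exact empty_subset _
      · simp
      · simp [gradient]
    refine ⟨_, _, _, fun _ => 0, h0, ⟨MemLp.zero, by simp⟩, ?_, ?_, ?_, ?_⟩
    all_goals exact Lp.coeFn_zero _ _ _
  add_mem' := by
    rintro f f' ⟨v, gx, gy, u, h, hu, h1, h2, h3, h4⟩
      ⟨v', gx', gy', u', h', hu', h1', h2', h3', h4'⟩
    refine ⟨_, _, _, _, h.add (isOpen_halfSpace n).measurableSet h',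
      hu.add hu' h h', ?_, ?_, ?_, ?_⟩
    · exact (Lp.coeFn_add _ _).trans (h1.add h1')
    · exact (Lp.coeFn_add _ _).trans (h2.add h2')
    · exact (Lp.coeFn_add _ _).trans (h3.add h3')
    · exact (Lp.coeFn_add _ _).trans (h4.add h4')
  smul_mem' := by
    rintro c f ⟨v, gx, gy, u, h, hu, h1, h2, h3, h4⟩
    refine ⟨_, _, _, _, h.const_mul hs hs1 (isOpen_halfSpace n) c, hu.const_mul c, ?_, ?_, ?_, ?_⟩
    · exact (Lp.coeFn_smul _ _).trans (h1.const_smul c)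
    · exact (Lp.coeFn_smul _ _).trans (h2.const_smul c)
    · exact (Lp.coeFn_smul _ _).trans (h3.const_smul c)
    · exact (Lp.coeFn_smul _ _).trans (h4.const_smul c)

/-- If the gradients of functions of finite energy converge, then so do the traces, by the trace
inequality. -/
lemma IsEnergy.tendsto_trace (hs : 0 < s) (hs1 : s < 1)
    {v : ℕ → EuclideanSpace ℝ (Fin n) × ℝ → ℝ}
    {gx : ℕ → EuclideanSpace ℝ (Fin n) × ℝ → EuclideanSpace ℝ (Fin n)}
    {gy : ℕ → EuclideanSpace ℝ (Fin n) × ℝ → ℝ} {u : ℕ → EuclideanSpace ℝ (Fin n) → ℝ}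
    {v' : EuclideanSpace ℝ (Fin n) × ℝ → ℝ}
    {gx' : EuclideanSpace ℝ (Fin n) × ℝ → EuclideanSpace ℝ (Fin n)}
    {gy' : EuclideanSpace ℝ (Fin n) × ℝ → ℝ} {c : EuclideanSpace ℝ (Fin n) → ℝ}
    (h : ∀ j, IsEnergy s (halfSpace n) (v j) (gx j) (gy j))
    (he : IsEnergy s (halfSpace n) v' gx' gy') (hu : ∀ j, HasTrace (halfSpace n) (v j) (u j))
    (hc : HasTrace (halfSpace n) v' c)
    (s1 : Tendsto (fun j => eLpNorm (fun z => gx j z - gx' z) 2 (cylMeasure s (halfSpace n)))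
      atTop (𝓝 0))
    (s2 : Tendsto (fun j => eLpNorm (fun z => gy j z - gy' z) 2 (cylMeasure s (halfSpace n)))
      atTop (𝓝 0)) :
    Tendsto (fun j => eLpNorm (fun z => u j z - c z) 2 (gaussOn (halfSpace n))) atTop (𝓝 0) := by
  have hΩ := isOpen_halfSpace n
  obtain ⟨C, hC⟩ := exists_trace_inequality n hs hs1
  have a1 := ((ENNReal.continuous_pow 2).tendsto _).comp s1
  have a2 := ((ENNReal.continuous_pow 2).tendsto _).comp s2
  have a3 := ENNReal.Tendsto.const_mul (a := (C : ℝ≥0∞)) (a1.add a2) (Or.inr (by simp))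
  refine tendsto_zero_of_sq (tendsto_of_tendsto_of_tendsto_of_le_of_le tendsto_const_nhds
    (by simpa using a3) (fun _ => zero_le) fun j => ?_)
  exact hC ((h j).sub hs hs1 hΩ he) ((hu j).sub hs hs1 hΩ hc (h j) he)

/-- The limit of a sequence of elements of finite energy has finite energy, and its last component
is the trace by uniqueness of limits. -/
lemma IsEnergyElement.of_tendsto (hs : 0 < s) (hs1 : s < 1) {f : ℕ → AmbientSpace n s}
    {f' : AmbientSpace n s} (hf : ∀ j, IsEnergyElement (f j)) (hlim : Tendsto f atTop (𝓝 f')) :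
    IsEnergyElement f' := by
  have hΩ := isOpen_halfSpace n
  choose v gx gy u h hu h1 h2 h3 h4 using hf
  have t1 := tendsto_withLp_fst (tendsto_withLp_fst hlim)
  have t2 := tendsto_withLp_snd (tendsto_withLp_fst hlim)
  have t3 := tendsto_withLp_fst (tendsto_withLp_snd hlim)
  have t4 := tendsto_withLp_snd (tendsto_withLp_snd hlim)
  rw [Lp.tendsto_Lp_iff_tendsto_eLpNorm'] at t1 t2 t3 t4
  have s1 : Tendsto (fun j => eLpNorm (fun z => gx j z - f'.fst.fst z) 2
      (cylMeasure s (halfSpace n))) atTop (𝓝 0) :=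
    t1.congr fun j => eLpNorm_congr_ae ((h1 j).sub EventuallyEq.rfl)
  have s2 : Tendsto (fun j => eLpNorm (fun z => gy j z - f'.fst.snd z) 2
      (cylMeasure s (halfSpace n))) atTop (𝓝 0) :=
    t2.congr fun j => eLpNorm_congr_ae ((h2 j).sub EventuallyEq.rfl)
  have s3 : Tendsto (fun j => eLpNorm (fun z => v j z - f'.snd.fst z) 2
      (cylMeasure s (halfSpace n))) atTop (𝓝 0) :=
    t3.congr fun j => eLpNorm_congr_ae ((h3 j).sub EventuallyEq.rfl)
  have s4 : Tendsto (fun j => eLpNorm (fun z => u j z - f'.snd.snd z) 2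
      (gaussOn (halfSpace n))) atTop (𝓝 0) :=
    t4.congr fun j => eLpNorm_congr_ae ((h4 j).sub EventuallyEq.rfl)
  have he := IsEnergy.of_tendsto hΩ.measurableSet h (Lp.memLp _) (Lp.memLp _) (Lp.memLp _) s3 s1 s2
  obtain ⟨c, hc, -⟩ := he.exists_hasTrace hs hs1 hΩ
  refine ⟨_, _, _, c, he, hc, EventuallyEq.rfl, EventuallyEq.rfl, EventuallyEq.rfl, ?_⟩
  have s5 := IsEnergy.tendsto_trace hs hs1 h he hu hc s1 s2
  exact ae_eq_of_tendsto_eLpNorm (fun j => (hu j).1.1) (Lp.memLp f'.snd.snd).1 hc.1.1 s4 s5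

lemma isClosed_energySubmodule (hs : 0 < s) (hs1 : s < 1) :
    IsClosed (energySubmodule n hs hs1 : Set (AmbientSpace n s)) :=
  IsSeqClosed.isClosed fun _ _ hf hlim => IsEnergyElement.of_tendsto hs hs1 hf hlim

lemma lp_norm_sq_eq {X F : Type*} [MeasurableSpace X] {μ : Measure X} [NormedAddCommGroup F]
    (f : Lp F 2 μ) {g : X → F} (h : f =ᵐ[μ] g) : ‖f‖ ^ 2 = (eLpNorm g 2 μ ^ 2).toReal := by
  rw [Lp.norm_def, eLpNorm_congr_ae h, ENNReal.toReal_pow]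

/-- Every right-hand side in `L²` admits a weak solution. -/
theorem exists_isWeakSolution (hs : 0 < s) (hs1 : s < 1) {h : EuclideanSpace ℝ (Fin n) → ℝ}
    (hh : MemLp h 2 (gaussOn (halfSpace n))) :
    ∃ ψ, IsWeakSolution s (halfSpace n) h ψ := by
  obtain ⟨C, hC⟩ := exists_trace_inequality n hs hs1
  let l : AmbientSpace n s →L[ℝ] ℝ := extConst s • (innerSL ℝ (hh.toLp h)).comp
    ((WithLp.sndL 2 ℝ _ _).comp (WithLp.sndL 2 ℝ (GradSpace n s) (ValueSpace n s)))
  obtain ⟨w, hw, hwl⟩ := exists_inner_eq_of_coercive (energySubmodule n hs hs1)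
    (isClosed_energySubmodule hs hs1) (WithLp.fstL 2 ℝ (GradSpace n s) (ValueSpace n s))
    (C := 2 + C) (by positivity) (by
      -- coercivity: the Poincaré inequality bounds the values and the trace inequality the trace
      rintro f ⟨v, gx, gy, u, he, hu, h1, h2, h3, h4⟩
      change ‖f‖ ^ 2 ≤ (2 + C) * ‖f.fst‖ ^ 2
      have fx := (ENNReal.pow_lt_top he.memLp_x.2 (n := 2)).ne
      have fy := (ENNReal.pow_lt_top he.memLp_y.2 (n := 2)).ne
      have p1 := ENNReal.toReal_mono fx he.poincare
      have p2 := ENNReal.toReal_mono (ENNReal.mul_ne_top (by simp) (ENNReal.add_ne_top.2 ⟨fx, fy⟩))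
        (hC he hu)
      rw [ENNReal.toReal_mul, ENNReal.toReal_add fx fy, ENNReal.coe_toReal,
        ← lp_norm_sq_eq _ h1, ← lp_norm_sq_eq _ h2, ← lp_norm_sq_eq _ h4] at p2
      rw [← lp_norm_sq_eq _ h1, ← lp_norm_sq_eq _ h3] at p1
      rw [WithLp.prod_norm_sq_eq_of_L2 f, WithLp.prod_norm_sq_eq_of_L2 f.snd,
        WithLp.prod_norm_sq_eq_of_L2 f.fst]
      nlinarith [sq_nonneg ‖f.fst.snd‖]) l
  obtain ⟨v, gx, gy, u, he, hu, h1, h2, h3, h4⟩ := hw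
  refine ⟨u, v, ⟨gx, gy, he, fun v' vx' vy' u' he' hu' => ?_⟩, hu⟩
  let fx : Lp (EuclideanSpace ℝ (Fin n)) 2 (cylMeasure s (halfSpace n)) := he'.memLp_x.toLp vx'
  let fy : Lp ℝ 2 (cylMeasure s (halfSpace n)) := he'.memLp_y.toLp vy'
  let fv : Lp ℝ 2 (cylMeasure s (halfSpace n)) := he'.memLp.toLp v'
  let fu : Lp ℝ 2 (gaussOn (halfSpace n)) := hu'.1.toLp u'
  let f' : AmbientSpace n s := WithLp.toLp 2 (WithLp.toLp 2 (fx, fy), WithLp.toLp 2 (fv, fu))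
  have hf' := hwl f' ⟨v', vx', vy', u', he', hu', he'.memLp_x.coeFn_toLp,
    he'.memLp_y.coeFn_toLp, he'.memLp.coeFn_toLp, hu'.1.coeFn_toLp⟩
  have e1 : l f' = extConst s * ∫ x, h x * u' x ∂gaussOn (halfSpace n) := by
    change extConst s * ⟪hh.toLp h, fu⟫ = _
    rw [L2.inner_def]
    congr 1
    refine integral_congr_ae ?_
    filter_upwards [hh.coeFn_toLp, hu'.1.coeFn_toLp] with x hx hx'
    rw [hx, hx']
    simp [mul_comm]
  have e2 : ⟪WithLp.fstL 2 ℝ (GradSpace n s) (ValueSpace n s) w,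
      WithLp.fstL 2 ℝ (GradSpace n s) (ValueSpace n s) f'⟫ =
      ∫ z, (⟪gx z, vx' z⟫ + gy z * vy' z) ∂cylMeasure s (halfSpace n) := by
    change ⟪w.fst, f'.fst⟫ = _
    rw [WithLp.prod_inner_apply]
    change ⟪w.fst.fst, fx⟫ + ⟪w.fst.snd, fy⟫ = _
    rw [L2.inner_def, L2.inner_def, ← integral_add (L2.integrable_inner _ _)
      (L2.integrable_inner _ _)]
    refine integral_congr_ae ?_
    filter_upwards [h1, h2, he'.memLp_x.coeFn_toLp, he'.memLp_y.coeFn_toLp] with z a b c d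
    rw [a, b, c, d]
    simp [mul_comm]
  rw [← e2, ← e1]
  exact hf'

end

/-! ### The `L^p` estimate -/

lemma ofReal_integral_norm_sq {X F : Type*} [MeasurableSpace X] [NormedAddCommGroup F]
    {μ : Measure X} {f : X → F} (hf : MemLp f 2 μ) :
    eLpNorm f 2 μ ^ 2 = ENNReal.ofReal (∫ x, ‖f x‖ ^ 2 ∂μ) := by
  rw [eLpNorm_two_sq, ofReal_integral_eq_lintegral_ofReal (hf.integrable_norm_pow two_ne_zero)
    (ae_of_all _ fun x => by positivity)]
  refine lintegral_congr fun x => ?_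
  rw [ENNReal.ofReal_pow (norm_nonneg _), ofReal_norm]

lemma extConst_pos {s : ℝ} (hs : 0 < s) (hs1 : s < 1) : 0 < extConst s := by
  have h1 := Real.Gamma_pos_of_pos hs
  have h2 := Real.Gamma_pos_of_pos (show 0 < 1 - s by linarith)
  unfold extConst
  positivity

/-- Testing the equation with `F(w)` and applying the trace inequality to `G(w)`. -/
lemma exists_energy_estimate (n : ℕ) [NeZero n] {s : ℝ} (hs : 0 < s) (hs1 : s < 1) :
    ∃ C : ℝ, 0 ≤ C ∧ ∀ {h ψ : EuclideanSpace ℝ (Fin n) → ℝ}, IsWeakSolution s (halfSpace n) h ψ →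
      ∀ {F G : ℝ → ℝ} {L M : NNReal} {A : ℝ}, ContDiff ℝ ∞ F → ContDiff ℝ ∞ G → F 0 = 0 →
        G 0 = 0 → (∀ t, ‖deriv F t‖₊ ≤ L) → (∀ t, ‖deriv G t‖₊ ≤ M) →
        (∀ t, deriv G t ^ 2 ≤ A * deriv F t) →
        ∫ x, G (ψ x) ^ 2 ∂gaussOn (halfSpace n) ≤
          C * A * ∫ x, h x * F (ψ x) ∂gaussOn (halfSpace n) := by
  obtain ⟨C, hC⟩ := exists_trace_inequality n hs hs1
  refine ⟨C * extConst s, by have := extConst_pos hs hs1; positivity, ?_⟩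
  rintro h ψ ⟨w, ⟨wx, wy, hw, hweak⟩, hψ⟩ F G L M A hF hG hF0 hG0 hL hM hA
  have hΩ := isOpen_halfSpace n
  have hLF : LipschitzWith L F := lipschitzWith_of_nnnorm_deriv_le (hF.differentiable (by simp)) hL
  have hLG : LipschitzWith M G := lipschitzWith_of_nnnorm_deriv_le (hG.differentiable (by simp)) hM
  have heF := hw.comp hs hs1 hΩ hF hF0 hL
  have heG := hw.comp hs hs1 hΩ hG hG0 hM
  have htG := hψ.comp hLG hG0
  have key := hweak _ _ _ _ heF (hψ.comp hLF hF0)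
  have tr := hC heG htG
  rw [ofReal_integral_norm_sq heG.memLp_x, ofReal_integral_norm_sq heG.memLp_y,
    ofReal_integral_norm_sq htG.1, ← ENNReal.ofReal_add (integral_nonneg fun _ => by positivity)
      (integral_nonneg fun _ => by positivity), ← ENNReal.ofReal_coe_nnreal,
    ← ENNReal.ofReal_mul (by positivity),
    ← integral_add (heG.memLp_x.integrable_norm_pow two_ne_zero)
      (heG.memLp_y.integrable_norm_pow two_ne_zero),
    ENNReal.ofReal_le_ofReal_iff (mul_nonneg (by positivity)
      (integral_nonneg fun _ => by positivity))] at tr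
  simp only [Real.norm_eq_abs, sq_abs] at tr
  refine tr.trans ?_
  rw [mul_assoc, mul_assoc]
  refine mul_le_mul_of_nonneg_left ?_ (by positivity)
  rw [mul_left_comm, ← key, ← integral_const_mul]
  have hi1 : Integrable (fun z => ⟪wx z, deriv F (w z) • wx z⟫) (cylMeasure s (halfSpace n)) :=
    (hw.memLp_x.norm.integrable_mul heF.memLp_x.norm).mono
      (hw.memLp_x.1.inner heF.memLp_x.1) (ae_of_all _ fun z => by
        simpa using abs_real_inner_le_norm _ _)
  have hi2 : Integrable (fun z => wy z * (deriv F (w z) * wy z)) (cylMeasure s (halfSpace n)) :=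
    hw.memLp_y.integrable_mul heF.memLp_y
  refine integral_mono_of_nonneg (ae_of_all _ fun z => by positivity)
    ((hi1.add hi2).const_mul A) (ae_of_all _ fun z => ?_)
  simp only
  rw [real_inner_smul_right, real_inner_self_eq_norm_sq, norm_smul, mul_pow, Real.norm_eq_abs,
    sq_abs]
  have := hA (w z)
  nlinarith [mul_le_mul_of_nonneg_right this (sq_nonneg ‖wx z‖),
    mul_le_mul_of_nonneg_right this (sq_nonneg (wy z))]

/-- A smooth bounded truncation of the identity, converging to it as `ε → 0`. -/
def softTrunc (ε t : ℝ) : ℝ := t / √(1 + ε * t ^ 2)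

/-- A smooth regularization of `t |t|^{2q}`. -/
def regPow (δ q t : ℝ) : ℝ := t * (δ + t ^ 2) ^ q

section
variable {ε δ q : ℝ}

lemma contDiff_softTrunc (hε : 0 ≤ ε) : ContDiff ℝ ∞ (softTrunc ε) := by
  have h : ∀ t : ℝ, 1 + ε * t ^ 2 ≠ 0 := fun t => by positivity
  unfold softTrunc
  refine contDiff_id.div (ContDiff.sqrt (by fun_prop) h) fun t => ?_
  exact Real.sqrt_ne_zero'.2 (by positivity)

lemma hasDerivAt_softTrunc (hε : 0 ≤ ε) (t : ℝ) :
    HasDerivAt (softTrunc ε) ((1 + ε * t ^ 2) * √(1 + ε * t ^ 2))⁻¹ t := by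
  have hu : 0 < 1 + ε * t ^ 2 := by positivity
  have h1 : HasDerivAt (fun t : ℝ => 1 + ε * t ^ 2) (ε * (2 * t)) t := by
    simpa using (((hasDerivAt_pow 2 t).const_mul ε).const_add 1)
  have h2 := (hasDerivAt_id t).div (h1.sqrt hu.ne') (Real.sqrt_ne_zero'.2 hu)
  refine h2.congr_deriv ?_
  have h3 := Real.sq_sqrt hu.le
  have h4 : √(1 + ε * t ^ 2) ≠ 0 := Real.sqrt_ne_zero'.2 hu
  simp only [id]
  rw [h3]
  field_simp
  rw [h3]
  ring

lemma one_le_mul_sqrt (hε : 0 ≤ ε) (t : ℝ) : 1 ≤ (1 + ε * t ^ 2) * √(1 + ε * t ^ 2) := by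
  have hu : 1 ≤ 1 + ε * t ^ 2 := by
    have : 0 ≤ ε * t ^ 2 := by positivity
    linarith
  have h2 : 1 ≤ √(1 + ε * t ^ 2) := Real.one_le_sqrt.2 hu
  nlinarith

lemma softTrunc_sq_le (hε : 0 < ε) (t : ℝ) : softTrunc ε t ^ 2 ≤ ε⁻¹ := by
  rw [softTrunc, div_pow, Real.sq_sqrt (by positivity), div_le_iff₀ (by positivity),
    le_inv_mul_iff₀ hε]
  linarith

lemma contDiff_regPow (hδ : 0 < δ) : ContDiff ℝ ∞ (regPow δ q) := by
  unfold regPow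
  exact contDiff_id.mul (ContDiff.rpow_const_of_ne (by fun_prop) fun t => by positivity)

lemma hasDerivAt_regPow (hδ : 0 < δ) (t : ℝ) :
    HasDerivAt (regPow δ q)
      ((δ + t ^ 2) ^ q + 2 * q * (t ^ 2 * (δ + t ^ 2) ^ (q - 1))) t := by
  have hu : 0 < δ + t ^ 2 := by positivity
  have h1 : HasDerivAt (fun t : ℝ => δ + t ^ 2) (2 * t) t := by
    simpa using (hasDerivAt_pow 2 t).const_add δ
  have h2 := (hasDerivAt_id t).mul (h1.rpow_const (p := q) (Or.inl hu.ne'))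
  refine h2.congr_deriv ?_
  simp only [id]
  ring

lemma le_deriv_regPow (hδ : 0 < δ) (hq : 0 ≤ q) (t : ℝ) :
    (δ + t ^ 2) ^ q ≤ deriv (regPow δ q) t := by
  rw [(hasDerivAt_regPow hδ t).deriv]
  have : 0 ≤ 2 * q * (t ^ 2 * (δ + t ^ 2) ^ (q - 1)) := by positivity
  linarith

lemma deriv_regPow_le (hδ : 0 < δ) (hq : 0 ≤ q) (t : ℝ) :
    deriv (regPow δ q) t ≤ (1 + 2 * q) * (δ + t ^ 2) ^ q := by
  rw [(hasDerivAt_regPow hδ t).deriv]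
  have hu : 0 < δ + t ^ 2 := by positivity
  have h1 : (δ + t ^ 2) ^ q = (δ + t ^ 2) * (δ + t ^ 2) ^ (q - 1) := by
    rw [Real.rpow_sub_one hu.ne']; field_simp
  have h2 : t ^ 2 * (δ + t ^ 2) ^ (q - 1) ≤ (δ + t ^ 2) ^ q := by
    rw [h1]
    gcongr
    linarith
  nlinarith

lemma deriv_regPow_softTrunc (hδ : 0 < δ) (hε : 0 ≤ ε) (t : ℝ) :
    deriv (fun t => regPow δ q (softTrunc ε t)) t =
      deriv (regPow δ q) (softTrunc ε t) * ((1 + ε * t ^ 2) * √(1 + ε * t ^ 2))⁻¹ :=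
  (((contDiff_regPow hδ).differentiable (by simp) _).hasDerivAt.comp t
    (hasDerivAt_softTrunc hε t)).deriv

lemma nnnorm_deriv_regPow_softTrunc_le (hδ : 0 < δ) (hε : 0 < ε) (hq : 0 ≤ q) (t : ℝ) :
    ‖deriv (fun t => regPow δ q (softTrunc ε t)) t‖₊ ≤
      ((1 + 2 * q) * (δ + ε⁻¹) ^ q).toNNReal := by
  rw [← NNReal.coe_le_coe, coe_nnnorm, Real.coe_toNNReal _ (by positivity),
    deriv_regPow_softTrunc hδ hε.le]
  have h0 : 0 ≤ deriv (regPow δ q) (softTrunc ε t) :=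
    le_trans (by positivity) (le_deriv_regPow hδ hq _)
  have h1 := inv_le_one_of_one_le₀ (one_le_mul_sqrt hε.le t)
  have h2 : 0 ≤ ((1 + ε * t ^ 2) * √(1 + ε * t ^ 2))⁻¹ := by positivity
  rw [Real.norm_of_nonneg (mul_nonneg h0 h2)]
  calc _ ≤ deriv (regPow δ q) (softTrunc ε t) := mul_le_of_le_one_right h0 h1
    _ ≤ (1 + 2 * q) * (δ + softTrunc ε t ^ 2) ^ q := deriv_regPow_le hδ hq _
    _ ≤ _ := by
      gcongr
      exact softTrunc_sq_le hε t

/-- The pointwise inequality `(G')² ≤ (1 + q)² F'` between the two nonlinearities. -/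
lemma deriv_sq_regPow_softTrunc_le (hδ : 0 < δ) (hε : 0 ≤ ε) (hq : 0 ≤ q) (t : ℝ) :
    deriv (fun t => regPow δ (q / 2) (softTrunc ε t)) t ^ 2 ≤
      (1 + q) ^ 2 * deriv (fun t => regPow δ q (softTrunc ε t)) t := by
  rw [deriv_regPow_softTrunc hδ hε, deriv_regPow_softTrunc hδ hε]
  set τ := softTrunc ε t
  set d := ((1 + ε * t ^ 2) * √(1 + ε * t ^ 2))⁻¹ with hd
  have hd0 : 0 ≤ d := by positivity
  have hd1 : d ≤ 1 := inv_le_one_of_one_le₀ (one_le_mul_sqrt hε t)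
  have hu : 0 < δ + τ ^ 2 := by positivity
  have h1 := le_deriv_regPow hδ hq τ
  have h2 := deriv_regPow_le hδ (show 0 ≤ q / 2 by positivity) τ
  have h3 : 0 ≤ deriv (regPow δ (q / 2)) τ :=
    le_trans (by positivity) (le_deriv_regPow hδ (by positivity) _)
  have h4 : ((δ + τ ^ 2) ^ (q / 2)) ^ 2 = (δ + τ ^ 2) ^ q := by
    rw [← Real.rpow_natCast, ← Real.rpow_mul hu.le]
    norm_num
  have h5 : deriv (regPow δ (q / 2)) τ ^ 2 ≤ (1 + q) ^ 2 * (δ + τ ^ 2) ^ q := by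
    rw [← h4, ← mul_pow]
    refine pow_le_pow_left₀ h3 (h2.trans (le_of_eq ?_)) 2
    ring
  have h6 : 0 ≤ deriv (regPow δ q) τ := le_trans (by positivity) h1
  calc (deriv (regPow δ (q / 2)) τ * d) ^ 2 = deriv (regPow δ (q / 2)) τ ^ 2 * (d * d) := by ring
    _ ≤ ((1 + q) ^ 2 * deriv (regPow δ q) τ) * (d * 1) := by
      gcongr
      exact h5.trans (by gcongr)
    _ = _ := by ring

end

lemma abs_mul_sq_rpow {t q : ℝ} (hq : 0 ≤ q) : |t| * (t ^ 2) ^ q = |t| ^ (2 * q + 1) := by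
  rw [Real.rpow_add' (abs_nonneg _) (by linarith), Real.rpow_one, Real.rpow_mul (abs_nonneg _),
    ← sq_abs t, Real.rpow_two, mul_comm]

lemma rpow_sq_mul {t q : ℝ} (hq : 0 ≤ q) : t ^ 2 * (t ^ 2) ^ q = |t| ^ (2 * q + 2) := by
  rw [Real.rpow_add' (abs_nonneg _) (by linarith), Real.rpow_mul (abs_nonneg _),
    ← sq_abs t, Real.rpow_two, mul_comm]

/-- The estimate for the truncated solution, before an application of Hölder's inequality. -/
lemma exists_integral_softTrunc_le (n : ℕ) [NeZero n] {s : ℝ} (hs : 0 < s) (hs1 : s < 1) {r : ℝ}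
    (hr : 2 ≤ r) :
    ∃ K : ℝ, 0 ≤ K ∧ ∀ {h ψ : EuclideanSpace ℝ (Fin n) → ℝ}, MemLp h 2 (gaussOn (halfSpace n)) →
      IsWeakSolution s (halfSpace n) h ψ → ∀ {ε : ℝ}, 0 < ε →
      ∫ x, |softTrunc ε (ψ x)| ^ r ∂gaussOn (halfSpace n) ≤
        K * ∫ x, |h x| * |softTrunc ε (ψ x)| ^ (r - 1) ∂gaussOn (halfSpace n) := by
  obtain ⟨C, hC0, hC⟩ := exists_energy_estimate n hs hs1
  -- with this exponent `regPow δ q` approximates `t |t|^{r-2}` and `regPow δ (q / 2)` approximates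
  -- `t |t|^{r/2-1}`
  set q := r / 2 - 1 with hq
  have hq0 : 0 ≤ q := by rw [hq]; linarith
  refine ⟨C * (1 + q) ^ 2, by positivity, fun {h ψ} hh hw {ε} hε => ?_⟩
  have hψ : MemLp ψ 2 (gaussOn (halfSpace n)) := by
    obtain ⟨w, -, hψ⟩ := hw
    exact hψ.1
  set γ := gaussOn (halfSpace n) with hγ
  set τ : EuclideanSpace ℝ (Fin n) → ℝ := fun x => softTrunc ε (ψ x) with hτ
  have hτm : AEStronglyMeasurable τ γ :=
    (contDiff_softTrunc hε.le).continuous.comp_aestronglyMeasurable hψ.1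
  have hτ2 : ∀ x, τ x ^ 2 ≤ ε⁻¹ := fun x => softTrunc_sq_le hε _
  have hτa : ∀ x, |τ x| ≤ √ε⁻¹ := fun x => Real.abs_le_sqrt (hτ2 x)
  have hhi : Integrable h γ := hh.integrable (by norm_num)
  -- the estimate for the regularized nonlinearity
  have hδ : ∀ δ : ℝ, 0 < δ → ∫ x, |τ x| ^ r ∂γ ≤
      C * (1 + q) ^ 2 * ∫ x, |h x| * (|τ x| * (δ + τ x ^ 2) ^ q) ∂γ := by
    intro δ hδ
    have h1 := hC hw (F := fun t => regPow δ q (softTrunc ε t))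
      (G := fun t => regPow δ (q / 2) (softTrunc ε t))
      ((contDiff_regPow hδ).comp (contDiff_softTrunc hε.le))
      ((contDiff_regPow hδ).comp (contDiff_softTrunc hε.le)) (by simp [softTrunc, regPow])
      (by simp [softTrunc, regPow]) (nnnorm_deriv_regPow_softTrunc_le hδ hε hq0)
      (nnnorm_deriv_regPow_softTrunc_le hδ hε (by positivity))
      (deriv_sq_regPow_softTrunc_le hδ hε.le hq0)
    have hbd : ∀ x, |τ x| * (δ + τ x ^ 2) ^ q ≤ √ε⁻¹ * (δ + ε⁻¹) ^ q := fun x => by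
      gcongr
      · exact hτa x
      · exact hτ2 x
    have hm : ∀ e : ℝ, AEStronglyMeasurable (fun x => (δ + τ x ^ 2) ^ e) γ := fun e =>
      (((hτm.aemeasurable.pow_const 2).const_add δ).pow_const e).aestronglyMeasurable
    have hi : Integrable (fun x => |h x| * (|τ x| * (δ + τ x ^ 2) ^ q)) γ :=
      hhi.abs.mul_bdd (c := √ε⁻¹ * (δ + ε⁻¹) ^ q) (hτm.norm.mul (hm q))
        (ae_of_all _ fun x => by
          rw [Real.norm_of_nonneg (by positivity)]
          exact hbd x)
    have hi2 : Integrable (fun x => regPow δ (q / 2) (τ x) ^ 2) γ := by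
      refine Integrable.of_bound (C := ε⁻¹ * (δ + ε⁻¹) ^ q)
        (((contDiff_regPow hδ).continuous.comp_aestronglyMeasurable hτm).pow 2)
        (ae_of_all _ fun x => ?_)
      have e2 : q / 2 * ((2 : ℕ) : ℝ) = q := by norm_num
      rw [Real.norm_of_nonneg (sq_nonneg _), regPow, mul_pow,
        ← Real.rpow_natCast (_ ^ (q / 2)) 2, ← Real.rpow_mul (by positivity), e2]
      have := hτ2 x
      gcongr
    calc ∫ x, |τ x| ^ r ∂γ ≤ ∫ x, regPow δ (q / 2) (τ x) ^ 2 ∂γ := by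
          refine integral_mono_of_nonneg (ae_of_all _ fun x => by positivity) hi2
            (ae_of_all _ fun x => ?_)
          have e1 : r = 2 * q + 2 := by rw [hq]; ring
          simp only
          rw [e1, ← rpow_sq_mul hq0, regPow, mul_pow, ← Real.rpow_natCast (_ ^ (q / 2)) 2,
            ← Real.rpow_mul (by positivity)]
          have e2 : q / 2 * ((2 : ℕ) : ℝ) = q := by norm_num
          rw [e2]
          gcongr
          linarith
      _ ≤ C * (1 + q) ^ 2 * ∫ x, h x * regPow δ q (τ x) ∂γ := h1
      _ ≤ _ := by
          refine mul_le_mul_of_nonneg_left ?_ (by positivity)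
          refine (le_abs_self _).trans ((abs_integral_le_integral_abs).trans ?_)
          refine le_of_eq (integral_congr_ae (ae_of_all _ fun x => ?_))
          simp only [regPow, abs_mul]
          rw [abs_of_nonneg (a := (δ + τ x ^ 2) ^ q) (by positivity)]
  -- remove the regularization by dominated convergence
  have hlim : Tendsto (fun k : ℕ => ∫ x, |h x| * (|τ x| * (1 / ((k : ℝ) + 1) + τ x ^ 2) ^ q) ∂γ)
      atTop (𝓝 (∫ x, |h x| * |τ x| ^ (r - 1) ∂γ)) := by
    refine tendsto_integral_of_dominated_convergence
      (fun x => |h x| * (√ε⁻¹ * (1 + ε⁻¹) ^ q)) (fun k => ?_) (hhi.abs.mul_const _)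
      (fun k => ae_of_all _ fun x => ?_) (ae_of_all _ fun x => ?_)
    · exact hh.1.norm.mul (hτm.norm.mul
        (((hτm.aemeasurable.pow_const 2).const_add _).pow_const q).aestronglyMeasurable)
    · rw [Real.norm_of_nonneg (by positivity)]
      have h1 : 1 / ((k : ℝ) + 1) ≤ 1 := by
        rw [div_le_one (by positivity)]
        have : (0 : ℝ) ≤ k := by positivity
        linarith
      gcongr
      · exact hτa x
      · exact hτ2 x
    · have e1 : r - 1 = 2 * q + 1 := by rw [hq]; ring
      rw [e1, ← abs_mul_sq_rpow hq0]
      refine Tendsto.const_mul _ (Tendsto.const_mul _ ?_)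
      have h1 : Tendsto (fun k : ℕ => 1 / ((k : ℝ) + 1) + τ x ^ 2) atTop (𝓝 (0 + τ x ^ 2)) :=
        tendsto_one_div_add_atTop_nhds_zero_nat.add_const _
      rw [zero_add] at h1
      exact h1.rpow_const (Or.inr hq0)
  exact ge_of_tendsto' (hlim.const_mul _) fun k => hδ _ (by positivity)

lemma tendsto_softTrunc (t : ℝ) :
    Tendsto (fun k : ℕ => softTrunc (1 / ((k : ℝ) + 1)) t) atTop (𝓝 t) := by
  have h1 : Tendsto (fun k : ℕ => 1 + 1 / ((k : ℝ) + 1) * t ^ 2) atTop (𝓝 (1 + 0 * t ^ 2)) :=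
    (tendsto_one_div_add_atTop_nhds_zero_nat.mul_const _).const_add _
  rw [zero_mul, add_zero] at h1
  have h2 := (tendsto_const_nhds (x := t)).div h1.sqrt (by simp)
  simpa [softTrunc, Pi.div_def] using h2

/-- Weak solutions inherit the integrability of the right-hand side. -/
theorem exists_eLpNorm_le (n : ℕ) [NeZero n] {s : ℝ} (hs : 0 < s) (hs1 : s < 1) {p : ℝ≥0∞}
    (hp2 : 2 ≤ p) (hp : p ≠ ⊤) :
    ∃ K : ℝ, 0 ≤ K ∧ ∀ {h ψ : EuclideanSpace ℝ (Fin n) → ℝ}, MemLp h p (gaussOn (halfSpace n)) →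
      IsWeakSolution s (halfSpace n) h ψ →
      eLpNorm ψ p (gaussOn (halfSpace n)) ≤
        ENNReal.ofReal K * eLpNorm h p (gaussOn (halfSpace n)) := by
  set r := p.toReal with hr
  have hpr : ENNReal.ofReal r = p := ENNReal.ofReal_toReal hp
  have hr2 : 2 ≤ r := by
    have := ENNReal.toReal_mono hp hp2
    simpa using this
  obtain ⟨K, hK0, hK⟩ := exists_integral_softTrunc_le n hs hs1 hr2
  refine ⟨K, hK0, fun {h ψ} hh hw => ?_⟩
  set γ := gaussOn (halfSpace n) with hγ
  have hψ : AEStronglyMeasurable ψ γ := by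
    obtain ⟨w, -, hψ⟩ := hw
    exact hψ.1.1
  have hh2 : MemLp h 2 γ := hh.mono_exponent hp2
  have hp0 : p ≠ 0 := fun h0 => by simp [h0] at hp2
  have hτm : ∀ ε : ℝ, 0 < ε → AEStronglyMeasurable (fun x => softTrunc ε (ψ x)) γ := fun ε hε =>
    (contDiff_softTrunc hε.le).continuous.comp_aestronglyMeasurable hψ
  have key : ∀ ε : ℝ, 0 < ε →
      eLpNorm (fun x => softTrunc ε (ψ x)) p γ ≤ ENNReal.ofReal K * eLpNorm h p γ := by
    intro ε hε
    have hτa : ∀ x, ‖softTrunc ε (ψ x)‖ ≤ √ε⁻¹ := fun x =>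
      Real.abs_le_sqrt (softTrunc_sq_le hε _)
    have hτL : MemLp (fun x => softTrunc ε (ψ x)) p γ :=
      MemLp.of_bound (hτm ε hε) _ (ae_of_all _ hτa)
    have hconj : r.HolderConjugate r.conjExponent :=
      Real.HolderConjugate.conjExponent (by linarith)
    have hb : MemLp (fun x => |softTrunc ε (ψ x)| ^ (r - 1)) (ENNReal.ofReal r.conjExponent) γ := by
      refine MemLp.of_bound (C := √ε⁻¹ ^ (r - 1))
        ((hτm ε hε).norm.aemeasurable.pow_const _).aestronglyMeasurable (ae_of_all _ fun x => ?_)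
      rw [Real.norm_of_nonneg (by positivity)]
      exact Real.rpow_le_rpow (abs_nonneg _) (hτa x) (by linarith)
    have hold := integral_mul_le_Lp_mul_Lq_of_nonneg hconj (μ := γ) (f := fun x => |h x|)
      (g := fun x => |softTrunc ε (ψ x)| ^ (r - 1)) (ae_of_all _ fun x => abs_nonneg _)
      (ae_of_all _ fun x => by positivity) (by rw [hpr]; exact hh.norm) hb
    have hexp : ∀ x, (|softTrunc ε (ψ x)| ^ (r - 1)) ^ r.conjExponent =
        |softTrunc ε (ψ x)| ^ r := by
      intro x
      rw [← Real.rpow_mul (abs_nonneg _), Real.conjExponent]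
      congr 1
      have : r - 1 ≠ 0 := by linarith
      field_simp
    simp only [hexp] at hold
    set I := ∫ x, |softTrunc ε (ψ x)| ^ r ∂γ with hI
    set N := (∫ x, |h x| ^ r ∂γ) ^ (1 / r) with hN
    have hI0 : 0 ≤ I := integral_nonneg fun x => by positivity
    have hN0 : 0 ≤ N := by
      have : 0 ≤ ∫ x, |h x| ^ r ∂γ := integral_nonneg fun x => by positivity
      positivity
    have hIle : I ≤ K * (N * I ^ (1 / r.conjExponent)) :=
      (hK hh2 hw hε).trans (mul_le_mul_of_nonneg_left hold hK0)
    -- divide by `I^{1 - 1/r}`, which is finite thanks to the truncation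
    have hfinal : I ^ (1 / r) ≤ K * N := by
      rcases hI0.eq_or_lt with h0 | hpos
      · rw [← h0, Real.zero_rpow (by positivity)]
        positivity
      · have hsplit : I = I ^ (1 / r) * I ^ (1 / r.conjExponent) := by
          rw [← Real.rpow_add hpos, one_div, one_div, hconj.inv_add_inv_eq_one, Real.rpow_one]
        have hpos' : 0 < I ^ (1 / r.conjExponent) := Real.rpow_pos_of_pos hpos _
        refine le_of_mul_le_mul_right ?_ hpos'
        rw [← hsplit, mul_assoc]
        exact hIle
    rw [hτL.eLpNorm_eq_integral_rpow_norm hp0 hp, hh.eLpNorm_eq_integral_rpow_norm hp0 hp,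
      ← ENNReal.ofReal_mul hK0]
    refine ENNReal.ofReal_le_ofReal ?_
    simpa [hI, hN, ← hr] using hfinal
  -- remove the truncation by Fatou's lemma
  have hpos : ∀ k : ℕ, (0 : ℝ) < 1 / ((k : ℝ) + 1) := fun k => by positivity
  refine (Lp.eLpNorm_lim_le_liminf_eLpNorm (fun k : ℕ => hτm _ (hpos k)) ψ
    (ae_of_all _ fun x => tendsto_softTrunc (ψ x))).trans ?_
  exact liminf_le_of_le (by isBoundedDefault) fun b hb => by
    obtain ⟨k, hk⟩ := hb.exists
    exact hk.trans (key _ (hpos k))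

end FracOU

end

theorem mainTheorem5 (n : ℕ) [NeZero n] (s : ℝ) (hs0 : 0 < s) (hs1 : s < 1)
    (p : ℝ≥0∞) (hp2 : 2 ≤ p) (hp : p ≠ ⊤) :
    ∃ C : ℝ, 0 < C ∧
      ∀ h : EuclideanSpace ℝ (Fin n) → ℝ,
        MemLp h p (FracOU.gaussOn (FracOU.halfSpace n)) → FracOU.IsRearranged h →
        (∃ ψ : EuclideanSpace ℝ (Fin n) → ℝ,
          FracOU.IsWeakSolution s (FracOU.halfSpace n) h ψ) ∧
        ∀ ψ : EuclideanSpace ℝ (Fin n) → ℝ,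
          FracOU.IsWeakSolution s (FracOU.halfSpace n) h ψ →
          MemLp ψ p (FracOU.gaussOn (FracOU.halfSpace n)) ∧
          eLpNorm ψ p (FracOU.gaussOn (FracOU.halfSpace n)) ≤
            ENNReal.ofReal C * eLpNorm h p (FracOU.gaussOn (FracOU.halfSpace n)) := by
  obtain ⟨K, hK0, hK⟩ := FracOU.exists_eLpNorm_le n hs0 hs1 hp2 hp
  -- `K` may vanish
  refine ⟨K + 1, by positivity, fun h hh _ =>
    ⟨FracOU.exists_isWeakSolution hs0 hs1 (hh.mono_exponent hp2), fun ψ hψ => ?_⟩⟩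
  have hle : eLpNorm ψ p (FracOU.gaussOn (FracOU.halfSpace n)) ≤
      ENNReal.ofReal (K + 1) * eLpNorm h p (FracOU.gaussOn (FracOU.halfSpace n)) :=
    (hK hh hψ).trans (by gcongr; linarith)
  obtain ⟨w, -, hw⟩ := id hψ
  exact ⟨⟨hw.1.1, hle.trans_lt (ENNReal.mul_lt_top ENNReal.ofReal_lt_top hh.2)⟩, hle⟩
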